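/- Let $d\ge 3$ be odd. For $j\in\mathbb Z$ let $\chi_j$ be the characteristic function of the channel $$\Omega_j=\{(x,t)\in\mathbb R^d\times\mathbb R:\ |t|+2^j\le |x|<|t|+2^{j+1}\},$$ and write $$\|u\|_{L^pL^q(\mathbb R\times\mathbb R^d)}=\Big(\int_{\mathbb R}\Big(\int_{\mathbb R^d}|u(x,t)|^q\,dx\Big)^{p/q}dt\Big)^{1/p}$$ (exponent $p$ in time, exponent $q$ in space). For $s\in\mathbb R$ let $\dot H^s(\mathbb R^d)$ be the space of tempered distributions $f$ whose Fourier transform $\hat f$ is a locally integrable function with $$\|f\|_{\dot H^s}=\Big(\int_{\mathbb R^d}(2\pi|\xi|)^{2s}|\hat f(\xi)|^2\,d\xi\Big)^{1/2}<\infty,\qquad \hat f(\xi)=\int_{\mathbb R^d} e^{-2\pi i x\cdot\xi}f(x)\,dx ,$$ and put $\|(u_0,u_1)\|_{\dot H^\beta\times\dot H^{\beta-1}}=(\|u_0\|_{\dot H^\beta}^2+\|u_1\|_{\dot H^{\beta-1}}^2)^{1/2}$. **Theorem.** Let $d\ge 3$ be odd, let $\beta\in(1/2,3/2)$, and let $p,q,\tilde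 p,\tilde q\in[1,\infty)$ satisfy $$\frac1p+\frac dq=\frac d2-\beta,\qquad \frac1{\tilde p}+\frac d{\tilde q}=\frac d2-\beta+2 .$$ Then there is a constant $C>0$, depending only on $d,\beta,p,q,\tilde p,\tilde q$, such that the following holds. Let $u,F:\mathbb R^d\times\mathbb R\to\mathbb C$ be locally integrable, with $u$ radial in $x$, let $(u_0,u_1)\in\dot H^\beta\times\dot H^{\beta-1}(\mathbb R^d)$, and suppose that $u$ solves $$\partial_t^2u-\Delta u=F\ \text{ on }\mathbb R^d\times\mathbb R,\qquad (u,\partial_tu)|_{t=0}=(u_0,u_1)$$ in the sense of distributions, that is, for every $\varphi\in C_c^\infty(\mathbb R^d\times\mathbb R)$, $$\int_{\pm t>0}u\,(\partial_t^2\varphi-\Delta\varphi)\,dx\,dt=\int_{\pm t>0}F\varphi\,dx\,dt\ \pm\ \big(\langle u_1,\varphi(\cdot,0)\rangle-\langle u_0,\partial_t\varphi(\cdot,0)\rangle\big)$$ for both choices of the sign. Then $$\Big(\sum_{j\in\mathbb Z}\|\chi_ju\|_{L^pL^q(\mathbb R\times\mathbb R^d)}^2\Big)^{1/2}\le C\Big[\|(u_0,u_1)\|_{\dot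 H^\beta\times\dot H^{\beta-1}(\mathbb R^d)}+\Big(\sum_{k\in\mathbb Z}\|\chi_kF\|_{L^{\tilde p}L^{\tilde q}(\mathbb R\times\mathbb R^d)}^2\Big)^{1/2}\Big].$$ Both sides are read in $[0,\infty]$; in particular, the left side is finite whenever the right side is. -/

import Mathlib

open MeasureTheory Set
open scoped ENNReal ContDiff SchwartzMap FourierTransform Laplacian

noncomputable section

namespace ChannelStrichartz

/-- Euclidean space `ℝ^d`. -/
abbrev Space (d : ℕ) : Type := EuclideanSpace ℝ (Fin d)

/-- The channel `Ω_j = {(x, t) : |t| + 2^j ≤ |x| < |t| + 2^(j+1)}`. -/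
def channel (d : ℕ) (j : ℤ) : Set (Space d × ℝ) :=
  {z | |z.2| + (2 : ℝ) ^ j ≤ ‖z.1‖ ∧ ‖z.1‖ < |z.2| + (2 : ℝ) ^ (j + 1)}

/-- The space-time norm `‖u‖_{L^p L^q(ℝ × ℝ^d)} = (∫ (∫ |u(x,t)|^q dx)^(p/q) dt)^(1/p)`
(exponent `p` in time, exponent `q` in space), with values in `[0, ∞]`. -/
def mixedNorm {d : ℕ} (p q : ℝ) (u : Space d × ℝ → ℂ) : ℝ≥0∞ :=
  (∫⁻ t : ℝ, (∫⁻ x : Space d, ‖u (x, t)‖ₑ ^ q) ^ (p / q)) ^ (1 / p)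

/-- The `l^2` sum over all channels, `(∑_j ‖χ_j u‖_{L^p L^q}^2)^(1/2)`, where `χ_j` is the
characteristic function of `Ω_j`. -/
def channelNorm {d : ℕ} (p q : ℝ) (u : Space d × ℝ → ℂ) : ℝ≥0∞ :=
  (∑' j : ℤ, mixedNorm p q ((channel d j).indicator u) ^ (2 : ℝ)) ^ (1 / 2 : ℝ)

/-- The Fourier transform of the tempered distribution `f` is the locally integrable
function `g`. -/
def HasFourierDensity {d : ℕ} (f : 𝓢'(Space d, ℂ)) (g : Space d → ℂ) : Prop :=
  LocallyIntegrable g ∧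
    ∀ φ : 𝓢(Space d, ℂ), Integrable (fun ξ => φ ξ * g ξ) ∧ (𝓕 f) φ = ∫ ξ, φ ξ * g ξ

/-- The norm of the homogeneous Sobolev space `Ḣ^s(ℝ^d)`: it is
`(∫ (2π|ξ|)^(2s) |g(ξ)|^2 dξ)^(1/2)` if the Fourier transform of `f` is a locally integrable
function `g` (which is then unique almost everywhere), and `∞` otherwise. The space `Ḣ^s`
consists of the tempered distributions for which it is finite. -/
def homSobolevNorm {d : ℕ} (s : ℝ) (f : 𝓢'(Space d, ℂ)) : ℝ≥0∞ :=
  ⨅ (g : Space d → ℂ) (_ : HasFourierDensity f g),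
    (∫⁻ ξ, ENNReal.ofReal (2 * Real.pi * ‖ξ‖) ^ (2 * s) * ‖g ξ‖ₑ ^ (2 : ℝ)) ^ (1 / 2 : ℝ)

/-- The norm of the pair `(u₀, u₁)` in `Ḣ^β × Ḣ^(β-1)`. -/
def dataNorm {d : ℕ} (β : ℝ) (u₀ u₁ : 𝓢'(Space d, ℂ)) : ℝ≥0∞ :=
  (homSobolevNorm β u₀ ^ (2 : ℝ) + homSobolevNorm (β - 1) u₁ ^ (2 : ℝ)) ^ (1 / 2 : ℝ)

/-- Smooth compactly supported test functions on `ℝ^d × ℝ`. -/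
abbrev TestFun (d : ℕ) : Type :=
  TestFunction (⊤ : TopologicalSpace.Opens (Space d × ℝ)) ℂ (⊤ : ℕ∞)

namespace TestFun

variable {d : ℕ} (φ : TestFun d)

/-- The time derivative `∂_t φ`. -/
def dt (z : Space d × ℝ) : ℂ := fderiv ℝ φ z (0, 1)

lemma dt_eq_deriv (x : Space d) (t : ℝ) : dt φ (x, t) = deriv (fun s => φ (x, s)) t := by
  have h1 : HasFDerivAt φ (fderiv ℝ φ (x, t)) (x, t) :=
    ((φ.contDiff.differentiable (by simp)) (x, t)).hasFDerivAt
  have h2 : HasDerivAt (fun s : ℝ => (x, s)) ((0 : Space d), (1 : ℝ)) t :=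
    (hasDerivAt_const t x).prodMk (hasDerivAt_id t)
  exact (h1.comp_hasDerivAt t h2).deriv.symm

lemma contDiff_dt : ContDiff ℝ ∞ (dt φ) :=
  (φ.contDiff.fderiv_right (m := ∞) (by simp)).clm_apply contDiff_const

lemma hasCompactSupport_dt : HasCompactSupport (dt φ) :=
  φ.hasCompactSupport.fderiv_apply ℝ (0, 1)

/-- The d'Alembertian `∂_t^2 φ - Δ φ`, with `Δ` the Laplacian in `x`. -/
def box (z : Space d × ℝ) : ℂ :=
  iteratedDeriv 2 (fun t => φ (z.1, t)) z.2 - (Δ (fun x => φ (x, z.2))) z.1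

lemma isClosedEmbedding_slice : Topology.IsClosedEmbedding (fun x : Space d => (x, (0 : ℝ))) :=
  Topology.IsClosedEmbedding.of_continuous_injective_isClosedMap (by fun_prop)
    (fun _ _ h => (Prod.ext_iff.1 h).1)
    (fun s hs => by
      have : (fun x : Space d => (x, (0 : ℝ))) '' s = s ×ˢ {0} := by
        ext ⟨a, b⟩; simp [eq_comm]
      rw [this]; exact hs.prod isClosed_singleton)

/-- The function `x ↦ φ(x, 0)` as a Schwartz function. -/
def initial : 𝓢(Space d, ℂ) :=
  (φ.hasCompactSupport.comp_isClosedEmbedding isClosedEmbedding_slice).toSchwartzMap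
    (φ.contDiff.comp (contDiff_id.prodMk contDiff_const))

/-- The function `x ↦ ∂_t φ(x, 0)` as a Schwartz function. -/
def initialDt : 𝓢(Space d, ℂ) :=
  ((hasCompactSupport_dt φ).comp_isClosedEmbedding isClosedEmbedding_slice).toSchwartzMap
    ((contDiff_dt φ).comp (contDiff_id.prodMk contDiff_const))

end TestFun

/-- `u` is a (distributional) solution on `ℝ^d × ℝ` of `∂_t^2 u - Δ u = F` with initial data
`(u, ∂_t u)|_{t = 0} = (u₀, u₁)`: integrating by parts against a test function on `t > 0` and
on `t < 0` produces the initial data as boundary terms. -/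
structure IsWaveSolution {d : ℕ} (u F : Space d × ℝ → ℂ) (u₀ u₁ : 𝓢'(Space d, ℂ)) : Prop where
  locallyIntegrable : LocallyIntegrable u
  locallyIntegrable_source : LocallyIntegrable F
  forward : ∀ φ : TestFun d,
    ∫ z in {z : Space d × ℝ | 0 < z.2}, u z * TestFun.box φ z =
      (∫ z in {z : Space d × ℝ | 0 < z.2}, F z * φ z)
        + u₁ (TestFun.initial φ) - u₀ (TestFun.initialDt φ)
  backward : ∀ φ : TestFun d,
    ∫ z in {z : Space d × ℝ | z.2 < 0}, u z * TestFun.box φ z =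
      (∫ z in {z : Space d × ℝ | z.2 < 0}, F z * φ z)
        - u₁ (TestFun.initial φ) + u₀ (TestFun.initialDt φ)

/-- `u(x, t)` depends on `x` only through `|x|`. -/
def IsRadial {d : ℕ} (u : Space d × ℝ → ℂ) : Prop :=
  ∀ (x y : Space d) (t : ℝ), ‖x‖ = ‖y‖ → u (x, t) = u (y, t)

end ChannelStrichartz

end

/-!
The channel norm only sees the exterior `|t| < |x|` of the light cone, and there a radial wave
obeys a pointwise bound without any oscillation. Write `d = 2 n + 3`, so that
`(d - 1) / 2 = n + 1`. The bound is (`exists_pointwise_bound`)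

  `|u(x, t)| ≤ C |x|^(-(n+1)) (D(2 |x|) + S(4 |x|))` for almost every `(x, t)` with `|t| < |x|`,

where `D = dataWeight` is an absolutely convergent integral of the Fourier densities of the
initial data and `S(R) = sourceWeight` is the integral of `|x|^(-(n+1)) |F|` over the part
`|x| + |t| ≤ R` of the exterior.

*The pointwise bound* is proved by duality. For a radial `ψ` supported outside the light cone there
is a test function `φ` with `∂_t² φ - Δ φ = ψ` for positive times (`exists_testFun`). In the
variable `w = |x|²`, each derivative in `w` raises the dimension of the radial wave equation by
two, so `φ` is the `n`-th `w`-derivative of a three-dimensional solution, which d'Alembert's formula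
gives explicitly; this is where odd dimension enters. The formula has an explicit kernel, the
Riemann function, and Huygens' principle (`KernelExpansion.kernel_neg`) restricts it to
`||x| - τ| < √v ≤ |x| + τ`, where it is bounded by a multiple of `√v^n |x|^(-(n+1))`. This controls
the pairing of `φ` with `F` by `S`. For the pairing with the initial data, the Fourier transform of
`φ` in space is a forced harmonic oscillator, hence is bounded at time zero by the time integral of
the Fourier transform of `ψ` (`oscillator_bound`), and the transform of a radial function in `d`
dimensions decays like `(|x| |ξ|)^(-(n+1))` (`exists_radial_fourier_bound`). Letting `ψ` run through
bump functions shrinking to a point gives the bound almost everywhere by Lebesgue's differentiation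
theorem.

*The norm estimates* decompose everything dyadically and use the scaling relations and Schur's test
with geometric kernels (`ell2_geomKernel_le`). The channel norm of a function with the pointwise
bound above is at most the `ℓ²` norm of `2^(-(β-1/2) l)` times the amplitude at radius `~ 2^l`
(`exists_channelNorm_le`). For the source this sequence is controlled by the channel norm of `F`,
using `β > 1/2` (`exists_sourceWeight_le`); for the data it is controlled by the Sobolev norms,
using `1/2 < β < 3/2` (`exists_dataWeight_le`).
-/

noncomputable section

namespace ChannelStrichartz

section

/-! ### Directional derivatives and integrals depending on a parameter -/

section Calculus

variable {P : Type} [NormedAddCommGroup P] [NormedSpace ℝ P]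
  {E : Type} [NormedAddCommGroup E] [NormedSpace ℝ E]

/-- The derivative of `f` in the direction `v`, as a function of the base point. -/
def pd (v : P) (f : P → E) (p : P) : E := fderiv ℝ f p v

lemma smoothOn_pd {f : P → E} {U : Set P} (hU : IsOpen U) (hf : ContDiffOn ℝ ∞ f U) (v : P) :
    ContDiffOn ℝ ∞ (pd v f) U :=
  (hf.fderiv_of_isOpen hU (m := ∞) (by simp)).clm_apply contDiffOn_const

lemma pd_congr {f g : P → E} {U : Set P} (hU : IsOpen U) (h : EqOn f g U) (v : P) :
    EqOn (pd v f) (pd v g) U := fun p hp => by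
  have : f =ᶠ[nhds p] g := Filter.eventuallyEq_of_mem (hU.mem_nhds hp) h
  simp only [pd, this.fderiv_eq]

lemma smoothOn_hasFDerivAt {f : P → E} {U : Set P} (hU : IsOpen U) (hf : ContDiffOn ℝ ∞ f U)
    {p : P} (hp : p ∈ U) : HasFDerivAt f (fderiv ℝ f p) p :=
  ((hf.contDiffAt (hU.mem_nhds hp)).differentiableAt (by simp)).hasFDerivAt

/-- The derivative of a smooth function along a differentiable curve. -/
lemma smoothOn_hasDerivAt_comp {f : P → E} {U : Set P} (hU : IsOpen U)
    (hf : ContDiffOn ℝ ∞ f U) {c : ℝ → P} {c' : P} {s : ℝ} (hc : HasDerivAt c c' s)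
    (hp : c s ∈ U) : HasDerivAt (fun x => f (c x)) (pd c' f (c s)) s :=
  (smoothOn_hasFDerivAt hU hf hp).comp_hasDerivAt s hc

lemma pd_comm {f : P → E} {U : Set P} (hU : IsOpen U) (hf : ContDiffOn ℝ ∞ f U) (v w : P) :
    EqOn (pd v (pd w f)) (pd w (pd v f)) U := fun p hp => by
  have hfp := hf.contDiffAt (hU.mem_nhds hp)
  have hs : IsSymmSndFDerivAt ℝ f p := hfp.isSymmSndFDerivAt (by simp; norm_cast)
  have hd : DifferentiableAt ℝ (fderiv ℝ f) p :=
    (hfp.fderiv_right (m := 1) (by norm_cast)).differentiableAt (by simp)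
  have key : ∀ a b : P, pd a (pd b f) p = fderiv ℝ (fderiv ℝ f) p a b := fun a b => by
    have h1 : HasFDerivAt (fun q => fderiv ℝ f q b) _ p :=
      hd.hasFDerivAt.clm_apply (hasFDerivAt_const b p)
    show fderiv ℝ (fun q => fderiv ℝ f q b) p a = _
    rw [h1.fderiv]; simp
  rw [key, key, hs.eq]

lemma pd_add_dir (v w : P) (f : P → E) (p : P) : pd (v + w) f p = pd v f p + pd w f p := by
  simp [pd]

lemma pd_smul_dir (c : ℝ) (v : P) (f : P → E) (p : P) : pd (c • v) f p = c • pd v f p := by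
  simp [pd]

lemma pd_neg_dir (v : P) (f : P → E) (p : P) : pd (-v) f p = - pd v f p := by
  simp [pd]

lemma smoothOn_pd_add {f g : P → E} {U : Set P} (hU : IsOpen U) (hf : ContDiffOn ℝ ∞ f U)
    (hg : ContDiffOn ℝ ∞ g U) (v : P) {p : P} (hp : p ∈ U) :
    pd v (fun q => f q + g q) p = pd v f p + pd v g p := by
  have := (smoothOn_hasFDerivAt hU hf hp).add (smoothOn_hasFDerivAt hU hg hp)
  simp only [pd]
  rw [show (fun q => f q + g q) = f + g from rfl, this.fderiv]; simp

lemma smoothOn_pd_const_smul {f : P → E} {U : Set P} (hU : IsOpen U) (hf : ContDiffOn ℝ ∞ f U)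
    (c : ℝ) (v : P) {p : P} (hp : p ∈ U) :
    pd v (fun q => c • f q) p = c • pd v f p := by
  have := (smoothOn_hasFDerivAt hU hf hp).const_smul c
  simp only [pd]
  rw [show (fun q => c • f q) = c • f from rfl, this.fderiv]; simp

lemma smoothOn_pd_smul {a : P → ℝ} {f : P → E} {U : Set P} (hU : IsOpen U)
    (ha : ContDiffOn ℝ ∞ a U) (hf : ContDiffOn ℝ ∞ f U) (v : P) {p : P} (hp : p ∈ U) :
    pd v (fun q => a q • f q) p = a p • pd v f p + pd v a p • f p := by
  have := (smoothOn_hasFDerivAt hU ha hp).smul (smoothOn_hasFDerivAt hU hf hp)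
  simp only [pd]
  rw [show (fun q => a q • f q) = a • f from rfl, this.fderiv]; simp

/-- Differentiation under the integral sign over a compact interval. -/
lemma hasFDerivAt_param_integral [FiniteDimensional ℝ P] [CompleteSpace E]
    {f : P × ℝ → E} {U : Set P} (hU : IsOpen U)
    (hf : ContDiffOn ℝ 1 f (U ×ˢ univ)) (N : ℝ) {p : P} (hp : p ∈ U) :
    HasFDerivAt (fun q => ∫ τ in (0 : ℝ)..N, f (q, τ))
      (∫ τ in (0 : ℝ)..N, (fderiv ℝ f (p, τ)).comp (ContinuousLinearMap.inl ℝ P ℝ)) p := by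
  have hV : IsOpen (U ×ˢ (univ : Set ℝ)) := hU.prod isOpen_univ
  have hd : ContinuousOn (fderiv ℝ f) (U ×ˢ univ) := hf.continuousOn_fderiv_of_isOpen hV le_rfl
  obtain ⟨r, hr, hrU⟩ := Metric.nhds_basis_closedBall.mem_iff.1 (hU.mem_nhds hp)
  have : ProperSpace P := FiniteDimensional.proper ℝ P
  have hK : IsCompact (Metric.closedBall p r ×ˢ uIcc (0 : ℝ) N) :=
    (isCompact_closedBall p r).prod isCompact_uIcc
  have hKV : Metric.closedBall p r ×ˢ uIcc (0 : ℝ) N ⊆ U ×ˢ univ :=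
    prod_mono hrU (subset_univ _)
  obtain ⟨B, hB⟩ := hK.exists_bound_of_continuousOn
    (f := fun z => (fderiv ℝ f z).comp (ContinuousLinearMap.inl ℝ P ℝ))
    ((hd.mono hKV).clm_comp continuousOn_const)
  have hline : ∀ q ∈ U, Continuous fun τ : ℝ => f (q, τ) := fun q hq =>
    hf.continuousOn.comp_continuous (by fun_prop) (fun τ => ⟨hq, mem_univ _⟩)
  have hline' : Continuous fun τ : ℝ =>
      (fderiv ℝ f (p, τ)).comp (ContinuousLinearMap.inl ℝ P ℝ) :=
    (hd.comp_continuous (by fun_prop) (fun τ => ⟨hp, mem_univ _⟩)).clm_comp continuous_const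
  refine intervalIntegral.hasFDerivAt_integral_of_dominated_of_fderiv_le
    (F := fun q τ => f (q, τ))
    (F' := fun q τ => (fderiv ℝ f (q, τ)).comp (ContinuousLinearMap.inl ℝ P ℝ))
    (bound := fun _ => B) (s := Metric.closedBall p r)
    (Metric.closedBall_mem_nhds p hr) ?_ ?_ ?_ ?_ ?_ ?_
  · filter_upwards [hU.mem_nhds hp] with q hq
    exact (hline q hq).aestronglyMeasurable
  · exact (hline p hp).intervalIntegrable _ _
  · exact hline'.aestronglyMeasurable
  · refine Filter.Eventually.of_forall fun τ hτ q hq => ?_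
    exact hB (q, τ) ⟨hq, uIoc_subset_uIcc hτ⟩
  · exact intervalIntegrable_const
  · refine Filter.Eventually.of_forall fun τ _ q hq => ?_
    have h1 : HasFDerivAt f (fderiv ℝ f (q, τ)) (q, τ) :=
      ((hf.contDiffAt (hV.mem_nhds ⟨hrU hq, mem_univ _⟩)).differentiableAt
        (by simp)).hasFDerivAt
    exact h1.comp q (hasFDerivAt_prodMk_left q τ)

lemma contDiffOn_param_integral_aux [FiniteDimensional ℝ P] (n : ℕ) :
    ∀ {E : Type} [NormedAddCommGroup E] [NormedSpace ℝ E] [CompleteSpace E]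
    {f : P × ℝ → E} {U : Set P} (_ : IsOpen U)
    (_ : ContDiffOn ℝ ∞ f (U ×ˢ univ)) (N : ℝ),
    ContDiffOn ℝ n (fun q => ∫ τ in (0 : ℝ)..N, f (q, τ)) U := by
  induction n with
  | zero =>
    intro E _ _ _ f U hU hf N
    refine contDiffOn_zero.2 fun p hp => ?_
    exact (hasFDerivAt_param_integral hU (hf.of_le (by norm_cast)) N
      hp).continuousAt.continuousWithinAt
  | succ n ih =>
    intro E _ _ _ f U hU hf N
    have hV : IsOpen (U ×ˢ (univ : Set ℝ)) := hU.prod isOpen_univ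
    have hder := fun p hp => hasFDerivAt_param_integral (p := p) hU
      (hf.of_le (m := 1) (by norm_cast)) N hp
    push_cast
    rw [contDiffOn_succ_iff_fderiv_of_isOpen hU]
    refine ⟨fun p hp => (hder p hp).differentiableAt.differentiableWithinAt, by simp, ?_⟩
    refine (ih (f := fun z => (fderiv ℝ f z).comp (ContinuousLinearMap.inl ℝ P ℝ)) hU ?_ N).congr
      fun p hp => (hder p hp).fderiv
    exact (hf.fderiv_of_isOpen hV (m := ∞) (by simp)).clm_comp contDiffOn_const

lemma contDiffOn_param_integral [FiniteDimensional ℝ P] [CompleteSpace E]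
    {f : P × ℝ → E} {U : Set P} (hU : IsOpen U)
    (hf : ContDiffOn ℝ ∞ f (U ×ˢ univ)) (N : ℝ) :
    ContDiffOn ℝ ∞ (fun q => ∫ τ in (0 : ℝ)..N, f (q, τ)) U :=
  contDiffOn_infty.2 fun n => contDiffOn_param_integral_aux n hU hf N

lemma pd_param_integral [FiniteDimensional ℝ P] [CompleteSpace E]
    {f : P × ℝ → E} {U : Set P} (hU : IsOpen U)
    (hf : ContDiffOn ℝ ∞ f (U ×ˢ univ)) (N : ℝ) (v : P) {p : P} (hp : p ∈ U) :
    pd v (fun q => ∫ τ in (0 : ℝ)..N, f (q, τ)) p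
      = ∫ τ in (0 : ℝ)..N, pd ((v, 0) : P × ℝ) f (p, τ) := by
  have hV : IsOpen (U ×ˢ (univ : Set ℝ)) := hU.prod isOpen_univ
  have hf1 : ContDiffOn ℝ 1 f (U ×ˢ univ) := hf.of_le (by norm_cast)
  have hd : ContinuousOn (fderiv ℝ f) (U ×ˢ univ) := hf1.continuousOn_fderiv_of_isOpen hV le_rfl
  have hline' : Continuous fun τ : ℝ =>
      (fderiv ℝ f (p, τ)).comp (ContinuousLinearMap.inl ℝ P ℝ) :=
    (hd.comp_continuous (by fun_prop) (fun τ => ⟨hp, mem_univ _⟩)).clm_comp continuous_const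
  rw [pd, (hasFDerivAt_param_integral hU hf1 N hp).fderiv,
    ContinuousLinearMap.intervalIntegral_apply (hline'.intervalIntegrable _ _)]
  rfl

lemma smoothOn_iterate_pd {f : P → E} {U : Set P} (hU : IsOpen U) (hf : ContDiffOn ℝ ∞ f U)
    (v : P) (n : ℕ) : ContDiffOn ℝ ∞ ((pd v)^[n] f) U := by
  induction n with
  | zero => exact hf
  | succ n ih => rw [Function.iterate_succ_apply']; exact smoothOn_pd hU ih v

lemma iterate_pd_param_integral [FiniteDimensional ℝ P] [CompleteSpace E]
    {f : P × ℝ → E} {U : Set P} (hU : IsOpen U)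
    (hf : ContDiffOn ℝ ∞ f (U ×ˢ univ)) (N : ℝ) (v : P) (n : ℕ) :
    EqOn ((pd v)^[n] (fun q => ∫ τ in (0 : ℝ)..N, f (q, τ)))
      (fun q => ∫ τ in (0 : ℝ)..N, (pd ((v, 0) : P × ℝ))^[n] f (q, τ)) U := by
  have hV : IsOpen (U ×ˢ (univ : Set ℝ)) := hU.prod isOpen_univ
  induction n with
  | zero => exact fun _ _ => rfl
  | succ n ih =>
    simp only [Function.iterate_succ_apply']
    exact (pd_congr hU ih v).trans fun p hp =>
      pd_param_integral hU (smoothOn_iterate_pd hV hf (v, 0) n) N v hp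

end Calculus

end

/-! ### The operator `∂_w^n` applied to shifted functions of `√w` -/

lemma hasDerivAt_kernel_term {a : ℝ → ℂ} (ha : ContDiff ℝ ∞ a) (c s : ℝ) (k l i : ℕ) {w : ℝ}
    (hw : 0 < w) :
    HasDerivAt (fun w => (c * (√w)⁻¹ ^ k * (√w + s) ^ l) • iteratedDeriv i a ((√w + s) ^ 2))
      ((c * (-k / 2) * (√w)⁻¹ ^ (k + 2) * (√w + s) ^ l) • iteratedDeriv i a ((√w + s) ^ 2)
        + (c * (l / 2) * (√w)⁻¹ ^ (k + 1) * (√w + s) ^ (l - 1)) •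
          iteratedDeriv i a ((√w + s) ^ 2)
        + (c * (√w)⁻¹ ^ (k + 1) * (√w + s) ^ (l + 1)) •
          iteratedDeriv (i + 1) a ((√w + s) ^ 2)) w := by
  have hy : 0 < √w := Real.sqrt_pos.2 hw
  have h1 : HasDerivAt (fun w => √w) (1 / (2 * √w)) w := Real.hasDerivAt_sqrt hw.ne'
  have h2 := (h1.inv hy.ne').pow k
  have h3 := (h1.add_const s).pow l
  have h4 := (h1.add_const s).pow 2
  have h5 : HasDerivAt (iteratedDeriv i a) (iteratedDeriv (i + 1) a ((√w + s) ^ 2))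
      ((√w + s) ^ 2) := by
    rw [iteratedDeriv_succ]
    exact ((ha.differentiable_iteratedDeriv i (by exact_mod_cast WithTop.coe_lt_top _))
      _).hasDerivAt
  have h6 : HasDerivAt (fun w => iteratedDeriv i a ((√w + s) ^ 2)) _ w :=
    HasDerivAt.scomp w (g₁ := iteratedDeriv i a) h5 h4
  have h7 := ((h2.const_mul c).mul h3).smul h6
  refine h7.congr_deriv ?_
  simp only [Pi.pow_apply, Pi.mul_apply, Pi.inv_apply, smul_smul]
  rw [add_comm, add_smul]
  congr 1
  · congr 2
    · rcases k with _ | k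
      · simp
      · push_cast [Nat.add_sub_cancel]; ring
    · rcases l with _ | l
      · simp
      · push_cast [Nat.add_sub_cancel]; ring
  · congr 1
    push_cast; ring

/-- The `n`-th derivative in `w` of `a((√w + s)²) / (2 √w)` is a universal finite combination of
the terms `y^(-k) z^l a^(i)(z²)` with `y = √w`, `z = y + s`, where `l ≤ i ≤ n` and
`k + 2 i = 2 n + 1 + l`. -/
lemma exists_kernel_expansion (n : ℕ) : ∃ (ι : Type) (_ : Fintype ι) (c : ι → ℝ) (k l i : ι → ℕ),
    (∀ j, l j ≤ i j ∧ i j ≤ n ∧ k j + 2 * i j = 2 * n + 1 + l j) ∧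
    ∀ a : ℝ → ℂ, ContDiff ℝ ∞ a → ∀ s w : ℝ, 0 < w →
      iteratedDeriv n (fun w => (1 / (2 * √w)) • a ((√w + s) ^ 2)) w
        = ∑ j, (c j * (√w)⁻¹ ^ k j * (√w + s) ^ l j) • iteratedDeriv (i j) a ((√w + s) ^ 2) := by
  induction n with
  | zero =>
    refine ⟨Unit, inferInstance, fun _ => 1 / 2, fun _ => 1, fun _ => 0, fun _ => 0, by simp, ?_⟩
    intro a _ s w _
    simp [mul_comm]
  | succ n ih =>
    obtain ⟨ι, _, c, k, l, i, hκ, h⟩ := ih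
    refine ⟨ι × Fin 3, inferInstance,
      fun j => ![c j.1 * (-k j.1 / 2), c j.1 * (l j.1 / 2), c j.1] j.2,
      fun j => ![k j.1 + 2, if l j.1 = 0 then k j.1 + 2 else k j.1 + 1, k j.1 + 1] j.2,
      fun j => ![l j.1, l j.1 - 1, l j.1 + 1] j.2,
      fun j => ![i j.1, i j.1, i j.1 + 1] j.2, ?_, ?_⟩
    · rintro ⟨j, b⟩
      have := hκ j
      fin_cases b <;> simp
      · omega
      · split_ifs <;> omega
      · omega
    · intro a ha s w hw
      have hev : iteratedDeriv n (fun w => (1 / (2 * √w)) • a ((√w + s) ^ 2)) =ᶠ[nhds w]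
          fun w => ∑ j, (c j * (√w)⁻¹ ^ k j * (√w + s) ^ l j) •
            iteratedDeriv (i j) a ((√w + s) ^ 2) :=
        Filter.eventuallyEq_of_mem (Ioi_mem_nhds hw) fun x hx => h a ha s x hx
      rw [iteratedDeriv_succ, hev.deriv_eq,
        (HasDerivAt.fun_sum fun j _ =>
          hasDerivAt_kernel_term ha (c j) s (k j) (l j) (i j) hw).deriv,
        Fintype.sum_prod_type]
      refine Finset.sum_congr rfl fun j _ => ?_
      simp only [Fin.sum_univ_three]
      simp
      intro h0
      simp [h0]

/-- The odd part in `y` of `(P + 2 τ y)^M`, divided by `y`, is a polynomial in `w = y²`. -/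
lemma exists_polynomial_odd_part (v τ : ℝ) (M : ℕ) : ∃ p : Polynomial ℝ, p.degree < M ∧
    ∀ y : ℝ, y ≠ 0 →
      ((v - (y + τ) ^ 2) ^ M - (v - (y - τ) ^ 2) ^ M) / y = p.eval (y ^ 2) := by
  open Polynomial in
  suffices H : ∀ M : ℕ, (∃ p : Polynomial ℝ, p.degree < M ∧ ∀ y : ℝ, y ≠ 0 →
      ((v - (y + τ) ^ 2) ^ M - (v - (y - τ) ^ 2) ^ M) / y = p.eval (y ^ 2)) ∧
      (∃ p : Polynomial ℝ, p.degree < (M + 1 : ℕ) ∧ ∀ y : ℝ, y ≠ 0 →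
      ((v - (y + τ) ^ 2) ^ (M + 1) - (v - (y - τ) ^ 2) ^ (M + 1)) / y = p.eval (y ^ 2)) from
    (H M).1
  intro M
  induction M with
  | zero =>
    refine ⟨⟨0, by simp, by simp⟩, ⟨Polynomial.C (-4 * τ), ?_, fun y hy => ?_⟩⟩
    · exact lt_of_le_of_lt Polynomial.degree_C_le (by norm_num)
    · simp; field_simp; ring
  | succ M ih =>
    obtain ⟨⟨p, hp, hp'⟩, ⟨q, hq, hq'⟩⟩ := ih
    refine ⟨⟨q, hq, hq'⟩, ?_⟩
    -- the two powers satisfy a common linear recurrence, whose coefficients depend on `y²` only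
    let L : Polynomial ℝ := Polynomial.C (2 * (v - τ ^ 2)) - 2 * Polynomial.X
    let Q : Polynomial ℝ := (Polynomial.C (v - τ ^ 2) - Polynomial.X) ^ 2
      - Polynomial.C (4 * τ ^ 2) * Polynomial.X
    have hL : L.degree ≤ 1 := by
      unfold L; compute_degree
    have hQ : Q.degree ≤ 2 := by
      unfold Q; compute_degree
    refine ⟨L * q - Q * p, ?_, fun y hy => ?_⟩
    · refine lt_of_le_of_lt (Polynomial.degree_sub_le _ _) (max_lt ?_ ?_)
      · rw [Polynomial.degree_mul]
        by_cases h0 : q = 0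
        · simp [h0]
        calc L.degree + q.degree ≤ 1 + q.degree := by gcongr
          _ < 1 + (M + 1 : ℕ) := by
              exact WithBot.add_lt_add_left (by simp) hq
          _ = _ := by push_cast; ring
      · rw [Polynomial.degree_mul]
        calc Q.degree + p.degree ≤ 2 + p.degree := by gcongr
          _ < 2 + (M : ℕ) := by
              exact WithBot.add_lt_add_left (by exact WithBot.coe_ne_bot (a := 2)) hp
          _ = _ := by push_cast; ring
    · rw [Polynomial.eval_sub, Polynomial.eval_mul, Polynomial.eval_mul, ← hp' y hy, ← hq' y hy]
      simp only [L, Q]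
      simp
      field_simp
      ring

lemma iteratedDeriv_polynomial_eval (p : Polynomial ℝ) (n : ℕ) :
    iteratedDeriv n (fun w => ((p.eval w : ℝ) : ℂ))
      = fun w => (((Polynomial.derivative^[n] p).eval w : ℝ) : ℂ) := by
  induction n with
  | zero => simp
  | succ n ih =>
    rw [iteratedDeriv_succ, ih, Function.iterate_succ_apply']
    ext w
    exact ((Polynomial.hasDerivAt _ w).ofReal_comp).deriv

section

/-! ### The Riemann function of the radial wave equation -/

/-- The index data of the expansion in `exists_kernel_expansion`. -/
structure KernelExpansion (n : ℕ) where
  ι : Type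
  fin : Fintype ι
  c : ι → ℝ
  k : ι → ℕ
  l : ι → ℕ
  i : ι → ℕ
  spec : ∀ j, l j ≤ i j ∧ i j ≤ n ∧ k j + 2 * i j = 2 * n + 1 + l j
  expand : ∀ a : ℝ → ℂ, ContDiff ℝ ∞ a → ∀ s w : ℝ, 0 < w →
      iteratedDeriv n (fun w => (1 / (2 * √w)) • a ((√w + s) ^ 2)) w
        = ∑ j, (c j * (√w)⁻¹ ^ k j * (√w + s) ^ l j) • iteratedDeriv (i j) a ((√w + s) ^ 2)

attribute [instance] KernelExpansion.fin

lemma nonempty_kernelExpansion (n : ℕ) : Nonempty (KernelExpansion n) := by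
  obtain ⟨ι, h, c, k, l, i, h1, h2⟩ := exists_kernel_expansion n
  exact ⟨⟨ι, h, c, k, l, i, h1, h2⟩⟩

variable {n : ℕ}

/-- The kernel `∂_w^n [a((√w + s)²) / (2 √w)]` for the polynomial
`a(x) = (-1)^(n+1) (v - x)^n / n!`. -/
def KernelExpansion.kernel (K : KernelExpansion n) (v w s : ℝ) : ℝ :=
  ∑ j, K.c j * (√w)⁻¹ ^ K.k j * (√w + s) ^ K.l j *
    ((-1) ^ (n + 1 + K.i j) * (v - (√w + s) ^ 2) ^ (n - K.i j) / (n - K.i j).factorial)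

lemma iteratedDeriv_sub_pow (n : ℕ) (v : ℝ) {i : ℕ} (hi : i ≤ n) (x : ℝ) :
    iteratedDeriv i (fun x : ℝ => (((-1) ^ (n + 1) * (v - x) ^ n / n.factorial : ℝ) : ℂ)) x
      = (((-1) ^ (n + 1 + i) * (v - x) ^ (n - i) / (n - i).factorial : ℝ) : ℂ) := by
  induction i generalizing x with
  | zero => simp
  | succ i ih =>
    have hi' : i ≤ n := by omega
    rw [iteratedDeriv_succ, (funext fun y => ih hi' y :
      iteratedDeriv i (fun x : ℝ => (((-1) ^ (n + 1) * (v - x) ^ n / n.factorial : ℝ) : ℂ)) = _)]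
    refine HasDerivAt.deriv ?_
    refine HasDerivAt.ofReal_comp ?_
    have h1 : HasDerivAt (fun x : ℝ => v - x) (-1) x := by
      simpa using (hasDerivAt_id x).const_sub v
    have h2 := ((h1.pow (n - i)).const_mul ((-1 : ℝ) ^ (n + 1 + i))).div_const
      (((n - i).factorial : ℕ) : ℝ)
    refine h2.congr_deriv ?_
    obtain ⟨r, hr⟩ : ∃ r, n - i = r + 1 := ⟨n - i - 1, by omega⟩
    have hr' : n - (i + 1) = r := by omega
    rw [hr, hr', Nat.factorial_succ]
    have : ((r.factorial : ℕ) : ℝ) ≠ 0 := by exact_mod_cast r.factorial_ne_zero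
    push_cast [Nat.add_sub_cancel]
    field_simp
    ring

lemma KernelExpansion.iteratedDeriv_eq_kernel (K : KernelExpansion n) (v s : ℝ) {w : ℝ}
    (hw : 0 < w) :
    iteratedDeriv n (fun w => (1 / (2 * √w)) •
      (((-1) ^ (n + 1) * (v - (√w + s) ^ 2) ^ n / n.factorial : ℝ) : ℂ)) w
      = ((K.kernel v w s : ℝ) : ℂ) := by
  have ha : ContDiff ℝ ∞
      (fun x : ℝ => (((-1) ^ (n + 1) * (v - x) ^ n / n.factorial : ℝ) : ℂ)) := by
    refine Complex.ofRealCLM.contDiff.comp ?_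
    exact (contDiff_const.mul ((contDiff_const.sub contDiff_id).pow n)).div_const _
  rw [K.expand _ ha s w hw, kernel, Complex.ofReal_sum]
  refine Finset.sum_congr rfl fun j _ => ?_
  rw [iteratedDeriv_sub_pow n v (K.spec j).2.1]
  simp

/-- Huygens' principle: the contributions of the two characteristics through a point cancel beyond
the far one. It holds because `n` derivatives in `w` kill the polynomials of degree `< n`. -/
lemma KernelExpansion.kernel_neg (K : KernelExpansion n) (v τ : ℝ) {w : ℝ} (hw : 0 < w) :
    K.kernel v w (-τ) = K.kernel v w τ := by
  have hU : Ioi (0 : ℝ) ∈ nhds w := Ioi_mem_nhds hw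
  have hsm : ∀ s : ℝ, ContDiffAt ℝ n (fun w => (1 / (2 * √w)) •
      (((-1) ^ (n + 1) * (v - (√w + s) ^ 2) ^ n / n.factorial : ℝ) : ℂ)) w := by
    intro s
    have h1 : ContDiffAt ℝ n (fun w => √w) w := Real.contDiffAt_sqrt hw.ne'
    have h2 : ContDiffAt ℝ n (fun w => (1 / (2 * √w))) w :=
      contDiffAt_const.div (contDiffAt_const.mul h1) (by positivity)
    refine h2.smul ?_
    refine Complex.ofRealCLM.contDiff.contDiffAt.comp w ?_
    exact (contDiffAt_const.mul ((contDiffAt_const.sub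
      ((h1.add contDiffAt_const).pow 2)).pow n)).div_const _
  have h0 : (((K.kernel v w τ - K.kernel v w (-τ) : ℝ)) : ℂ) = 0 := by
    push_cast
    rw [← K.iteratedDeriv_eq_kernel v τ hw, ← K.iteratedDeriv_eq_kernel v (-τ) hw,
      ← iteratedDeriv_sub (hsm τ) (hsm (-τ))]
    obtain ⟨p, hp, hp'⟩ := exists_polynomial_odd_part v τ n
    have hev : ((fun w => (1 / (2 * √w)) •
        (((-1) ^ (n + 1) * (v - (√w + τ) ^ 2) ^ n / n.factorial : ℝ) : ℂ)) -
        (fun w => (1 / (2 * √w)) •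
        (((-1) ^ (n + 1) * (v - (√w + -τ) ^ 2) ^ n / n.factorial : ℝ) : ℂ))) =ᶠ[nhds w]
        fun w => (((Polynomial.C ((-1 : ℝ) ^ (n + 1) / (2 * (n.factorial : ℝ))) * p).eval w : ℝ) : ℂ)
        := by
      refine Filter.eventuallyEq_of_mem hU fun x (hx : 0 < x) => ?_
      have hy : √x ≠ 0 := (Real.sqrt_pos.2 hx).ne'
      have := hp' (√x) hy
      rw [Real.sq_sqrt hx.le] at this
      simp only [Pi.sub_apply, Polynomial.eval_mul, Polynomial.eval_C, ← this,
        ← sub_eq_add_neg]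
      rw [Complex.real_smul, Complex.real_smul, ← Complex.ofReal_mul, ← Complex.ofReal_mul,
        ← Complex.ofReal_sub]
      congr 1
      have : ((n.factorial : ℕ) : ℝ) ≠ 0 := by exact_mod_cast n.factorial_ne_zero
      field_simp
    rw [hev.iteratedDeriv_eq]
    have hq : (Polynomial.C ((-1 : ℝ) ^ (n + 1) / (2 * (n.factorial : ℝ))) * p).degree < n := by
      refine lt_of_le_of_lt ?_ hp
      rw [Polynomial.degree_mul]
      calc _ ≤ 0 + p.degree := add_le_add_left Polynomial.degree_C_le _
        _ = _ := by simp
    rw [iteratedDeriv_polynomial_eval,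
      Polynomial.iterate_derivative_eq_zero_of_degree_lt hq]
    simp
  have := Complex.ofReal_eq_zero.1 h0
  linarith

/-- The kernel is bounded by `ρ^n y^(-(n+1))` at `v = ρ²`, `w = y²`. -/
lemma KernelExpansion.exists_bound (K : KernelExpansion n) : ∃ C : ℝ, 0 < C ∧
    ∀ ρ y τ : ℝ, 0 < y → 0 < ρ → y ≤ 2 * ρ → |y - τ| ≤ ρ → τ ≤ ρ → ρ ≤ y + τ →
      |K.kernel (ρ ^ 2) (y ^ 2) (-τ)| ≤ C * ρ ^ n * y⁻¹ ^ (n + 1) := by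
  refine ⟨∑ j, |K.c j| * 8 ^ n + 1, by positivity, ?_⟩
  intro ρ y τ hy hρ hyρ hz hτρ hτ
  rw [kernel, Real.sqrt_sq hy.le]
  have hterm : ∀ j, |K.c j * y⁻¹ ^ K.k j * (y + -τ) ^ K.l j *
      ((-1) ^ (n + 1 + K.i j) * (ρ ^ 2 - (y + -τ) ^ 2) ^ (n - K.i j) / (n - K.i j).factorial)|
      ≤ |K.c j| * 8 ^ n * (ρ ^ n * y⁻¹ ^ (n + 1)) := by
    intro j
    obtain ⟨h1, h2, h3⟩ := K.spec j
    have hD0 : 0 ≤ ρ ^ 2 - (y + -τ) ^ 2 := by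
      have := sq_le_sq' (abs_le.1 hz).1 (abs_le.1 hz).2
      nlinarith
    have hD : ρ ^ 2 - (y + -τ) ^ 2 ≤ 4 * ρ * y := by
      have e : ρ ^ 2 - (y + -τ) ^ 2 = (ρ - y + τ) * (ρ + y - τ) := by ring
      rw [e]
      have a1 : ρ - y + τ ≤ 2 * ρ := by linarith
      have a2 : ρ + y - τ ≤ 2 * y := by linarith
      have a3 : 0 ≤ ρ + y - τ := by have := (abs_le.1 hz).1; linarith
      nlinarith
    have hfac : (1 : ℝ) ≤ (n - K.i j).factorial := by
      exact_mod_cast Nat.succ_le_of_lt (Nat.factorial_pos _)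
    rw [abs_mul, abs_mul, abs_mul, abs_div, abs_mul, abs_pow, abs_pow, abs_pow, abs_neg, abs_one,
      one_pow, one_mul, abs_pow, abs_of_nonneg hD0, abs_of_pos (inv_pos.2 hy), Nat.abs_cast,
      ← sub_eq_add_neg]
    calc |K.c j| * y⁻¹ ^ K.k j * |y - τ| ^ K.l j *
          ((ρ ^ 2 - (y - τ) ^ 2) ^ (n - K.i j) / (n - K.i j).factorial)
        ≤ |K.c j| * y⁻¹ ^ K.k j * ρ ^ K.l j * (4 * ρ * y) ^ (n - K.i j) := by
          gcongr
          refine (div_le_self (by rw [← sub_eq_add_neg] at hD0; positivity) hfac).trans ?_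
          rw [← sub_eq_add_neg] at hD hD0
          gcongr
      _ ≤ |K.c j| * 8 ^ n * (ρ ^ n * y⁻¹ ^ (n + 1)) := by
          obtain ⟨r, hr⟩ := Nat.exists_eq_add_of_le h1
          obtain ⟨q, hq⟩ := Nat.exists_eq_add_of_le h2
          have hk : K.k j + r = (n + 1) + q := by omega
          have hnl : n - K.i j = q := by omega
          rw [show |K.c j| * y⁻¹ ^ K.k j * ρ ^ K.l j * (4 * ρ * y) ^ (n - K.i j)
            = |K.c j| * (y⁻¹ ^ K.k j * (ρ ^ K.l j * (4 * ρ * y) ^ (n - K.i j))) by ring,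
            mul_assoc |K.c j| (8 ^ n) _]
          refine mul_le_mul_of_nonneg_left ?_ (abs_nonneg (K.c j))
          rw [hnl]
          have e1 : y⁻¹ ^ K.k j * y ^ q = y⁻¹ ^ (n + 1) * y ^ r := by
            have hy' : y ≠ 0 := hy.ne'
            rw [inv_pow, inv_pow]
            field_simp
            rw [← pow_add, ← pow_add, hk]
            congr 1; omega
          calc y⁻¹ ^ K.k j * (ρ ^ K.l j * (4 * ρ * y) ^ q)
              = (y⁻¹ ^ K.k j * y ^ q) * ρ ^ K.l j * (4 ^ q * ρ ^ q) := by ring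
            _ = y⁻¹ ^ (n + 1) * y ^ r * ρ ^ K.l j * (4 ^ q * ρ ^ q) := by rw [e1]
            _ ≤ y⁻¹ ^ (n + 1) * (2 * ρ) ^ r * ρ ^ K.l j * (4 ^ q * ρ ^ q) := by gcongr
            _ = (2 ^ r * 4 ^ q) * (ρ ^ (K.l j + r + q) * y⁻¹ ^ (n + 1)) := by ring
            _ ≤ 8 ^ n * (ρ ^ n * y⁻¹ ^ (n + 1)) := by
                rw [show K.l j + r + q = n by omega]
                gcongr
                calc (2 : ℝ) ^ r * 4 ^ q ≤ 2 ^ n * 4 ^ n := by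
                      gcongr
                      · norm_num
                      · omega
                      · norm_num
                      · omega
                  _ = 8 ^ n := by rw [← mul_pow]; norm_num
  calc _ ≤ ∑ j, |K.c j * y⁻¹ ^ K.k j * (y + -τ) ^ K.l j * ((-1) ^ (n + 1 + K.i j) *
        (ρ ^ 2 - (y + -τ) ^ 2) ^ (n - K.i j) / (n - K.i j).factorial)| :=
        Finset.abs_sum_le_sum_abs (G := ℝ) _ _
    _ ≤ ∑ j, |K.c j| * 8 ^ n * (ρ ^ n * y⁻¹ ^ (n + 1)) :=
        Finset.sum_le_sum (fun j _ => hterm j)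
    _ = (∑ j, |K.c j| * 8 ^ n) * (ρ ^ n * y⁻¹ ^ (n + 1)) := by rw [Finset.sum_mul]
    _ ≤ _ := by
      rw [mul_assoc]; gcongr; linarith

end

/-! ### The radial wave equation in three dimensions -/

/-- The region `w > 0` of space-time-parameter space. -/
def regionPos : Set ((ℝ × ℝ) × ℝ) := {q | 0 < q.1.1}

lemma isOpen_regionPos : IsOpen regionPos := isOpen_lt continuous_const (by fun_prop)

/-- The powers `w^(-j/2)`. -/
def invPow (j : ℕ) (q : (ℝ × ℝ) × ℝ) : ℝ := (√q.1.1)⁻¹ ^ j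

/-- The difference of `g` at the two points reached after time `τ` along the characteristics
through `(√w, t)`. -/
def charDiff (g : ℝ × ℝ → ℂ) (q : (ℝ × ℝ) × ℝ) : ℂ :=
  g (√q.1.1 + q.2, q.1.2 + q.2) - g (√q.1.1 - q.2, q.1.2 + q.2)

lemma contDiffOn_sqrt_regionPos : ContDiffOn ℝ ∞ (fun q : (ℝ × ℝ) × ℝ => √q.1.1) regionPos :=
  ContDiffOn.sqrt (by fun_prop) fun q (hq : 0 < q.1.1) => hq.ne'

lemma contDiffOn_invPow (j : ℕ) : ContDiffOn ℝ ∞ (invPow j) regionPos :=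
  (contDiffOn_sqrt_regionPos.inv fun q (hq : 0 < q.1.1) => (Real.sqrt_pos.2 hq).ne').pow j

lemma contDiffOn_charDiff {g : ℝ × ℝ → ℂ} (hg : ContDiff ℝ ∞ g) :
    ContDiffOn ℝ ∞ (charDiff g) regionPos := by
  refine (hg.comp_contDiffOn ?_).sub (hg.comp_contDiffOn ?_)
  · exact (contDiffOn_sqrt_regionPos.add (by fun_prop)).prodMk (by fun_prop)
  · exact (contDiffOn_sqrt_regionPos.sub (by fun_prop)).prodMk (by fun_prop)

lemma contDiff_pd {P E : Type} [NormedAddCommGroup P] [NormedSpace ℝ P]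
    [NormedAddCommGroup E] [NormedSpace ℝ E] {g : P → E} (hg : ContDiff ℝ ∞ g) (v : P) :
    ContDiff ℝ ∞ (pd v g) :=
  contDiffOn_univ.1 (smoothOn_pd isOpen_univ hg.contDiffOn v)

lemma ContDiff.hasDerivAt_pd {P E : Type} [NormedAddCommGroup P] [NormedSpace ℝ P]
    [NormedAddCommGroup E] [NormedSpace ℝ E] {g : P → E} (hg : ContDiff ℝ ∞ g)
    {c : ℝ → P} {c' : P} {s : ℝ} (hc : HasDerivAt c c' s) :
    HasDerivAt (fun x => g (c x)) (pd c' g (c s)) s :=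
  smoothOn_hasDerivAt_comp isOpen_univ hg.contDiffOn hc (mem_univ _)

lemma pd_invPow (j : ℕ) {q : (ℝ × ℝ) × ℝ} (hq : q ∈ regionPos) :
    pd ((1, 0), 0) (invPow j) q = -(j / 2) * invPow (j + 2) q := by
  obtain ⟨⟨w, t⟩, τ⟩ := q
  have hw : 0 < w := hq
  have hy : 0 < √w := Real.sqrt_pos.2 hw
  have hc : HasDerivAt (fun x : ℝ => ((x, t), τ)) (((1 : ℝ), (0 : ℝ)), (0 : ℝ)) w :=
    ((hasDerivAt_id w).prodMk (hasDerivAt_const w t)).prodMk (hasDerivAt_const w τ)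
  have h1 := smoothOn_hasDerivAt_comp isOpen_regionPos (contDiffOn_invPow j) hc hq
  have h2 : HasDerivAt (fun x => (√x)⁻¹ ^ j) _ w := ((Real.hasDerivAt_sqrt hw.ne').inv hy.ne').pow j
  rw [h1.unique h2]
  simp only [invPow, Pi.inv_apply]
  rcases j with _ | j
  · simp
  · push_cast [Nat.add_sub_cancel]; ring

lemma pd_charDiff {g : ℝ × ℝ → ℂ} (hg : ContDiff ℝ ∞ g) {q : (ℝ × ℝ) × ℝ} (hq : q ∈ regionPos) :
    pd ((1, 0), 0) (charDiff g) q
      = ((1 / 2 : ℝ) * invPow 1 q) • charDiff (pd (1, 0) g) q := by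
  obtain ⟨⟨w, t⟩, τ⟩ := q
  have hw : 0 < w := hq
  have hy : 0 < √w := Real.sqrt_pos.2 hw
  have hc : HasDerivAt (fun x : ℝ => ((x, t), τ)) (((1 : ℝ), (0 : ℝ)), (0 : ℝ)) w :=
    ((hasDerivAt_id w).prodMk (hasDerivAt_const w t)).prodMk (hasDerivAt_const w τ)
  have h1 := smoothOn_hasDerivAt_comp isOpen_regionPos (contDiffOn_charDiff hg) hc hq
  have e : ((1 / (2 * √w), 0) : ℝ × ℝ) = (1 / (2 * √w)) • ((1 : ℝ), (0 : ℝ)) := by simp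
  have hs := Real.hasDerivAt_sqrt hw.ne'
  have h2 := ContDiff.hasDerivAt_pd hg ((hs.add_const τ).prodMk (hasDerivAt_const w (t + τ)))
  have h3 := ContDiff.hasDerivAt_pd hg ((hs.sub_const τ).prodMk (hasDerivAt_const w (t + τ)))
  rw [h1.unique (h2.sub h3)]
  simp only [e, pd_smul_dir, ← smul_sub, charDiff, invPow]
  congr 1
  ring

lemma pd_time_charDiff {g : ℝ × ℝ → ℂ} (hg : ContDiff ℝ ∞ g) {q : (ℝ × ℝ) × ℝ}
    (hq : q ∈ regionPos) :
    pd ((0, 1), 0) (charDiff g) q = charDiff (pd (0, 1) g) q := by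
  obtain ⟨⟨w, t⟩, τ⟩ := q
  have hc : HasDerivAt (fun x : ℝ => ((w, x), τ)) (((0 : ℝ), (1 : ℝ)), (0 : ℝ)) t :=
    ((hasDerivAt_const t w).prodMk (hasDerivAt_id t)).prodMk (hasDerivAt_const t τ)
  have h1 := smoothOn_hasDerivAt_comp isOpen_regionPos (contDiffOn_charDiff hg) hc hq
  have hs := (hasDerivAt_id t).add_const τ
  have h2 := ContDiff.hasDerivAt_pd hg ((hasDerivAt_const t (√w + τ)).prodMk hs)
  have h3 := ContDiff.hasDerivAt_pd hg ((hasDerivAt_const t (√w - τ)).prodMk hs)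
  exact h1.unique (h2.sub h3)

/-- The product rule for the functions `w^(-j/2) (g(√w + τ, t + τ) - g(√w - τ, t + τ))`. -/
lemma pd_invPow_smul_charDiff {g : ℝ × ℝ → ℂ} (hg : ContDiff ℝ ∞ g) (j : ℕ) {q : (ℝ × ℝ) × ℝ}
    (hq : q ∈ regionPos) :
    pd ((1, 0), 0) (fun q => invPow j q • charDiff g q) q
      = (1 / 2 : ℝ) • (invPow (j + 1) q • charDiff (pd (1, 0) g) q)
        - (j / 2 : ℝ) • (invPow (j + 2) q • charDiff g q) := by
  rw [smoothOn_pd_smul isOpen_regionPos (contDiffOn_invPow j) (contDiffOn_charDiff hg) _ hq,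
    pd_invPow j hq, pd_charDiff hg hq]
  simp only [smul_smul, invPow]
  rw [sub_eq_add_neg, ← neg_smul]
  congr 2 <;> ring

lemma pd_time_invPow_smul_charDiff {g : ℝ × ℝ → ℂ} (hg : ContDiff ℝ ∞ g) (j : ℕ)
    {q : (ℝ × ℝ) × ℝ} (hq : q ∈ regionPos) :
    pd ((0, 1), 0) (fun q => invPow j q • charDiff g q) q
      = invPow j q • charDiff (pd (0, 1) g) q := by
  rw [smoothOn_pd_smul isOpen_regionPos (contDiffOn_invPow j) (contDiffOn_charDiff hg) _ hq,
    pd_time_charDiff hg hq]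
  obtain ⟨⟨w, t⟩, τ⟩ := q
  have hc : HasDerivAt (fun x : ℝ => ((w, x), τ)) (((0 : ℝ), (1 : ℝ)), (0 : ℝ)) t :=
    ((hasDerivAt_const t w).prodMk (hasDerivAt_id t)).prodMk (hasDerivAt_const t τ)
  have h1 := smoothOn_hasDerivAt_comp isOpen_regionPos (contDiffOn_invPow j) hc hq
  rw [h1.unique (hasDerivAt_const t ((√w)⁻¹ ^ j))]
  simp

/-- The integrand of the solution operator of the three-dimensional radial wave equation. -/
def waveIntegrand (f : ℝ × ℝ → ℂ) (q : (ℝ × ℝ) × ℝ) : ℂ := (1 / 4 : ℝ) • (invPow 1 q • charDiff f q)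

lemma contDiffOn_waveIntegrand {f : ℝ × ℝ → ℂ} (hf : ContDiff ℝ ∞ f) :
    ContDiffOn ℝ ∞ (waveIntegrand f) regionPos :=
  ((contDiffOn_invPow 1).smul (contDiffOn_charDiff hf)).const_smul _

lemma smooth_invPow_charDiff {g : ℝ × ℝ → ℂ} (hg : ContDiff ℝ ∞ g) (j : ℕ) :
    ContDiffOn ℝ ∞ (fun q => invPow j q • charDiff g q) regionPos :=
  (contDiffOn_invPow j).smul (contDiffOn_charDiff hg)

lemma pd_waveIntegrand {f : ℝ × ℝ → ℂ} (hf : ContDiff ℝ ∞ f) :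
    EqOn (pd ((1, 0), 0) (waveIntegrand f))
      (fun q => (1 / 8 : ℝ) • (invPow 2 q • charDiff (pd (1, 0) f) q)
        + (-1 / 8 : ℝ) • (invPow 3 q • charDiff f q)) regionPos := fun q hq => by
  unfold waveIntegrand
  rw [smoothOn_pd_const_smul isOpen_regionPos (smooth_invPow_charDiff hf 1) _ _ hq,
    pd_invPow_smul_charDiff hf 1 hq]
  simp only [smul_sub, smul_smul]
  module

lemma pd_pd_waveIntegrand {f : ℝ × ℝ → ℂ} (hf : ContDiff ℝ ∞ f) :
    EqOn (pd ((1, 0), 0) (pd ((1, 0), 0) (waveIntegrand f)))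
      (fun q => (1 / 16 : ℝ) • (invPow 3 q • charDiff (pd (1, 0) (pd (1, 0) f)) q)
        - (3 / 16 : ℝ) • (invPow 4 q • charDiff (pd (1, 0) f) q)
        + (3 / 16 : ℝ) • (invPow 5 q • charDiff f q)) regionPos := fun q hq => by
  have hf1 := contDiff_pd hf (1, 0)
  have s1 := smooth_invPow_charDiff hf1 2
  have s2 := smooth_invPow_charDiff hf 3
  rw [pd_congr isOpen_regionPos (pd_waveIntegrand hf) _ hq,
    smoothOn_pd_add isOpen_regionPos (s1.const_smul (1 / 8 : ℝ)) (s2.const_smul (-1 / 8 : ℝ)) _ hq,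
    smoothOn_pd_const_smul isOpen_regionPos s1 _ _ hq,
    smoothOn_pd_const_smul isOpen_regionPos s2 _ _ hq,
    pd_invPow_smul_charDiff hf1 2 hq, pd_invPow_smul_charDiff hf 3 hq]
  simp only [smul_sub, smul_smul]
  module

lemma pd_time_pd_time_waveIntegrand {f : ℝ × ℝ → ℂ} (hf : ContDiff ℝ ∞ f) :
    EqOn (pd ((0, 1), 0) (pd ((0, 1), 0) (waveIntegrand f)))
      (fun q => (1 / 4 : ℝ) • (invPow 1 q • charDiff (pd (0, 1) (pd (0, 1) f)) q)) regionPos :=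
  fun q hq => by
  have hf1 := contDiff_pd hf (0, 1)
  have h1 : ∀ {g : ℝ × ℝ → ℂ}, ContDiff ℝ ∞ g → EqOn (pd ((0, 1), 0) (waveIntegrand g))
      (waveIntegrand (pd (0, 1) g)) regionPos := fun {g} hg q hq => by
    unfold waveIntegrand
    rw [smoothOn_pd_const_smul isOpen_regionPos (smooth_invPow_charDiff hg 1) _ _ hq,
      pd_time_invPow_smul_charDiff hg 1 hq]
  rw [pd_congr isOpen_regionPos (h1 hf) _ hq, h1 hf1 hq]
  rfl

/-- The wave operator applied to the integrand is an exact derivative along the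
characteristics. -/
lemma wave_waveIntegrand {f : ℝ × ℝ → ℂ} (hf : ContDiff ℝ ∞ f) {q : (ℝ × ℝ) × ℝ}
    (hq : q ∈ regionPos) :
    pd ((0, 1), 0) (pd ((0, 1), 0) (waveIntegrand f)) q
      = (4 * q.1.1) • pd ((1, 0), 0) (pd ((1, 0), 0) (waveIntegrand f)) q
        + (6 : ℝ) • pd ((1, 0), 0) (waveIntegrand f) q
        + (1 / 4 : ℝ) • (invPow 1 q •
          (charDiff (pd (0, 1) (pd (0, 1) f)) q - charDiff (pd (1, 0) (pd (1, 0) f)) q)) := by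
  have hw : 0 < q.1.1 := hq
  rw [pd_time_pd_time_waveIntegrand hf hq, pd_pd_waveIntegrand hf hq, pd_waveIntegrand hf hq]
  have e : ∀ j, (4 * q.1.1) * invPow (j + 2) q = 4 * invPow j q := fun j => by
    have h0 : √q.1.1 ≠ 0 := (Real.sqrt_pos.2 hw).ne'
    have h2 : q.1.1 = √q.1.1 ^ 2 := (Real.sq_sqrt hw.le).symm
    simp only [invPow, pow_add]
    rw [inv_pow (√q.1.1) 2, ← h2]
    field_simp
  have e1 := e 1; have e2 := e 2; have e3 := e 3
  norm_num at e1 e2 e3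
  simp only [smul_add, smul_sub, smul_smul]
  rw [show 4 * q.1.1 * (1 / 16 * invPow 3 q) = 1 / 4 * invPow 1 q by linarith,
    show 4 * q.1.1 * (3 / 16 * invPow 4 q) = 3 / 4 * invPow 2 q by linarith,
    show 4 * q.1.1 * (3 / 16 * invPow 5 q) = 3 / 4 * invPow 3 q by linarith]
  module

/-- The solution of the three-dimensional radial wave equation with vanishing data at late times.
The integral along the characteristics is cut off at `N`, which changes nothing when the source
vanishes from time `t + N` on. -/
def waveSol (f : ℝ × ℝ → ℂ) (N : ℝ) (p : ℝ × ℝ) : ℂ := ∫ τ in (0 : ℝ)..N, waveIntegrand f (p, τ)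

/-- The half-plane `w > 0` of radial space-time. -/
def halfPlane : Set (ℝ × ℝ) := {p | 0 < p.1}

lemma isOpen_halfPlane : IsOpen halfPlane := isOpen_lt continuous_const (by fun_prop)

lemma halfPlane_prod_univ : halfPlane ×ˢ (univ : Set ℝ) = regionPos := by
  ext q; simp [halfPlane, regionPos]

lemma contDiffOn_waveSol {f : ℝ × ℝ → ℂ} (hf : ContDiff ℝ ∞ f) (N : ℝ) :
    ContDiffOn ℝ ∞ (waveSol f N) halfPlane :=
  contDiffOn_param_integral isOpen_halfPlane
    (by rw [halfPlane_prod_univ]; exact contDiffOn_waveIntegrand hf) N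

lemma hasDerivAt_charDiff {g : ℝ × ℝ → ℂ} (hg : ContDiff ℝ ∞ g) (w t τ : ℝ) :
    HasDerivAt (fun τ => g (√w + τ, t + τ)) (pd (1, 1) g (√w + τ, t + τ)) τ ∧
    HasDerivAt (fun τ => g (√w - τ, t + τ)) (pd (-1, 1) g (√w - τ, t + τ)) τ :=
  ⟨ContDiff.hasDerivAt_pd hg (((hasDerivAt_id τ).const_add _).prodMk
      ((hasDerivAt_id τ).const_add _)),
    ContDiff.hasDerivAt_pd hg (((hasDerivAt_id τ).const_sub _).prodMk
      ((hasDerivAt_id τ).const_add _))⟩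

/-- By the fundamental theorem of calculus along the two characteristics only their common starting
point contributes: at the other end `f` vanishes. -/
lemma integral_charDiff_wave {f : ℝ × ℝ → ℂ} (hf : ContDiff ℝ ∞ f) {N T : ℝ}
    (hT : ∀ y t, T < t → f (y, t) = 0) {w t : ℝ} (htN : T < t + N) :
    ∫ τ in (0 : ℝ)..N, (charDiff (pd (0, 1) (pd (0, 1) f)) ((w, t), τ)
        - charDiff (pd (1, 0) (pd (1, 0) f)) ((w, t), τ)) = (2 : ℝ) • pd (1, 0) f (√w, t) := by
  set f1 := pd (1, 0) f with hf1
  set f2 := pd (0, 1) f with hf2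
  have sf1 : ContDiff ℝ ∞ f1 := contDiff_pd hf _
  have sf2 : ContDiff ℝ ∞ f2 := contDiff_pd hf _
  have sym : ∀ p, pd (0, 1) f1 p = pd (1, 0) f2 p := fun p =>
    pd_comm isOpen_univ hf.contDiffOn _ _ (mem_univ p)
  have dir1 : ∀ (g : ℝ × ℝ → ℂ) p, pd (1, 1) g p = pd (1, 0) g p + pd (0, 1) g p := fun g p => by
    rw [← pd_add_dir]; simp
  have dir2 : ∀ (g : ℝ × ℝ → ℂ) p, pd (-1, 1) g p = - pd (1, 0) g p + pd (0, 1) g p :=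
    fun g p => by rw [← pd_neg_dir, ← pd_add_dir]; simp
  have hder : ∀ τ ∈ uIcc 0 N, HasDerivAt
      (fun τ => (f2 (√w + τ, t + τ) - f1 (√w + τ, t + τ))
        - (f2 (√w - τ, t + τ) + f1 (√w - τ, t + τ)))
      (charDiff (pd (0, 1) f2) ((w, t), τ) - charDiff (pd (1, 0) f1) ((w, t), τ)) τ := by
    intro τ _
    have := (((hasDerivAt_charDiff sf2 w t τ).1.sub (hasDerivAt_charDiff sf1 w t τ).1)).sub
      ((hasDerivAt_charDiff sf2 w t τ).2.add (hasDerivAt_charDiff sf1 w t τ).2)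
    refine this.congr_deriv ?_
    simp only [dir1, dir2, charDiff, sym]
    ring
  have hz : ∀ y t', T < t' → f1 (y, t') = 0 ∧ f2 (y, t') = 0 := by
    intro y t' h
    have : f =ᶠ[nhds (y, t')] fun _ => 0 := by
      have : {p : ℝ × ℝ | T < p.2} ∈ nhds (y, t') :=
        (isOpen_lt continuous_const continuous_snd).mem_nhds h
      filter_upwards [this] with p hp using hT p.1 p.2 hp
    simp [hf1, hf2, pd, this.fderiv_eq]
  rw [intervalIntegral.integral_eq_sub_of_hasDerivAt hder]
  · rw [(hz _ _ htN).1, (hz _ _ htN).2, (hz _ _ htN).1, (hz _ _ htN).2]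
    simp only [add_zero, sub_zero]
    module
  · refine Continuous.intervalIntegrable ?_ _ _
    have c1 := (contDiff_pd sf1 (1, 0)).continuous
    have c2 := (contDiff_pd sf2 (0, 1)).continuous
    unfold charDiff
    fun_prop

/-- `waveSol` solves the radial wave equation in dimension `3`, written in the variable `w = |x|²`,
with source the `w`-derivative of `f(√w, t)`. -/
lemma wave_waveSol {f : ℝ × ℝ → ℂ} (hf : ContDiff ℝ ∞ f) {N T : ℝ}
    (hT : ∀ y t, T < t → f (y, t) = 0) {p : ℝ × ℝ} (hp : p ∈ halfPlane) (htN : T < p.2 + N) :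
    pd (0, 1) (pd (0, 1) (waveSol f N)) p
      = (4 * p.1) • pd (1, 0) (pd (1, 0) (waveSol f N)) p
        + (6 : ℝ) • pd (1, 0) (waveSol f N) p
        + (1 / (2 * √p.1)) • pd (1, 0) f (√p.1, p.2) := by
  have sK : ContDiffOn ℝ ∞ (waveIntegrand f) (halfPlane ×ˢ univ) := by
    rw [halfPlane_prod_univ]; exact contDiffOn_waveIntegrand hf
  have hU := isOpen_halfPlane
  have hV : IsOpen (halfPlane ×ˢ (univ : Set ℝ)) := hU.prod isOpen_univ
  have two : ∀ v : ℝ × ℝ, pd v (pd v (waveSol f N)) p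
      = ∫ τ in (0 : ℝ)..N, pd (v, 0) (pd (v, 0) (waveIntegrand f)) (p, τ) := fun v =>
    iterate_pd_param_integral hU sK N v 2 hp
  have one : ∀ v : ℝ × ℝ, pd v (waveSol f N) p
      = ∫ τ in (0 : ℝ)..N, pd (v, 0) (waveIntegrand f) (p, τ) := fun v =>
    pd_param_integral hU sK N v hp
  have hint : ∀ {g : (ℝ × ℝ) × ℝ → ℂ}, ContDiffOn ℝ ∞ g (halfPlane ×ˢ univ) →
      IntervalIntegrable (fun τ => g (p, τ)) volume 0 N := fun {g} hg =>
    (hg.continuousOn.comp_continuous (by fun_prop)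
      (fun τ => ⟨hp, mem_univ _⟩)).intervalIntegrable _ _
  have i1 := hint (smoothOn_pd hV sK ((1, 0), 0))
  have i2 := hint (smoothOn_pd hV (smoothOn_pd hV sK ((1, 0), 0)) ((1, 0), 0))
  have i3 : IntervalIntegrable (fun τ => charDiff (pd (0, 1) (pd (0, 1) f)) (p, τ)
        - charDiff (pd (1, 0) (pd (1, 0) f)) (p, τ)) volume 0 N := by
    refine hint (g := fun q => charDiff (pd (0, 1) (pd (0, 1) f)) q
      - charDiff (pd (1, 0) (pd (1, 0) f)) q) ?_
    rw [halfPlane_prod_univ]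
    exact (contDiffOn_charDiff (contDiff_pd (contDiff_pd hf _) _)).sub
      (contDiffOn_charDiff (contDiff_pd (contDiff_pd hf _) _))
  rw [two, two, one, ← intervalIntegral.integral_smul, ← intervalIntegral.integral_smul]
  have key : ∀ τ : ℝ, pd ((0, 1), 0) (pd ((0, 1), 0) (waveIntegrand f)) (p, τ)
      = (4 * p.1) • pd ((1, 0), 0) (pd ((1, 0), 0) (waveIntegrand f)) (p, τ)
        + (6 : ℝ) • pd ((1, 0), 0) (waveIntegrand f) (p, τ)
        + (1 / 4 * (√p.1)⁻¹ : ℝ) • (charDiff (pd (0, 1) (pd (0, 1) f)) (p, τ)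
          - charDiff (pd (1, 0) (pd (1, 0) f)) (p, τ)) := fun τ => by
    rw [wave_waveIntegrand hf (q := (p, τ)) hp, smul_smul (1 / 4 : ℝ)]
    simp [invPow]
  simp_rw [key]
  have j1 : IntervalIntegrable (fun τ => (6 : ℝ) • pd ((1, 0), 0) (waveIntegrand f) (p, τ))
    volume 0 N := i1.smul (6 : ℝ)
  have j2 : IntervalIntegrable (fun τ => (4 * p.1) •
    pd ((1, 0), 0) (pd ((1, 0), 0) (waveIntegrand f)) (p, τ)) volume 0 N := i2.smul (4 * p.1)
  have j3 : IntervalIntegrable (fun τ => (1 / 4 * (√p.1)⁻¹ : ℝ) •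
    (charDiff (pd (0, 1) (pd (0, 1) f)) (p, τ) - charDiff (pd (1, 0) (pd (1, 0) f)) (p, τ)))
    volume 0 N := i3.smul (1 / 4 * (√p.1)⁻¹)
  rw [intervalIntegral.integral_add (j2.add j1) j3, intervalIntegral.integral_add j2 j1]
  congr 1
  rw [intervalIntegral.integral_smul, integral_charDiff_wave hf hT (w := p.1) htN, smul_smul]
  congr 1
  ring

/-! ### Iterated antiderivatives in the radial variable -/

/-- The integral `∫_0^L (u^k / k!) ψ(x + u, t) du`, which up to sign is the `(k+1)`-fold
antiderivative of `ψ` in the first variable vanishing for large `x`. -/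
def moment (ψ : ℝ × ℝ → ℂ) (L : ℝ) (k : ℕ) (p : ℝ × ℝ) : ℂ :=
  ∫ u in (0 : ℝ)..L, (u ^ k / k.factorial : ℝ) • ψ (p.1 + u, p.2)

lemma contDiff_moment_integrand {ψ : ℝ × ℝ → ℂ} (hψ : ContDiff ℝ ∞ ψ) (k : ℕ) :
    ContDiff ℝ ∞ (fun q : (ℝ × ℝ) × ℝ =>
      (q.2 ^ k / k.factorial : ℝ) • ψ (q.1.1 + q.2, q.1.2)) := by
  refine ((contDiff_snd.pow k).div_const _).smul (hψ.comp ?_)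
  fun_prop

lemma contDiff_moment {ψ : ℝ × ℝ → ℂ} (hψ : ContDiff ℝ ∞ ψ) (L : ℝ) (k : ℕ) :
    ContDiff ℝ ∞ (moment ψ L k) :=
  contDiffOn_univ.1 (contDiffOn_param_integral isOpen_univ
    (contDiff_moment_integrand hψ k).contDiffOn L)

lemma pd_moment {ψ : ℝ × ℝ → ℂ} (hψ : ContDiff ℝ ∞ ψ) {L : ℝ}
    (k : ℕ) (p : ℝ × ℝ) :
    pd (1, 0) (moment ψ L k) p
      = ∫ u in (0 : ℝ)..L, (u ^ k / k.factorial : ℝ) • pd (1, 0) ψ (p.1 + u, p.2) := by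
  have hs := (contDiff_moment_integrand hψ k)
  have e : moment ψ L k = fun p => ∫ u in (0 : ℝ)..L, (fun q : (ℝ × ℝ) × ℝ =>
      (q.2 ^ k / k.factorial : ℝ) • ψ (q.1.1 + q.2, q.1.2)) (p, u) := rfl
  rw [e, pd_param_integral isOpen_univ hs.contDiffOn L (1, 0) (mem_univ p)]
  refine intervalIntegral.integral_congr fun u _ => ?_
  obtain ⟨x, t⟩ := p
  have hc : HasDerivAt (fun y : ℝ => ((y, t), u)) (((1 : ℝ), (0 : ℝ)), (0 : ℝ)) x :=
    ((hasDerivAt_id x).prodMk (hasDerivAt_const x t)).prodMk (hasDerivAt_const x u)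
  have h1 := ContDiff.hasDerivAt_pd hs hc
  have h2 := (ContDiff.hasDerivAt_pd hψ
    (((hasDerivAt_id x).add_const u).prodMk (hasDerivAt_const x t))).const_smul
    (u ^ k / k.factorial : ℝ)
  exact h1.unique h2

lemma pd_moment_zero {ψ : ℝ × ℝ → ℂ} (hψ : ContDiff ℝ ∞ ψ) {L : ℝ}
    {p : ℝ × ℝ} (hL : ψ (p.1 + L, p.2) = 0) :
    pd (1, 0) (moment ψ L 0) p = - ψ p := by
  have hψ' := (contDiff_pd hψ (1, 0)).continuous
  rw [pd_moment hψ]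
  have hd : ∀ u ∈ uIcc 0 L, HasDerivAt (fun u => ψ (p.1 + u, p.2))
      ((u ^ 0 / (Nat.factorial 0 : ℕ) : ℝ) • pd (1, 0) ψ (p.1 + u, p.2)) u := fun u _ => by
    simpa using ContDiff.hasDerivAt_pd hψ
      (((hasDerivAt_id u).const_add p.1).prodMk (hasDerivAt_const u p.2))
  rw [intervalIntegral.integral_eq_sub_of_hasDerivAt hd, hL]
  · simp
  · refine Continuous.intervalIntegrable ?_ _ _
    fun_prop

lemma pd_moment_succ {ψ : ℝ × ℝ → ℂ} (hψ : ContDiff ℝ ∞ ψ) {L : ℝ} (k : ℕ)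
    {p : ℝ × ℝ} (hL : ψ (p.1 + L, p.2) = 0) :
    pd (1, 0) (moment ψ L (k + 1)) p = - moment ψ L k p := by
  have hψ' := (contDiff_pd hψ (1, 0)).continuous
  have hψc := hψ.continuous
  rw [pd_moment hψ]
  have hd : ∀ u ∈ uIcc 0 L,
      HasDerivAt (fun u => (u ^ (k + 1) / (k + 1).factorial : ℝ) • ψ (p.1 + u, p.2))
      ((u ^ (k + 1) / (k + 1).factorial : ℝ) • pd (1, 0) ψ (p.1 + u, p.2)
        + (u ^ k / k.factorial : ℝ) • ψ (p.1 + u, p.2)) u := fun u _ => by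
    have h1 := ContDiff.hasDerivAt_pd hψ
      (((hasDerivAt_id u).const_add p.1).prodMk (hasDerivAt_const u p.2))
    have h2 := ((hasDerivAt_id u).pow (k + 1)).div_const (((k + 1).factorial : ℕ) : ℝ)
    refine (h2.smul h1).congr_deriv ?_
    congr 2
    have : ((k.factorial : ℕ) : ℝ) ≠ 0 := by exact_mod_cast k.factorial_ne_zero
    rw [Nat.factorial_succ]
    push_cast [Nat.add_sub_cancel]
    simp
    field_simp
  have i1 : IntervalIntegrable (fun u => (u ^ (k + 1) / (k + 1).factorial : ℝ) •
      pd (1, 0) ψ (p.1 + u, p.2)) volume 0 L :=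
    Continuous.intervalIntegrable (by fun_prop) _ _
  have i2 : IntervalIntegrable (fun u => (u ^ k / k.factorial : ℝ) •
      ψ (p.1 + u, p.2)) volume 0 L :=
    Continuous.intervalIntegrable (by fun_prop) _ _
  have h := intervalIntegral.integral_eq_sub_of_hasDerivAt hd (i1.add i2)
  rw [intervalIntegral.integral_add i1 i2, hL] at h
  rw [moment]
  rw [eq_neg_iff_add_eq_zero, h]
  simp

/-- The `(n+1)`-fold antiderivative of `ψ` in the first variable vanishing for large arguments. -/
def primitive (n : ℕ) (ψ : ℝ × ℝ → ℂ) (L : ℝ) (p : ℝ × ℝ) : ℂ :=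
  ((-1) ^ (n + 1) : ℝ) • moment ψ L n p

lemma contDiff_primitive {ψ : ℝ × ℝ → ℂ} (hψ : ContDiff ℝ ∞ ψ) (L : ℝ) (n : ℕ) :
    ContDiff ℝ ∞ (primitive n ψ L) :=
  (contDiff_moment hψ L n).const_smul ((-1) ^ (n + 1) : ℝ)

lemma iterate_pd_primitive {ψ : ℝ × ℝ → ℂ} (hψ : ContDiff ℝ ∞ ψ) {L : ℝ}
    (hL : ∀ x t, L - 1 ≤ x → ψ (x, t) = 0) (n : ℕ) {i : ℕ} (hi : i ≤ n) :
    EqOn ((pd (1, 0))^[i] (primitive n ψ L))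
      (fun p => ((-1) ^ (n + 1 + i) : ℝ) • moment ψ L (n - i) p) {p | -1 < p.1} := by
  have hU : IsOpen {p : ℝ × ℝ | -1 < p.1} := isOpen_lt continuous_const continuous_fst
  induction i with
  | zero => intro p _; simp [primitive]
  | succ i ih =>
    intro p hp
    have hp' : -1 < p.1 := hp
    rw [Function.iterate_succ_apply', pd_congr hU (ih (by omega)) _ hp,
      smoothOn_pd_const_smul hU (contDiff_moment hψ L _).contDiffOn _ _ hp]
    obtain ⟨r, hr⟩ : ∃ r, n - i = r + 1 := ⟨n - i - 1, by omega⟩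
    rw [hr, pd_moment_succ hψ r (hL _ _ (by linarith)), show n - (i + 1) = r by omega, ← add_assoc,
      pow_succ]
    simp

lemma iterate_pd_primitive_eq {ψ : ℝ × ℝ → ℂ} (hψ : ContDiff ℝ ∞ ψ) {L : ℝ}
    (hL : ∀ x t, L - 1 ≤ x → ψ (x, t) = 0) (n : ℕ) :
    EqOn ((pd (1, 0))^[n] (pd (1, 0) (primitive n ψ L))) ψ {p | -1 < p.1} := by
  have hU : IsOpen {p : ℝ × ℝ | -1 < p.1} := isOpen_lt continuous_const continuous_fst
  intro p hp
  have hp' : -1 < p.1 := hp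
  rw [← Function.iterate_succ_apply, Function.iterate_succ_apply',
    pd_congr hU (iterate_pd_primitive hψ hL n le_rfl) _ hp,
    smoothOn_pd_const_smul hU (contDiff_moment hψ L _).contDiffOn _ _ hp, Nat.sub_self,
    pd_moment_zero hψ (hL _ _ (by linarith))]
  have : ((-1 : ℝ)) ^ (n + 1 + n) = -1 := Odd.neg_one_pow ⟨n, by ring⟩
  rw [this]; simp

lemma moment_eq_integral_Ioi {ψ : ℝ × ℝ → ℂ} {L : ℝ}
    (hL : ∀ x t, L - 1 ≤ x → ψ (x, t) = 0) (hL0 : 0 ≤ L) (k : ℕ) {x : ℝ} (hx : -1 < x) (t : ℝ) :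
    moment ψ L k (x, t) = ∫ v in Ioi x, ((v - x) ^ k / k.factorial : ℝ) • ψ (v, t) := by
  have e1 : moment ψ L k (x, t)
      = ∫ v in x..(x + L), ((v - x) ^ k / k.factorial : ℝ) • ψ (v, t) := by
    have := intervalIntegral.integral_comp_add_left
      (fun v => ((v - x) ^ k / k.factorial : ℝ) • ψ (v, t)) x (a := 0) (b := L)
    simpa [moment] using this
  rw [e1, intervalIntegral.integral_of_le (by linarith)]
  refine (setIntegral_eq_of_subset_of_forall_sdiff_eq_zero measurableSet_Ioi
    Ioc_subset_Ioi_self ?_).symm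
  rintro v ⟨hv, hv'⟩
  have hv0 : x < v := hv
  rw [hL v t, smul_zero]
  by_contra h
  exact hv' ⟨hv0, by linarith⟩

/-! ### The radial wave equation in dimension `2 n + 3` -/

/-- The backward solution, in the variable `w = |x|²`, of the radial wave equation in dimension
`2 n + 3` with source `ψ`: the `n`-th derivative of a solution in dimension `3`. -/
def radialSol (n : ℕ) (ψ : ℝ × ℝ → ℂ) (L N : ℝ) : ℝ × ℝ → ℂ :=
  (pd (1, 0))^[n] (waveSol (fun p => primitive n ψ L (p.1 ^ 2, p.2)) N)

lemma contDiff_primitive_sq {ψ : ℝ × ℝ → ℂ} (hψ : ContDiff ℝ ∞ ψ) (L : ℝ) (n : ℕ) :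
    ContDiff ℝ ∞ (fun p : ℝ × ℝ => primitive n ψ L (p.1 ^ 2, p.2)) :=
  (contDiff_primitive hψ L n).comp (by fun_prop)

lemma contDiffOn_radialSol {ψ : ℝ × ℝ → ℂ} (hψ : ContDiff ℝ ∞ ψ) (n : ℕ) (L N : ℝ) :
    ContDiffOn ℝ ∞ (radialSol n ψ L N) halfPlane :=
  smoothOn_iterate_pd isOpen_halfPlane (contDiffOn_waveSol (contDiff_primitive_sq hψ L n) N) _ n

lemma pd_fst_sq {A : ℝ × ℝ → ℂ} (hA : ContDiff ℝ ∞ A) (y t : ℝ) :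
    pd (1, 0) (fun p : ℝ × ℝ => A (p.1 ^ 2, p.2)) (y, t) = (2 * y) • pd (1, 0) A (y ^ 2, t) := by
  have hs : ContDiff ℝ ∞ (fun p : ℝ × ℝ => A (p.1 ^ 2, p.2)) := hA.comp (by fun_prop)
  have h1 := ContDiff.hasDerivAt_pd hs ((hasDerivAt_id y).prodMk (hasDerivAt_const y t))
  have h2 := ContDiff.hasDerivAt_pd hA (((hasDerivAt_id y).pow 2).prodMk (hasDerivAt_const y t))
  have h3 := h1.unique h2
  simp only [Pi.pow_apply, id] at h3
  rw [h3, ← pd_smul_dir]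
  simp

/-- Every derivative in `w = |x|²` raises the dimension of the radial wave equation by two: the
first-order coefficient `2 d = 6` becomes `6 + 4 n = 2 (2 n + 3)`. -/
lemma wave_iterate {X A : ℝ × ℝ → ℂ} {V : Set (ℝ × ℝ)} (hV : IsOpen V)
    (hX : ContDiffOn ℝ ∞ X V) (hA : ContDiffOn ℝ ∞ A V)
    (h : ∀ p ∈ V, pd (0, 1) (pd (0, 1) X) p = (4 * p.1) • pd (1, 0) (pd (1, 0) X) p
      + (6 : ℝ) • pd (1, 0) X p + A p) (n : ℕ) :
    ∀ p ∈ V, pd (0, 1) (pd (0, 1) ((pd (1, 0))^[n] X)) p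
      = (4 * p.1) • pd (1, 0) (pd (1, 0) ((pd (1, 0))^[n] X)) p
      + (6 + 4 * n : ℝ) • pd (1, 0) ((pd (1, 0))^[n] X) p + (pd (1, 0))^[n] A p := by
  induction n with
  | zero => simpa using h
  | succ n ih =>
    intro p hp
    set Y := (pd ((1 : ℝ), (0 : ℝ)))^[n] X with hY
    have sY : ContDiffOn ℝ ∞ Y V := smoothOn_iterate_pd hV hX _ n
    have sY1 := smoothOn_pd hV sY (1, 0)
    have sY2 := smoothOn_pd hV sY1 (1, 0)
    have sA := smoothOn_iterate_pd hV hA (1, 0) n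
    have hlin : ContDiffOn ℝ ∞ (fun p : ℝ × ℝ => 4 * p.1) V := by fun_prop
    have hpdlin : pd (1, 0) (fun p : ℝ × ℝ => 4 * p.1) p = 4 := by
      have : HasFDerivAt (fun p : ℝ × ℝ => 4 * p.1) ((4 : ℝ) • ContinuousLinearMap.fst ℝ ℝ ℝ) p :=
        (hasFDerivAt_fst).const_mul 4
      simp [pd, this.fderiv]
    have e1 : pd (0, 1) (pd (0, 1) ((pd (1, 0))^[n + 1] X)) p
        = pd (1, 0) (pd (0, 1) (pd (0, 1) Y)) p := by
      rw [Function.iterate_succ_apply', ← hY,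
        pd_congr hV (pd_comm hV sY (0, 1) (1, 0)) _ hp,
        pd_comm hV (smoothOn_pd hV sY _) (0, 1) (1, 0) hp]
    have t2 : ContDiffOn ℝ ∞ (fun p => (4 * p.1) • pd (1, 0) (pd (1, 0) Y) p) V := hlin.smul sY2
    have t1 : ContDiffOn ℝ ∞ (fun p => (6 + 4 * n : ℝ) • pd (1, 0) Y p) V :=
      sY1.const_smul (6 + 4 * n : ℝ)
    rw [e1, pd_congr hV ih _ hp, smoothOn_pd_add hV (t2.add t1) sA _ hp,
      smoothOn_pd_add hV t2 t1 _ hp,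
      smoothOn_pd_smul hV hlin sY2 _ hp, smoothOn_pd_const_smul hV sY1 _ _ hp, hpdlin]
    simp only [Function.iterate_succ_apply', ← hY]
    push_cast
    module

lemma wave_radialSol {ψ : ℝ × ℝ → ℂ} (hψ : ContDiff ℝ ∞ ψ) {L N T : ℝ}
    (hL : ∀ x t, L - 1 ≤ x → ψ (x, t) = 0) (hT : ∀ x t, T < t → ψ (x, t) = 0) (n : ℕ)
    {p : ℝ × ℝ} (hp : 0 < p.1) (htN : T < p.2 + N) :
    pd (0, 1) (pd (0, 1) (radialSol n ψ L N)) p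
      = (4 * p.1) • pd (1, 0) (pd (1, 0) (radialSol n ψ L N)) p
        + (6 + 4 * n : ℝ) • pd (1, 0) (radialSol n ψ L N) p + ψ p := by
  set V : Set (ℝ × ℝ) := {p | 0 < p.1 ∧ T < p.2 + N} with hVdef
  have hV : IsOpen V := (isOpen_lt continuous_const continuous_fst).inter
    (isOpen_lt continuous_const (continuous_snd.add continuous_const))
  have hVh : V ⊆ halfPlane := fun p hp => hp.1
  have hA := contDiff_primitive hψ L n
  have hf := contDiff_primitive_sq hψ L n
  have hfT : ∀ y t, T < t → (fun p : ℝ × ℝ => primitive n ψ L (p.1 ^ 2, p.2)) (y, t) = 0 := by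
    intro y t ht
    simp [primitive, moment, hT _ _ ht]
  have := wave_iterate hV ((contDiffOn_waveSol hf N).mono hVh)
    (contDiff_pd hA (1, 0)).contDiffOn (fun p hp => by
      rw [wave_waveSol hf hfT hp.1 hp.2, pd_fst_sq hA, smul_smul, Real.sq_sqrt hp.1.le]
      have : √p.1 ≠ 0 := (Real.sqrt_pos.2 hp.1).ne'
      rw [show 1 / (2 * √p.1) * (2 * √p.1) = 1 by field_simp, one_smul]) n p ⟨hp, htN⟩
  rw [radialSol, this, iterate_pd_primitive_eq hψ hL n (show (-1 : ℝ) < p.1 by linarith)]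

/-- Iterated directional derivatives are the derivatives along a line. -/
lemma iterate_pd_eq_iteratedDeriv {P : Type} [NormedAddCommGroup P] [NormedSpace ℝ P]
    {h : P → ℂ} {U : Set P} (hU : IsOpen U) (hh : ContDiffOn ℝ ∞ h U) (c v : P) (n : ℕ) :
    ∀ w : ℝ, c + w • v ∈ U →
    (pd v)^[n] h (c + w • v) = iteratedDeriv n (fun w : ℝ => h (c + w • v)) w := by
  induction n with
  | zero => intro w _; rfl
  | succ n ih =>
    intro w hp
    have hcurve : ∀ w : ℝ, HasDerivAt (fun w : ℝ => c + w • v) v w := fun w => by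
      simpa using ((hasDerivAt_id w).smul_const v).const_add c
    rw [Function.iterate_succ_apply', iteratedDeriv_succ]
    have hev : iteratedDeriv n (fun w : ℝ => h (c + w • v)) =ᶠ[nhds w]
        fun w => (pd v)^[n] h (c + w • v) := by
      filter_upwards [(hcurve w).continuousAt.preimage_mem_nhds (hU.mem_nhds hp)] with x hx
        using (ih x hx).symm
    rw [hev.deriv_eq]
    exact (smoothOn_hasDerivAt_comp hU (smoothOn_iterate_pd hU hh _ n) (hcurve w) hp).deriv.symm

section

/-! ### Kernel representation and pointwise bound of the backward solution -/

variable {n : ℕ}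

lemma continuous_slice {ψ : ℝ × ℝ → ℂ} (hψ : Continuous ψ) (t : ℝ) :
    Continuous fun v => ψ (v, t) := hψ.comp (by fun_prop)

lemma hasCompactSupport_slice {ψ : ℝ × ℝ → ℂ} (hc : HasCompactSupport ψ) (t : ℝ) :
    HasCompactSupport fun v => ψ (v, t) := by
  refine HasCompactSupport.intro (hc.isCompact.image continuous_fst) fun v hv => ?_
  by_contra h
  exact hv ⟨(v, t), subset_tsupport _ h, rfl⟩

lemma KernelExpansion.continuous_kernel (K : KernelExpansion n) (w s : ℝ) :
    Continuous fun v => K.kernel v w s := by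
  unfold KernelExpansion.kernel
  fun_prop

lemma KernelExpansion.integrable_kernel_smul (K : KernelExpansion n) (w s : ℝ) {ψ : ℝ × ℝ → ℂ}
    (hψ : Continuous ψ) (hc : HasCompactSupport ψ) (t : ℝ) :
    Integrable fun v => K.kernel v w s • ψ (v, t) :=
  ((K.continuous_kernel w s).smul (continuous_slice hψ t)).integrable_of_hasCompactSupport
    ((hasCompactSupport_slice hc t).smul_left)

/-- The derivatives in `w` fall on the kernel: the moving end point of the integral contributes
nothing, since `n` derivatives of a function vanishing there to order `n` are taken. -/
lemma KernelExpansion.iteratedDeriv_primitive (K : KernelExpansion n) {ψ : ℝ × ℝ → ℂ}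
    (hψ : ContDiff ℝ ∞ ψ) (hc : HasCompactSupport ψ) {L : ℝ}
    (hL : ∀ x t, L - 1 ≤ x → ψ (x, t) = 0) (hL0 : 0 ≤ L) (t s : ℝ) {w : ℝ} (hw : 0 < w) :
    iteratedDeriv n (fun w => (1 / (2 * √w)) • primitive n ψ L ((√w + s) ^ 2, t)) w
      = ∫ v in Ioi ((√w + s) ^ 2), K.kernel v w s • ψ (v, t) := by
  have hA := contDiff_primitive hψ L n
  have hU : IsOpen {p : ℝ × ℝ | -1 < p.1} := isOpen_lt continuous_const continuous_fst
  have ha : ContDiff ℝ ∞ (fun x => primitive n ψ L (x, t)) := hA.comp (by fun_prop)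
  have hz : -1 < (√w + s) ^ 2 := by nlinarith [sq_nonneg (√w + s)]
  rw [K.expand _ ha s w hw]
  have hterm : ∀ j, (K.c j * (√w)⁻¹ ^ K.k j * (√w + s) ^ K.l j) •
      iteratedDeriv (K.i j) (fun x => primitive n ψ L (x, t)) ((√w + s) ^ 2)
      = ∫ v in Ioi ((√w + s) ^ 2), (K.c j * (√w)⁻¹ ^ K.k j * (√w + s) ^ K.l j *
        ((-1) ^ (n + 1 + K.i j) * (v - (√w + s) ^ 2) ^ (n - K.i j) / (n - K.i j).factorial)) •
          ψ (v, t) := fun j => by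
    have h1 := iterate_pd_eq_iteratedDeriv isOpen_univ hA.contDiffOn ((0 : ℝ), t) ((1 : ℝ), (0 : ℝ))
      (K.i j) ((√w + s) ^ 2) (mem_univ _)
    simp only [Prod.smul_mk, smul_eq_mul, mul_one, mul_zero, Prod.mk_add_mk, zero_add,
      add_zero] at h1
    rw [← h1, iterate_pd_primitive hψ hL n (K.spec j).2.1 (show (-1 : ℝ) < _ from hz)]
    simp only
    rw [moment_eq_integral_Ioi hL hL0 _ hz, ← integral_smul, ← integral_smul]
    refine integral_congr_ae (Filter.Eventually.of_forall fun v => ?_)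
    simp only [smul_smul]
    congr 1
    ring
  rw [Finset.sum_congr rfl fun j _ => hterm j, ← integral_finsetSum]
  · refine integral_congr_ae (Filter.Eventually.of_forall fun v => ?_)
    simp only [KernelExpansion.kernel, Finset.sum_smul]
  · intro j _
    refine Integrable.integrableOn ?_
    have hcs : Continuous fun v : ℝ => K.c j * (√w)⁻¹ ^ K.k j * (√w + s) ^ K.l j *
        ((-1) ^ (n + 1 + K.i j) * (v - (√w + s) ^ 2) ^ (n - K.i j) / (n - K.i j).factorial) :=
      continuous_const.mul ((continuous_const.mul
        ((continuous_id.sub continuous_const).pow _)).div_const _)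
    exact (hcs.smul (continuous_slice hψ.continuous t)).integrable_of_hasCompactSupport
      ((hasCompactSupport_slice hc t).smul_left)

/-- The backward solution is given by integration of the source against the Riemann function over
the dependence domain. -/
lemma KernelExpansion.radialSol_eq (K : KernelExpansion n) {ψ : ℝ × ℝ → ℂ}
    (hψ : ContDiff ℝ ∞ ψ) (hc : HasCompactSupport ψ) {L N : ℝ}
    (hL : ∀ x t, L - 1 ≤ x → ψ (x, t) = 0) (hL0 : 0 ≤ L) (hN : 0 ≤ N) (t : ℝ) {y : ℝ}
    (hy : 0 < y) :
    radialSol n ψ L N (y ^ 2, t)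
      = ∫ τ in (0 : ℝ)..N, (-1 / 2 : ℝ) • ∫ v in Ioc ((y - τ) ^ 2) ((y + τ) ^ 2),
          K.kernel v (y ^ 2) (-τ) • ψ (v, t + τ) := by
  have hw : 0 < y ^ 2 := by positivity
  have hf := contDiff_primitive_sq hψ L n
  have hA := contDiff_primitive hψ L n
  have sK : ContDiffOn ℝ ∞ (waveIntegrand fun p => primitive n ψ L (p.1 ^ 2, p.2))
      (halfPlane ×ˢ univ) := by
    rw [halfPlane_prod_univ]; exact contDiffOn_waveIntegrand hf
  rw [radialSol]
  have h0 := iterate_pd_param_integral isOpen_halfPlane sK N (1, 0) n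
    (show ((y ^ 2, t) : ℝ × ℝ) ∈ halfPlane from hw)
  refine (h0.trans ?_)
  refine intervalIntegral.integral_congr fun τ hτ => ?_
  rw [uIcc_of_le hN] at hτ
  have h1 := iterate_pd_eq_iteratedDeriv isOpen_regionPos (contDiffOn_waveIntegrand hf)
    (((0 : ℝ), t), τ) (((1 : ℝ), (0 : ℝ)), (0 : ℝ)) n (y ^ 2) (by simpa [regionPos] using hw)
  simp only [Prod.smul_mk, smul_eq_mul, mul_one, mul_zero, Prod.mk_add_mk, zero_add,
    add_zero] at h1
  rw [h1]
  have hsplit : (fun w => waveIntegrand (fun p => primitive n ψ L (p.1 ^ 2, p.2)) ((w, t), τ))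
      = fun w => (1 / 2 : ℝ) • (((1 / (2 * √w)) • primitive n ψ L ((√w + τ) ^ 2, t + τ))
          - ((1 / (2 * √w)) • primitive n ψ L ((√w + -τ) ^ 2, t + τ))) := by
    funext w
    simp only [waveIntegrand, invPow, charDiff, pow_one, ← sub_eq_add_neg, ← smul_sub, smul_smul]
    congr 1
    rw [one_div (2 * √w), mul_inv]
    ring
  have hsm : ∀ s : ℝ, ContDiffAt ℝ n
      (fun w => (1 / (2 * √w)) • primitive n ψ L ((√w + s) ^ 2, t + τ)) (y ^ 2) := by
    intro s
    have h1 : ContDiffAt ℝ n (fun w => √w) (y ^ 2) := Real.contDiffAt_sqrt hw.ne'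
    have h2 : ContDiffAt ℝ n (fun w => (1 / (2 * √w))) (y ^ 2) :=
      contDiffAt_const.div (contDiffAt_const.mul h1) (by positivity)
    refine h2.smul ?_
    refine (hA.of_le (by exact_mod_cast le_top)).contDiffAt.comp (y ^ 2) ?_
    exact ((h1.add contDiffAt_const).pow 2).prodMk contDiffAt_const
  rw [hsplit]
  have hsub : iteratedDeriv n (fun w => (1 / 2 : ℝ) •
      (((1 / (2 * √w)) • primitive n ψ L ((√w + τ) ^ 2, t + τ))
          - ((1 / (2 * √w)) • primitive n ψ L ((√w + -τ) ^ 2, t + τ)))) (y ^ 2)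
      = (1 / 2 : ℝ) • (iteratedDeriv n
          (fun w => (1 / (2 * √w)) • primitive n ψ L ((√w + τ) ^ 2, t + τ)) (y ^ 2)
        - iteratedDeriv n
          (fun w => (1 / (2 * √w)) • primitive n ψ L ((√w + -τ) ^ 2, t + τ)) (y ^ 2)) := by
    have h3 := iteratedDeriv_sub (hsm τ) (hsm (-τ))
    have h4 := iteratedDeriv_const_smul_field (n := n) (x := y ^ 2) (1 / 2 : ℝ)
      ((fun w => (1 / (2 * √w)) • primitive n ψ L ((√w + τ) ^ 2, t + τ))
        - fun w => (1 / (2 * √w)) • primitive n ψ L ((√w + -τ) ^ 2, t + τ))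
    exact h4.trans (congrArg _ h3)
  rw [hsub, K.iteratedDeriv_primitive hψ hc hL hL0 _ _ hw,
    K.iteratedDeriv_primitive hψ hc hL hL0 _ _ hw, Real.sqrt_sq hy.le, ← sub_eq_add_neg]
  simp only [← K.kernel_neg _ τ hw]
  have hle : (y - τ) ^ 2 ≤ (y + τ) ^ 2 := by nlinarith [hτ.1]
  have hint := K.integrable_kernel_smul (y ^ 2) (-τ) hψ.continuous hc (t + τ)
  rw [← Ioc_union_Ioi_eq_Ioi hle, setIntegral_union (Ioc_disjoint_Ioi le_rfl) measurableSet_Ioi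
    hint.integrableOn hint.integrableOn]
  module

/-- The source is supported in `0 < t`, `t + ε ≤ √v ≤ b`, `t ≤ T`. -/
structure SupportedOutside (ψ : ℝ × ℝ → ℂ) (ε b T : ℝ) : Prop where
  pos : ∀ v t, ψ (v, t) ≠ 0 → 0 < t
  gap : ∀ v t, ψ (v, t) ≠ 0 → t + ε ≤ √v
  le_b : ∀ v t, ψ (v, t) ≠ 0 → √v ≤ b
  le_T : ∀ v t, ψ (v, t) ≠ 0 → t ≤ T

lemma mem_dependence {y τ v : ℝ} (hy : 0 < y) (hτ : 0 ≤ τ)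
    (hv : v ∈ Ioc ((y - τ) ^ 2) ((y + τ) ^ 2)) :
    0 < v ∧ |y - τ| < √v ∧ √v ≤ y + τ := by
  have hv0 : 0 < v := lt_of_le_of_lt (sq_nonneg _) hv.1
  refine ⟨hv0, ?_, ?_⟩
  · rw [← Real.sqrt_sq_eq_abs]
    exact Real.sqrt_lt_sqrt (sq_nonneg _) hv.1
  · rw [← Real.sqrt_sq (by linarith : 0 ≤ y + τ)]
    exact Real.sqrt_le_sqrt hv.2

/-- Finite speed of propagation. -/
lemma KernelExpansion.radialSol_support (K : KernelExpansion n) {ψ : ℝ × ℝ → ℂ}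
    (hψ : ContDiff ℝ ∞ ψ) (hc : HasCompactSupport ψ) {L N ε b T : ℝ}
    (hS : SupportedOutside ψ ε b T)
    (hL : ∀ x t, L - 1 ≤ x → ψ (x, t) = 0) (hL0 : 0 ≤ L) (hN : 0 ≤ N) {t : ℝ} {y : ℝ}
    (hy : 0 < y) (h : radialSol n ψ L N (y ^ 2, t) ≠ 0) :
    ε + t ≤ y ∧ y ≤ b + T - t ∧ t ≤ T := by
  by_contra hcon
  refine h ?_
  rw [K.radialSol_eq hψ hc hL hL0 hN t hy]
  refine (intervalIntegral.integral_congr (g := fun _ => 0) fun τ hτ => ?_).trans (by simp)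
  rw [uIcc_of_le hN] at hτ
  simp only
  rw [setIntegral_eq_zero_of_forall_eq_zero, smul_zero]
  intro v hv
  by_contra hne
  have hψ0 : ψ (v, t + τ) ≠ 0 := fun h0 => hne (by rw [h0, smul_zero])
  obtain ⟨hv0, h1, h2⟩ := mem_dependence hy hτ.1 hv
  have h3 := hS.gap _ _ hψ0
  have h4 := hS.le_b _ _ hψ0
  have h5 := hS.le_T _ _ hψ0
  have h6 := (abs_lt.1 h1).2
  exact hcon ⟨by linarith, by linarith, by linarith [hτ.1]⟩

/-- The pointwise bound of the backward solution in terms of its source. -/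
lemma KernelExpansion.exists_radialSol_bound (K : KernelExpansion n) : ∃ C : ℝ, 0 < C ∧
    ∀ {ψ : ℝ × ℝ → ℂ}, ContDiff ℝ ∞ ψ → HasCompactSupport ψ → ∀ {L N ε b T : ℝ}, 0 < ε →
    SupportedOutside ψ ε b T → (∀ x t, L - 1 ≤ x → ψ (x, t) = 0) → 0 ≤ L → 0 ≤ N →
    ∀ t y : ℝ, 0 < t → 0 < y →
    ‖radialSol n ψ L N (y ^ 2, t)‖ₑ ≤ ENNReal.ofReal (C * y⁻¹ ^ (n + 1)) *
      ∫⁻ t' : ℝ, ∫⁻ v : ℝ, {z : ℝ × ℝ | t < y ∧ y + t ≤ 2 * √z.1}.indicator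
        (fun z => ENNReal.ofReal (√z.1 ^ n) * ‖ψ z‖ₑ) (v, t') := by
  obtain ⟨C, hC, hK⟩ := K.exists_bound
  refine ⟨C, hC, ?_⟩
  intro ψ hψ hc L N ε b T hε hS hL hL0 hN t y ht hy
  rw [K.radialSol_eq hψ hc hL hL0 hN t hy, intervalIntegral.integral_of_le hN]
  set G : ℝ → ℝ≥0∞ := fun t' => ∫⁻ v : ℝ, {z : ℝ × ℝ | t < y ∧ y + t ≤ 2 * √z.1}.indicator
        (fun z => ENNReal.ofReal (√z.1 ^ n) * ‖ψ z‖ₑ) (v, t') with hG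
  have hpt : ∀ τ ∈ Ioc 0 N, ‖(-1 / 2 : ℝ) • ∫ v in Ioc ((y - τ) ^ 2) ((y + τ) ^ 2),
      K.kernel v (y ^ 2) (-τ) • ψ (v, t + τ)‖ₑ ≤ ENNReal.ofReal (C * y⁻¹ ^ (n + 1)) * G (t + τ) := by
    intro τ hτ
    rw [enorm_smul]
    have half : ‖(-1 / 2 : ℝ)‖ₑ ≤ 1 := by
      rw [Real.enorm_eq_ofReal_abs]
      simpa using ENNReal.ofReal_le_ofReal (by norm_num [abs_of_nonneg] : |(-1 / 2 : ℝ)| ≤ 1)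
    refine (mul_le_of_le_one_left' half).trans ?_
    refine (enorm_integral_le_lintegral_enorm _).trans ?_
    rw [hG, ← lintegral_const_mul' _ _ ENNReal.ofReal_ne_top]
    rw [← lintegral_indicator measurableSet_Ioc]
    refine lintegral_mono fun v => ?_
    by_cases hv : v ∈ Ioc ((y - τ) ^ 2) ((y + τ) ^ 2)
    swap
    · simp [indicator_of_notMem hv]
    rw [indicator_of_mem hv]
    by_cases hψ0 : ψ (v, t + τ) = 0
    · simp [hψ0]
    obtain ⟨hv0, h1, h2⟩ := mem_dependence hy hτ.1.le hv
    have h3 := hS.gap _ _ hψ0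
    have h6 := abs_lt.1 h1
    have hρ : 0 < √v := Real.sqrt_pos.2 hv0
    have hmem : ((v, t + τ) : ℝ × ℝ) ∈ {z : ℝ × ℝ | t < y ∧ y + t ≤ 2 * √z.1} :=
      ⟨by linarith, by show y + t ≤ 2 * √v; linarith⟩
    rw [indicator_of_mem hmem, enorm_smul, ← mul_assoc, ← ENNReal.ofReal_mul (by positivity)]
    gcongr
    rw [Real.enorm_eq_ofReal_abs]
    refine ENNReal.ofReal_le_ofReal ?_
    have := hK (√v) y τ hy hρ (by linarith) h1.le (by linarith) h2
    rw [Real.sq_sqrt hv0.le] at this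
    calc _ ≤ _ := this
      _ = _ := by ring
  calc _ ≤ ∫⁻ τ in Ioc 0 N, ‖(-1 / 2 : ℝ) • ∫ v in Ioc ((y - τ) ^ 2) ((y + τ) ^ 2),
      K.kernel v (y ^ 2) (-τ) • ψ (v, t + τ)‖ₑ := enorm_integral_le_lintegral_enorm _
    _ ≤ ∫⁻ τ in Ioc 0 N, ENNReal.ofReal (C * y⁻¹ ^ (n + 1)) * G (t + τ) :=
        setLIntegral_mono' measurableSet_Ioc hpt
    _ ≤ ∫⁻ τ, ENNReal.ofReal (C * y⁻¹ ^ (n + 1)) * G (t + τ) := setLIntegral_le_lintegral _ _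
    _ = ENNReal.ofReal (C * y⁻¹ ^ (n + 1)) * ∫⁻ τ, G (t + τ) :=
        lintegral_const_mul' _ _ ENNReal.ofReal_ne_top
    _ = _ := by rw [lintegral_add_left_eq_self]

end

section

/-! ### The radial test functions -/

lemma pd_pd_eq_fderiv {P E : Type} [NormedAddCommGroup P] [NormedSpace ℝ P]
    [NormedAddCommGroup E] [NormedSpace ℝ E] {f : P → E} {p : P} (hf : ContDiffAt ℝ 2 f p)
    (a b : P) : pd a (pd b f) p = fderiv ℝ (fderiv ℝ f) p a b := by
  have hd : DifferentiableAt ℝ (fderiv ℝ f) p :=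
    (hf.fderiv_right (m := 1) (by norm_num)).differentiableAt (by simp)
  have h1 : HasFDerivAt (fun q => fderiv ℝ f q b) _ p :=
    hd.hasFDerivAt.clm_apply (hasFDerivAt_const b p)
  show fderiv ℝ (fun q => fderiv ℝ f q b) p a = _
  rw [h1.fderiv]; simp

/-- The Laplacian of a radial function, written as a function of `w = |x|²`. -/
lemma laplacian_radial {d : ℕ} {G : ℝ × ℝ → ℂ} (hG : ContDiffOn ℝ ∞ G halfPlane) {x : Space d}
    (hx : x ≠ 0) (t : ℝ) :
    (Δ (fun x : Space d => G (‖x‖ ^ 2, t))) x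
      = (4 * ‖x‖ ^ 2) • pd (1, 0) (pd (1, 0) G) (‖x‖ ^ 2, t)
        + (2 * d : ℝ) • pd (1, 0) G (‖x‖ ^ 2, t) := by
  set V : Set (Space d) := {x | x ≠ 0} with hVdef
  have hV : IsOpen V := isOpen_ne
  have hmap : ContDiff ℝ ∞ (fun x : Space d => ((‖x‖ ^ 2, t) : ℝ × ℝ)) :=
    (contDiff_norm_sq ℝ).prodMk contDiff_const
  have hmaps : MapsTo (fun x : Space d => ((‖x‖ ^ 2, t) : ℝ × ℝ)) V halfPlane := fun x hx => by
    have : 0 < ‖x‖ := norm_pos_iff.2 hx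
    exact pow_pos this 2
  have first : ∀ {H : ℝ × ℝ → ℂ}, ContDiffOn ℝ ∞ H halfPlane → ∀ v : Space d,
      EqOn (pd v fun x : Space d => H (‖x‖ ^ 2, t))
        (fun x => (2 * inner ℝ x v : ℝ) • pd (1, 0) H (‖x‖ ^ 2, t)) V := by
    intro H hH v x hx
    have h1 := smoothOn_hasFDerivAt isOpen_halfPlane hH (hmaps hx)
    have h2 : HasFDerivAt (fun x : Space d => ((‖x‖ ^ 2, t) : ℝ × ℝ)) _ x :=
      ((hasStrictFDerivAt_norm_sq x).hasFDerivAt).prodMk (hasFDerivAt_const t x)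
    have h3 := h1.comp x h2
    show fderiv ℝ (fun x : Space d => H (‖x‖ ^ 2, t)) x v = _
    rw [show (fun x : Space d => H (‖x‖ ^ 2, t)) = H ∘ fun x : Space d => (‖x‖ ^ 2, t) from rfl,
      h3.fderiv]
    simp only
    rw [← pd_smul_dir]
    simp [pd]
  have hsm : ∀ {H : ℝ × ℝ → ℂ}, ContDiffOn ℝ ∞ H halfPlane →
      ContDiffOn ℝ ∞ (fun x : Space d => H (‖x‖ ^ 2, t)) V := fun hH =>
    hH.comp hmap.contDiffOn hmaps
  have hG1 := smoothOn_pd isOpen_halfPlane hG (1, 0)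
  have second : ∀ v : Space d, pd v (pd v fun x : Space d => G (‖x‖ ^ 2, t)) x
      = (4 * (inner ℝ x v) ^ 2 : ℝ) • pd (1, 0) (pd (1, 0) G) (‖x‖ ^ 2, t)
        + (2 * ‖v‖ ^ 2 : ℝ) • pd (1, 0) G (‖x‖ ^ 2, t) := by
    intro v
    have hl : ContDiffOn ℝ ∞ (fun x : Space d => (2 * inner ℝ x v : ℝ)) V :=
      (contDiff_const.mul (contDiff_id.inner ℝ contDiff_const)).contDiffOn
    have hlv : pd v (fun x : Space d => (2 * inner ℝ x v : ℝ)) x = 2 * ‖v‖ ^ 2 := by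
      have : HasFDerivAt (fun x : Space d => (2 * inner ℝ x v : ℝ))
          ((2 : ℝ) • (innerSL ℝ v)) x := by
        have := ((innerSL ℝ v).hasFDerivAt (x := x)).const_mul 2
        refine this.congr_of_eventuallyEq (Filter.Eventually.of_forall fun y => ?_)
        simp [real_inner_comm]
      simp [pd, this.fderiv]
    rw [pd_congr hV (first hG v) v hx, smoothOn_pd_smul hV hl (hsm hG1) v hx, first hG1 v hx, hlv,
      smul_smul]
    congr 2
    ring
  rw [InnerProductSpace.laplacian_eq_iteratedFDeriv_orthonormalBasis _
    (EuclideanSpace.basisFun (Fin d) ℝ)]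
  have hxV : x ∈ V := hx
  have hterm : ∀ i : Fin d, iteratedFDeriv ℝ 2 (fun x : Space d => G (‖x‖ ^ 2, t)) x
      ![EuclideanSpace.basisFun (Fin d) ℝ i, EuclideanSpace.basisFun (Fin d) ℝ i]
      = (4 * (x i) ^ 2 : ℝ) • pd (1, 0) (pd (1, 0) G) (‖x‖ ^ 2, t)
        + (2 : ℝ) • pd (1, 0) G (‖x‖ ^ 2, t) := by
    intro i
    have hsx : ContDiffAt ℝ 2 (fun x : Space d => G (‖x‖ ^ 2, t)) x :=
      ((hsm hG).contDiffAt (hV.mem_nhds hxV)).of_le (by norm_cast)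
    rw [iteratedFDeriv_two_apply]
    have := (pd_pd_eq_fderiv hsx (EuclideanSpace.basisFun (Fin d) ℝ i)
      (EuclideanSpace.basisFun (Fin d) ℝ i)).symm.trans (second _)
    simpa [EuclideanSpace.inner_single_right] using this
  refine (Finset.sum_congr rfl fun i _ => hterm i).trans ?_
  rw [Finset.sum_add_distrib, ← Finset.sum_smul,
    ← Finset.mul_sum, Finset.sum_const, EuclideanSpace.norm_sq_eq]
  simp only [Real.norm_eq_abs, sq_abs]
  congr 1
  rw [Finset.card_univ, Fintype.card_fin, ← Nat.cast_smul_eq_nsmul ℝ, smul_smul, mul_comm]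

/-- A smooth cut-off in time, equal to `1` for `t ≥ -ε/4` and to `0` for `t ≤ -ε/2`. -/
def timeCut (ε t : ℝ) : ℝ := Real.smoothTransition (4 * t / ε + 2)

lemma contDiff_timeCut (ε : ℝ) : ContDiff ℝ ∞ (timeCut ε) :=
  Real.smoothTransition.contDiff.comp (by fun_prop)

lemma timeCut_eq_one {ε t : ℝ} (hε : 0 < ε) (ht : -ε / 4 ≤ t) : timeCut ε t = 1 := by
  refine Real.smoothTransition.one_of_one_le ?_
  have : -1 ≤ 4 * t / ε := by rw [le_div_iff₀ hε]; linarith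
  linarith

lemma timeCut_eq_zero {ε t : ℝ} (hε : 0 < ε) (ht : t ≤ -ε / 2) : timeCut ε t = 0 := by
  refine Real.smoothTransition.zero_of_nonpos ?_
  have : 4 * t / ε ≤ -2 := by rw [div_le_iff₀ hε]; linarith
  linarith

variable {n : ℕ}

/-- The backward solution as a function on `ℝ^d × ℝ`, cut off at negative times. On the axis
`x = 0`, where the formula for `radialSol` is singular, the value is set to `0`; for sources
supported outside the light cone the solution vanishes near that axis. -/
def radialTest (d n : ℕ) (ψ : ℝ × ℝ → ℂ) (L N ε : ℝ) (z : Space d × ℝ) : ℂ :=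
  if z.1 = 0 then 0 else timeCut ε z.2 • radialSol n ψ L N (‖z.1‖ ^ 2, z.2)

lemma KernelExpansion.radialTest_ne_zero (K : KernelExpansion n) {d : ℕ} {ψ : ℝ × ℝ → ℂ}
    (hψ : ContDiff ℝ ∞ ψ) (hc : HasCompactSupport ψ) {L N ε b T : ℝ} (hε : 0 < ε)
    (hS : SupportedOutside ψ ε b T)
    (hL : ∀ x t, L - 1 ≤ x → ψ (x, t) = 0) (hL0 : 0 ≤ L) (hN : 0 ≤ N) {x : Space d} {t : ℝ}
    (h : radialTest d n ψ L N ε (x, t) ≠ 0) :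
    ε / 2 ≤ ‖x‖ ∧ ‖x‖ ≤ b + T + ε ∧ -ε ≤ t ∧ t ≤ T := by
  rw [radialTest] at h
  simp only [ne_eq, ite_eq_left_iff, Classical.not_imp, smul_eq_zero, not_or] at h
  obtain ⟨hx, h1, h2⟩ := h
  have ht : -ε / 2 < t := by
    by_contra hcon
    exact h1 (timeCut_eq_zero hε (not_lt.1 hcon))
  have := K.radialSol_support hψ hc hS hL hL0 hN (norm_pos_iff.2 hx) h2
  refine ⟨by linarith, by linarith, by linarith, this.2.2⟩

lemma KernelExpansion.contDiff_radialTest (K : KernelExpansion n) {d : ℕ} {ψ : ℝ × ℝ → ℂ}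
    (hψ : ContDiff ℝ ∞ ψ) (hc : HasCompactSupport ψ) {L N ε b T : ℝ} (hε : 0 < ε)
    (hS : SupportedOutside ψ ε b T)
    (hL : ∀ x t, L - 1 ≤ x → ψ (x, t) = 0) (hL0 : 0 ≤ L) (hN : 0 ≤ N) :
    ContDiff ℝ ∞ (radialTest d n ψ L N ε) := by
  rw [contDiff_iff_contDiffAt]
  rintro ⟨x, t⟩
  by_cases hx : x = 0
  · have hU : {z : Space d × ℝ | ‖z.1‖ < ε / 2} ∈ nhds (x, t) :=
      (isOpen_lt (by fun_prop) continuous_const).mem_nhds (by simp [hx, hε])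
    refine (contDiffAt_const (c := (0 : ℂ))).congr_of_eventuallyEq ?_
    filter_upwards [hU] with z hz
    by_contra hne
    exact absurd (K.radialTest_ne_zero hψ hc hε hS hL hL0 hN hne).1 (not_le.2 hz)
  · have hU : {z : Space d × ℝ | z.1 ≠ 0} ∈ nhds (x, t) :=
      (isOpen_ne.preimage continuous_fst).mem_nhds hx
    have hsm : ContDiffAt ℝ ∞ (fun z : Space d × ℝ =>
        timeCut ε z.2 • radialSol n ψ L N (‖z.1‖ ^ 2, z.2)) (x, t) := by
      refine ((contDiff_timeCut ε).comp contDiff_snd).contDiffAt.smul ?_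
      have hmem : ((‖x‖ ^ 2, t) : ℝ × ℝ) ∈ halfPlane := pow_pos (norm_pos_iff.2 hx) 2
      have h1 := (contDiffOn_radialSol hψ n L N).contDiffAt (isOpen_halfPlane.mem_nhds hmem)
      refine ContDiffAt.comp (g := radialSol n ψ L N)
        (f := fun z : Space d × ℝ => ((‖z.1‖ ^ 2, z.2) : ℝ × ℝ)) (x, t) h1 ?_
      exact ((((contDiff_norm_sq ℝ).comp contDiff_fst).prodMk contDiff_snd)).contDiffAt
    refine hsm.congr_of_eventuallyEq ?_
    filter_upwards [hU] with z hz
    simp only [radialTest, if_neg (show ¬ z.1 = 0 from hz)]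

lemma KernelExpansion.hasCompactSupport_radialTest (K : KernelExpansion n) {d : ℕ}
    {ψ : ℝ × ℝ → ℂ}
    (hψ : ContDiff ℝ ∞ ψ) (hc : HasCompactSupport ψ) {L N ε b T : ℝ} (hε : 0 < ε)
    (hS : SupportedOutside ψ ε b T)
    (hL : ∀ x t, L - 1 ≤ x → ψ (x, t) = 0) (hL0 : 0 ≤ L) (hN : 0 ≤ N) :
    HasCompactSupport (radialTest d n ψ L N ε) := by
  refine HasCompactSupport.intro
    ((isCompact_closedBall (0 : Space d) (b + T + ε)).prod (isCompact_Icc (a := -ε) (b := T)))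
    fun z hz => ?_
  by_contra hne
  obtain ⟨_, h2, h3, h4⟩ := K.radialTest_ne_zero hψ hc hε hS hL hL0 hN (x := z.1) (t := z.2) hne
  exact hz ⟨by simpa using h2, h3, h4⟩

/-- For every source supported outside the light cone there is a test function solving the wave
equation for positive times, bounded pointwise by the source on the dependence domain. -/
theorem exists_testFun (n : ℕ) : ∃ C : ℝ, 0 < C ∧ ∀ (d : ℕ), d = 2 * n + 3 →
    ∀ {ψ : ℝ × ℝ → ℂ}, ContDiff ℝ ∞ ψ → HasCompactSupport ψ → ∀ {ε b T : ℝ}, 0 < ε →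
    SupportedOutside ψ ε b T → ∃ φ : TestFun d,
      (∀ (x : Space d) (t : ℝ), 0 < t → TestFun.box φ (x, t) = ψ (‖x‖ ^ 2, t)) ∧
      (∀ (x : Space d) (t : ℝ), 0 < t →
        ‖φ (x, t)‖ₑ ≤ ENNReal.ofReal (C * ‖x‖⁻¹ ^ (n + 1)) *
        ∫⁻ t' : ℝ, ∫⁻ v : ℝ, {z : ℝ × ℝ | t < ‖x‖ ∧ ‖x‖ + t ≤ 2 * √z.1}.indicator
        (fun z => ENNReal.ofReal (√z.1 ^ n) * ‖ψ z‖ₑ) (v, t')) := by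
  obtain ⟨K⟩ := nonempty_kernelExpansion n
  obtain ⟨C, hC, hK⟩ := K.exists_radialSol_bound
  refine ⟨C, hC, ?_⟩
  intro d hd ψ hψ hc ε b T hε hS
  -- `L` and `N` lie beyond the support of `ψ` in the two variables
  set L : ℝ := b ^ 2 + 2 with hLdef
  set N : ℝ := max T 0 + 1 with hNdef
  have hL : ∀ x t, L - 1 ≤ x → ψ (x, t) = 0 := by
    intro x t hx
    by_contra hne
    have h1 := hS.le_b _ _ hne
    have h2 : 0 ≤ x := by nlinarith [sq_nonneg b]
    have h3 : x ≤ b ^ 2 := (Real.sqrt_le_left ((Real.sqrt_nonneg x).trans h1)).1 h1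
    linarith
  have hL0 : 0 ≤ L := by positivity
  have hN : 0 ≤ N := by positivity
  have hT : ∀ x t, T < t → ψ (x, t) = 0 := fun x t ht => by
    by_contra hne
    exact absurd (hS.le_T _ _ hne) (not_le.2 ht)
  let φ : TestFun d := ⟨radialTest d n ψ L N ε, by
    exact_mod_cast K.contDiff_radialTest hψ hc hε hS hL hL0 hN,
    K.hasCompactSupport_radialTest hψ hc hε hS hL hL0 hN, fun _ _ => trivial⟩
  have hφ : ∀ z, φ z = radialTest d n ψ L N ε z := fun z => rfl
  refine ⟨φ, fun x t ht => ?_, fun x t ht => ?_⟩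
  · by_cases hx : x = 0
    · have hψ0 : ψ (‖x‖ ^ 2, t) = 0 := by
        by_contra hne
        have := hS.gap _ _ hne
        simp [hx] at this
        linarith
      have hz1 : ∀ t : ℝ, φ (x, t) = 0 := fun t => by simp [hφ, radialTest, hx]
      have hz2 : (fun x : Space d => φ (x, t)) =ᶠ[nhds x] fun _ => 0 := by
        have hU : {x : Space d | ‖x‖ < ε / 2} ∈ nhds x :=
          (isOpen_lt (by fun_prop) continuous_const).mem_nhds (by simp [hx, hε])
        filter_upwards [hU] with y hy
        by_contra hne
        exact absurd (K.radialTest_ne_zero hψ hc hε hS hL hL0 hN hne).1 (not_le.2 hy)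
      rw [hψ0, TestFun.box, InnerProductSpace.laplacian_congr_nhds hz2 |>.eq_of_nhds]
      simp [hz1, InnerProductSpace.laplacian_const]
    · have hpos : 0 < ‖x‖ ^ 2 := pow_pos (norm_pos_iff.2 hx) 2
      have sG := contDiffOn_radialSol hψ n L N
      have e1 : (fun s => φ (x, s)) =ᶠ[nhds t]
          fun s => radialSol n ψ L N ((‖x‖ ^ 2, (0 : ℝ)) + s • ((0 : ℝ), (1 : ℝ))) := by
        filter_upwards [Ioi_mem_nhds ht] with s (hs : 0 < s)
        simp [hφ, radialTest, hx, timeCut_eq_one hε (by linarith : -ε / 4 ≤ s)]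
      have e2 : (fun x : Space d => φ (x, t)) =ᶠ[nhds x]
          fun x => radialSol n ψ L N (‖x‖ ^ 2, t) := by
        filter_upwards [isOpen_ne.mem_nhds hx] with y hy
        simp [hφ, radialTest, hy, timeCut_eq_one hε (by linarith : -ε / 4 ≤ t)]
      rw [TestFun.box, (InnerProductSpace.laplacian_congr_nhds e2).eq_of_nhds,
        e1.iteratedDeriv_eq, laplacian_radial sG hx,
        ← iterate_pd_eq_iteratedDeriv isOpen_halfPlane sG _ _ 2 t (by simpa [halfPlane] using hpos)]
      have e3 : ((‖x‖ ^ 2, (0 : ℝ)) + t • ((0 : ℝ), (1 : ℝ)) : ℝ × ℝ) = (‖x‖ ^ 2, t) := by simp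
      have htN : T < t + N := by
        have := le_max_left T 0
        linarith
      rw [e3]
      have := wave_radialSol hψ hL hT n (p := (‖x‖ ^ 2, t)) hpos htN
      show pd (0, 1) (pd (0, 1) (radialSol n ψ L N)) (‖x‖ ^ 2, t) - _ = _
      have hd' : (d : ℝ) = 2 * n + 3 := by exact_mod_cast hd
      rw [this, hd']
      module
  · by_cases hx : x = 0
    · simp [hφ, radialTest, hx]
    · have := hK hψ hc hε hS hL hL0 hN t ‖x‖ ht (norm_pos_iff.2 hx)
      simpa [hφ, radialTest, hx, timeCut_eq_one hε (by linarith : -ε / 4 ≤ t)] using this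

end

/-! ### The Fourier transform of a radial function in odd dimensions -/

/-- Integration by parts `j + 1` times: the weight `(1 - s²)^j` kills all boundary terms but
the last. -/
lemma exists_oscillatory_bound_polynomial (j : ℕ) : ∀ P : Polynomial ℂ, ∃ C : ℝ, 0 ≤ C ∧
    ∀ μ : ℝ, 0 < μ → ‖∫ s in (-1 : ℝ)..1, (1 - (s : ℂ) ^ 2) ^ j * P.eval (s : ℂ) *
      Complex.exp (μ * s * Complex.I)‖ ≤ C * μ⁻¹ ^ (j + 1) := by
  have hpoly : ∀ (Q : Polynomial ℂ) (s : ℝ),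
      HasDerivAt (fun s : ℝ => Q.eval (s : ℂ)) (Q.derivative.eval (s : ℂ)) s := fun Q s =>
    (Q.hasDerivAt (s : ℂ)).comp_ofReal
  have hcont : ∀ Q : Polynomial ℂ, Continuous fun s : ℝ => Q.eval (s : ℂ) := fun Q =>
    continuous_iff_continuousAt.2 fun s => (hpoly Q s).continuousAt
  have hexp : ∀ μ : ℝ, 0 < μ → ∀ s : ℝ, HasDerivAt
      (fun s : ℝ => Complex.exp (μ * s * Complex.I) / (μ * Complex.I))
      (Complex.exp (μ * s * Complex.I)) s := by
    intro μ hμ s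
    have h1 : HasDerivAt (fun s : ℝ => (μ * s * Complex.I : ℂ)) (μ * Complex.I) s := by
      have := ((hasDerivAt_id s).ofReal_comp.const_mul (μ : ℂ)).mul_const Complex.I
      simpa using this
    have h2 := h1.cexp.div_const (μ * Complex.I)
    have hne : (μ : ℂ) * Complex.I ≠ 0 := by simp [hμ.ne']
    rwa [mul_div_cancel_right₀ _ hne] at h2
  have hnorm : ∀ μ s : ℝ, ‖Complex.exp (μ * s * Complex.I)‖ = 1 := fun μ s => by
    rw [← Complex.ofReal_mul, Complex.norm_exp_ofReal_mul_I]
  -- one integration by parts for an arbitrary polynomial amplitude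
  have key : ∀ (Q : Polynomial ℂ) (μ : ℝ), 0 < μ →
      ‖∫ s in (-1 : ℝ)..1, Q.eval (s : ℂ) * Complex.exp (μ * s * Complex.I)‖
        ≤ (‖Q.eval 1‖ + ‖Q.eval (-1)‖ + ‖∫ s in (-1 : ℝ)..1, Q.derivative.eval (s : ℂ) *
          Complex.exp (μ * s * Complex.I)‖) * μ⁻¹ := by
    intro Q μ hμ
    have hce : Continuous fun s : ℝ => Complex.exp (μ * s * Complex.I) := by fun_prop
    rw [intervalIntegral.integral_mul_deriv_eq_deriv_mul (fun s _ => hpoly Q s)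
      (fun s _ => hexp μ hμ s) ((hcont _).intervalIntegrable _ _) (hce.intervalIntegrable _ _)]
    simp only [← mul_div_assoc]
    rw [intervalIntegral.integral_div, ← sub_div, ← sub_div, norm_div]
    have hd : ‖(μ : ℂ) * Complex.I‖ = μ := by simp [abs_of_pos hμ]
    rw [hd, div_eq_mul_inv]
    refine mul_le_mul_of_nonneg_right ?_ (by positivity)
    refine (norm_sub_le _ _).trans (add_le_add_left ((norm_sub_le _ _).trans ?_) _)
    simp only [norm_mul, hnorm, mul_one]
    simp
  induction j with
  | zero =>
    intro P
    obtain ⟨B, hB⟩ := (isCompact_Icc (a := (-1 : ℝ)) (b := 1)).exists_bound_of_continuousOn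
      (hcont P.derivative).continuousOn
    have hB0 : 0 ≤ B := (norm_nonneg _).trans (hB 0 (by norm_num))
    refine ⟨‖P.eval 1‖ + ‖P.eval (-1)‖ + B * 2, by positivity, fun μ hμ => ?_⟩
    simp only [pow_zero, one_mul, zero_add, pow_one]
    refine (key P μ hμ).trans (mul_le_mul_of_nonneg_right (add_le_add_right ?_ _) (by positivity))
    refine (intervalIntegral.norm_integral_le_of_norm_le_const (C := B) fun s hs => ?_).trans
      (by norm_num)
    rw [norm_mul, hnorm, mul_one]
    rw [uIoc_of_le (by norm_num)] at hs
    exact hB s ⟨hs.1.le, hs.2⟩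
  | succ j ih =>
    intro P
    set R : Polynomial ℂ := 1 - Polynomial.X ^ 2 with hR
    set Q : Polynomial ℂ := -(2 * (j + 1 : ℂ)) • (Polynomial.X * P) + R * P.derivative with hQ
    obtain ⟨C, hC, h⟩ := ih Q
    refine ⟨C, hC, fun μ hμ => ?_⟩
    have h1 := key (R ^ (j + 1) * P) μ hμ
    have e1 : (R ^ (j + 1) * P).eval 1 = 0 := by simp [hR]
    have e2 : (R ^ (j + 1) * P).eval (-1) = 0 := by simp [hR]
    have e3 : (R ^ (j + 1) * P).derivative = R ^ j * Q := by
      rw [hQ, Polynomial.derivative_mul, Polynomial.derivative_pow, hR]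
      simp only [Polynomial.derivative_sub, Polynomial.derivative_one, Polynomial.derivative_X_pow,
        Nat.add_sub_cancel, Polynomial.smul_eq_C_mul]
      simp
      ring
    rw [e1, e2, e3] at h1
    simp only [Polynomial.eval_mul, Polynomial.eval_pow] at h1
    have e4 : ∀ s : ℂ, R.eval s = 1 - s ^ 2 := fun s => by simp [hR]
    simp only [e4, norm_zero, zero_add] at h1
    refine h1.trans ?_
    rw [pow_succ _ (j + 1), ← mul_assoc]
    exact mul_le_mul_of_nonneg_right (h μ hμ) (by positivity)

/-- Decay of order `n + 1` for `μ ≥ 1` by integration by parts; for `μ ≤ 1` the bound is trivial. -/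
lemma exists_oscillatory_bound (n : ℕ) : ∃ C : ℝ, 0 < C ∧ ∀ μ : ℝ, 0 < μ →
    ‖∫ s in (-1 : ℝ)..1, (1 - (s : ℂ) ^ 2) ^ n * Complex.exp (μ * s * Complex.I)‖
      ≤ C * (μ⁻¹ ^ (n + 1) * min 1 μ) := by
  obtain ⟨C, hC, h⟩ := exists_oscillatory_bound_polynomial n 1
  refine ⟨C + 2, by positivity, fun μ hμ => ?_⟩
  rcases le_total 1 μ with h1 | h1
  · have := h μ hμ
    simp only [Polynomial.eval_one, mul_one] at this
    rw [min_eq_left h1, mul_one]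
    refine this.trans (mul_le_mul_of_nonneg_right (by linarith) (by positivity))
  · rw [min_eq_right h1, pow_succ, mul_assoc, inv_mul_cancel₀ hμ.ne', mul_one]
    have h2 : (1 : ℝ) ≤ μ⁻¹ ^ n := one_le_pow₀ ((one_le_inv₀ hμ).2 h1)
    have h3 : ‖∫ s in (-1 : ℝ)..1, (1 - (s : ℂ) ^ 2) ^ n * Complex.exp (μ * s * Complex.I)‖
        ≤ 1 * |1 - (-1)| := by
      refine intervalIntegral.norm_integral_le_of_norm_le_const fun s hs => ?_
      rw [uIoc_of_le (by norm_num)] at hs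
      rw [norm_mul, ← Complex.ofReal_mul, Complex.norm_exp_ofReal_mul_I, mul_one, norm_pow]
      refine pow_le_one₀ (norm_nonneg _) ?_
      rw [← Complex.ofReal_pow, ← Complex.ofReal_one, ← Complex.ofReal_sub, Complex.norm_real,
        Real.norm_eq_abs, abs_le]
      constructor <;> nlinarith [hs.1, hs.2]
    have h4 : (1 : ℝ) * |1 - (-1)| = 2 := by norm_num
    rw [h4] at h3
    nlinarith

/-- Euclidean space as a product of the first coordinate and the remaining ones. -/
def splitFirst (k : ℕ) : Space (k + 1) ≃ᵐ ℝ × Space k :=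
  ((MeasurableEquiv.toLp 2 (Fin (k + 1) → ℝ)).symm.trans
    (MeasurableEquiv.piFinSuccAbove (fun _ => ℝ) 0)).trans
    ((MeasurableEquiv.refl ℝ).prodCongr (MeasurableEquiv.toLp 2 (Fin k → ℝ)))

lemma splitFirst_apply (k : ℕ) (x : Space (k + 1)) :
    splitFirst k x = (x 0, WithLp.toLp 2 fun i : Fin k => x i.succ) := rfl

lemma measurePreserving_splitFirst (k : ℕ) : MeasurePreserving (splitFirst k) := by
  have h1 : MeasurePreserving (MeasurableEquiv.toLp 2 (Fin (k + 1) → ℝ)).symm volume volume :=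
    MeasurePreserving.symm (MeasurableEquiv.toLp 2 (Fin (k + 1) → ℝ))
      (PiLp.volume_preserving_toLp (Fin (k + 1)))
  have h2 := volume_preserving_piFinSuccAbove (fun _ : Fin (k + 1) => ℝ) 0
  have h3 := (MeasurePreserving.id (volume : Measure ℝ)).prod (PiLp.volume_preserving_toLp (Fin k))
  exact h3.comp (h2.comp h1)

lemma norm_sq_splitFirst (k : ℕ) (x : Space (k + 1)) :
    ‖x‖ ^ 2 = (splitFirst k x).1 ^ 2 + ‖(splitFirst k x).2‖ ^ 2 := by
  rw [splitFirst_apply, EuclideanSpace.norm_sq_eq, EuclideanSpace.norm_sq_eq, Fin.sum_univ_succ]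
  simp

/-- Polar coordinates in even dimension, with the squared radius as variable. -/
lemma integral_radial_even (n : ℕ) : ∃ c : ℝ, 0 ≤ c ∧ ∀ (f : ℝ → ℂ) (a : ℝ),
    ∫ y : Space (2 * n + 2), f (a + ‖y‖ ^ 2)
      = c • ∫ v : ℝ, (Ioi a).indicator (fun v => ((v : ℂ) - a) ^ n * f v) v := by
  refine ⟨(2 * n + 2 : ℕ) * (volume.real (Metric.ball (0 : Space (2 * n + 2)) 1)) / 2,
    by positivity, fun f a => ?_⟩
  rw [integral_fun_norm_addHaar volume (fun r => f (a + r ^ 2))]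
  simp only [finrank_euclideanSpace, Fintype.card_fin]
  have h1 := integral_comp_rpow_Ioi_of_pos (g := fun w : ℝ => ((w : ℂ)) ^ n * f (a + w))
    (p := 2) (by norm_num)
  have h2 : ∫ y in Ioi (0 : ℝ), y ^ (2 * n + 2 - 1) • f (a + y ^ 2)
      = (1 / 2 : ℝ) • ∫ w in Ioi (0 : ℝ), ((w : ℂ)) ^ n * f (a + w) := by
    rw [← h1, ← integral_smul]
    refine setIntegral_congr_fun measurableSet_Ioi fun y (hy : 0 < y) => ?_
    have e1 : (2 : ℝ) - 1 = 1 := by norm_num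
    have e2 : 2 * n + 2 - 1 = 2 * n + 1 := by omega
    simp only [e1, e2, Real.rpow_one, Real.rpow_two, Complex.real_smul]
    push_cast
    ring
  have h3 : ∫ w in Ioi (0 : ℝ), ((w : ℂ)) ^ n * f (a + w)
      = ∫ v : ℝ, (Ioi a).indicator (fun v => ((v : ℂ) - a) ^ n * f v) v := by
    rw [← integral_indicator measurableSet_Ioi, 
      ← integral_add_left_eq_self (fun v : ℝ => (Ioi a).indicator
        (fun v : ℝ => ((v : ℂ) - a) ^ n * f v) v) a]
    refine integral_congr_ae (Filter.Eventually.of_forall fun w => ?_)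
    by_cases hw : 0 < w
    · simp [indicator, hw]
    · simp [indicator, hw]
  rw [h2, h3, ← Nat.cast_smul_eq_nsmul ℝ, smul_smul, smul_smul]
  congr 1
  ring

/-- The Fourier transform of a radial function, as a superposition of one-dimensional Fourier
transforms of powers of `v - y²`. -/
lemma integral_radial_mul_exp (n : ℕ) : ∃ c : ℝ, 0 ≤ c ∧ ∀ f : ℝ → ℂ, Continuous f →
    HasCompactSupport f → ∀ μ : ℝ,
    ∫ x : Space (2 * n + 3), Complex.exp (μ * (x 0 : ℝ) * Complex.I) * f (‖x‖ ^ 2)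
      = c • ∫ v in Ioi (0 : ℝ), f v * ∫ y in (-√v)..√v, ((v : ℂ) - (y : ℂ) ^ 2) ^ n *
        Complex.exp (μ * y * Complex.I) := by
  obtain ⟨c, hc, h⟩ := integral_radial_even n
  refine ⟨c, hc, fun f hf hfc μ => ?_⟩
  obtain ⟨B, hB⟩ : ∃ B : ℝ, ∀ v, B < v → f v = 0 := by
    obtain ⟨B, hB⟩ := hfc.isCompact.bddAbove
    exact ⟨B, fun v hv => image_eq_zero_of_notMem_tsupport fun h => absurd (hB h) (not_le.2 hv)⟩
  have e1 : ∫ x : Space (2 * n + 3), Complex.exp (μ * (x 0 : ℝ) * Complex.I) * f (‖x‖ ^ 2)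
      = ∫ z : ℝ × Space (2 * n + 2),
        Complex.exp (μ * z.1 * Complex.I) * f (z.1 ^ 2 + ‖z.2‖ ^ 2) := by
    rw [← (measurePreserving_splitFirst (2 * n + 2)).integral_comp']
    refine integral_congr_ae (Filter.Eventually.of_forall fun x => ?_)
    simp only [← norm_sq_splitFirst]
    rfl
  have hi : Integrable fun z : ℝ × Space (2 * n + 2) =>
      Complex.exp (μ * z.1 * Complex.I) * f (z.1 ^ 2 + ‖z.2‖ ^ 2) := by
    refine Continuous.integrable_of_hasCompactSupport (by fun_prop) ?_
    refine HasCompactSupport.intro ((isCompact_closedBall (0 : ℝ) √B).prod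
      (isCompact_closedBall (0 : Space (2 * n + 2)) √B)) fun z hz => ?_
    rw [hB _ ?_, mul_zero]
    by_contra hle
    rw [not_lt] at hle
    refine hz ⟨?_, ?_⟩
    · rw [mem_closedBall_zero_iff]
      exact Real.le_sqrt_of_sq_le (by rw [Real.norm_eq_abs, sq_abs]; nlinarith [sq_nonneg ‖z.2‖])
    · rw [mem_closedBall_zero_iff]
      exact Real.le_sqrt_of_sq_le (by nlinarith [sq_nonneg z.1])
  rw [e1, Measure.volume_eq_prod, integral_prod _ hi]
  simp only [integral_const_mul, h]
  set S : Set (ℝ × ℝ) := {z | z.1 ^ 2 < z.2} with hS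
  have hSm : MeasurableSet S := measurableSet_lt (by fun_prop) (by fun_prop)
  set G : ℝ × ℝ → ℂ := fun z =>
    Complex.exp (μ * z.1 * Complex.I) * (((z.2 : ℂ) - (z.1 : ℂ) ^ 2) ^ n * f z.2) with hG
  have hGc : Continuous G := by
    rw [hG]; fun_prop
  have hGi : Integrable (S.indicator G) (volume.prod volume) := by
    set T : Set (ℝ × ℝ) := Icc (-√B) √B ×ˢ Icc 0 B with hT
    have hTc : IsCompact T := isCompact_Icc.prod isCompact_Icc
    have e : S.indicator G = T.indicator (S.indicator G) := by
      ext z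
      by_cases hz : z ∈ T
      · rw [indicator_of_mem hz]
      rw [indicator_of_notMem hz]
      by_cases hzS : z ∈ S
      · rw [indicator_of_mem hzS]
        have : f z.2 = 0 := by
          refine hB _ ?_
          by_contra hle
          rw [not_lt] at hle
          have hzS' : z.1 ^ 2 < z.2 := hzS
          refine hz ⟨abs_le.1 (Real.abs_le_sqrt (by linarith)), (sq_nonneg _).trans hzS'.le, hle⟩
        simp [hG, this]
      · rw [indicator_of_notMem hzS]
    rw [e, integrable_indicator_iff hTc.measurableSet]
    exact (hGc.continuousOn.integrableOn_compact hTc).indicator hSm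
  have e2 : ∀ y : ℝ, Complex.exp (μ * y * Complex.I) *
      (c • ∫ v : ℝ, (Ioi (y ^ 2)).indicator (fun v => ((v : ℂ) - (y ^ 2 : ℝ)) ^ n * f v) v)
      = c • ∫ v : ℝ, S.indicator G (y, v) := by
    intro y
    rw [mul_smul_comm, ← integral_const_mul]
    congr 2 with v
    by_cases hv : y ^ 2 < v
    · simp [indicator, hv, hS, hG]
    · simp [indicator, hv, hS]
  simp only [e2]
  rw [integral_smul, integral_integral_swap (f := fun y v => S.indicator G (y, v)) hGi,
    ← integral_indicator measurableSet_Ioi]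
  have hmem : ∀ v y : ℝ, y ∈ Ioo (-√v) √v ↔ y ^ 2 < v := fun v y =>
    abs_lt.symm.trans (by rw [Real.lt_sqrt (abs_nonneg y), sq_abs])
  congr 2 with v
  by_cases hv : 0 < v
  · rw [indicator_of_mem (show v ∈ Ioi 0 from hv), ← intervalIntegral.integral_const_mul,
      intervalIntegral.integral_of_le (by linarith [Real.sqrt_nonneg v]),
      integral_Ioc_eq_integral_Ioo, ← integral_indicator measurableSet_Ioo]
    congr 1 with y
    by_cases hy : y ^ 2 < v
    · rw [indicator_of_mem ((hmem v y).2 hy), indicator_of_mem (show (y, v) ∈ S from hy), hG]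
      ring
    · rw [indicator_of_notMem (mt (hmem v y).1 hy), indicator_of_notMem (show (y, v) ∉ S from hy)]
  · rw [indicator_of_notMem (show v ∉ Ioi 0 from hv)]
    have : ∀ y, S.indicator G (y, v) = 0 := fun y =>
      indicator_of_notMem (s := S) (fun h' => hv ((sq_nonneg y).trans_lt h')) _
    simp [this]

/-- Pointwise decay of the Fourier transform of a radial function. -/
lemma exists_radial_fourier_bound (n : ℕ) : ∃ C : ℝ, 0 < C ∧ ∀ d, d = 2 * n + 3 →
    ∀ f : ℝ → ℂ, Continuous f → HasCompactSupport f → ∀ ξ : Space d, ξ ≠ 0 →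
    ‖𝓕 (fun x : Space d => f (‖x‖ ^ 2)) ξ‖ₑ
      ≤ ENNReal.ofReal C * ∫⁻ v, ENNReal.ofReal (√v ^ n) * ‖f v‖ₑ *
        ENNReal.ofReal (‖ξ‖⁻¹ ^ (n + 1) * min 1 (√v * ‖ξ‖)) := by
  obtain ⟨c, hc, hrad⟩ := integral_radial_mul_exp n
  obtain ⟨C, hC, hosc⟩ := exists_oscillatory_bound n
  refine ⟨(c * C + 1) * (2 * Real.pi), by positivity, ?_⟩
  rintro d rfl f hf hfc ξ hξ
  have hξ0 : 0 < ‖ξ‖ := norm_pos_iff.2 hξ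
  set e : Space (2 * n + 3) := EuclideanSpace.single 0 (-‖ξ‖) with he
  set A := (Submodule.span ℝ {e - ξ})ᗮ.reflection with hA
  have hAe : A e = ξ := Submodule.reflection_sub (by simp [he])
  set μ : ℝ := 2 * Real.pi * ‖ξ‖ with hμ
  have hμ0 : 0 < μ := by positivity
  have e1 : 𝓕 (fun x : Space (2 * n + 3) => f (‖x‖ ^ 2)) ξ
      = ∫ x : Space (2 * n + 3), Complex.exp (μ * (x 0 : ℝ) * Complex.I) * f (‖x‖ ^ 2) := by
    rw [Real.fourier_eq', ← A.measurePreserving.integral_comp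
      A.toHomeomorph.measurableEmbedding]
    refine integral_congr_ae (Filter.Eventually.of_forall fun x => ?_)
    have h1 : inner ℝ (A x) ξ = -(x 0 * ‖ξ‖) := by
      rw [← hAe, A.inner_map_map, he, EuclideanSpace.inner_single_right]
      simp [mul_comm]
    simp only [smul_eq_mul, A.norm_map, h1]
    congr 2
    push_cast [hμ]
    ring
  have hinner : ∀ v : ℝ, 0 < v → ‖∫ y in (-√v)..√v, ((v : ℂ) - (y : ℂ) ^ 2) ^ n *
        Complex.exp (μ * y * Complex.I)‖
      ≤ C * (2 * Real.pi) * (√v ^ n * (‖ξ‖⁻¹ ^ (n + 1) * min 1 (√v * ‖ξ‖))) := by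
    intro v hv
    have hr : 0 < √v := Real.sqrt_pos.2 hv
    have h1 := intervalIntegral.smul_integral_comp_mul_right (a := -1) (b := 1)
      (fun y : ℝ => ((v : ℂ) - (y : ℂ) ^ 2) ^ n * Complex.exp (μ * y * Complex.I)) √v
    rw [neg_one_mul, one_mul] at h1
    have h2 : ∀ s : ℝ, ((v : ℂ) - ((s * √v : ℝ) : ℂ) ^ 2) ^ n *
        Complex.exp (μ * (s * √v : ℝ) * Complex.I)
        = ((v : ℂ) ^ n) * ((1 - (s : ℂ) ^ 2) ^ n *
          Complex.exp ((μ * √v : ℝ) * s * Complex.I)) := by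
      intro s
      have h3 : ((√v : ℝ) : ℂ) ^ 2 = v := by
        rw [← Complex.ofReal_pow, Real.sq_sqrt hv.le]
      have h4 : (v : ℂ) - ((s * √v : ℝ) : ℂ) ^ 2 = v * (1 - (s : ℂ) ^ 2) := by
        push_cast
        rw [mul_pow, h3]
        ring
      rw [h4, mul_pow, mul_assoc]
      congr 3
      push_cast
      ring
    rw [← h1]
    simp only [h2]
    rw [intervalIntegral.integral_const_mul, norm_smul, norm_mul, norm_pow, Complex.norm_real,
      Real.norm_of_nonneg hr.le, Real.norm_of_nonneg hv.le]
    have h5 := hosc (μ * √v) (by positivity)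
    have h6 : √v * (v ^ n * (C * ((μ * √v)⁻¹ ^ (n + 1) * min 1 (μ * √v))))
        = C * (√v ^ n * (μ⁻¹ ^ (n + 1) * min 1 (μ * √v))) := by
      have h3 : v ^ n = √v ^ n * √v ^ n := by rw [← mul_pow, Real.mul_self_sqrt hv.le]
      rw [h3, inv_pow, inv_pow, mul_pow, pow_succ √v]
      field_simp
    calc √v * (v ^ n * ‖∫ s in (-1 : ℝ)..1, (1 - (s : ℂ) ^ 2) ^ n *
          Complex.exp ((μ * √v : ℝ) * s * Complex.I)‖)
        ≤ √v * (v ^ n * (C * ((μ * √v)⁻¹ ^ (n + 1) * min 1 (μ * √v)))) := by gcongr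
      _ = C * (√v ^ n * (μ⁻¹ ^ (n + 1) * min 1 (μ * √v))) := h6
      _ ≤ C * (√v ^ n * (‖ξ‖⁻¹ ^ (n + 1) * (2 * Real.pi * min 1 (√v * ‖ξ‖)))) := by
        have hpi : (1 : ℝ) ≤ 2 * Real.pi := by linarith [Real.pi_gt_three]
        have hm : min 1 (μ * √v) ≤ 2 * Real.pi * min 1 (√v * ‖ξ‖) := by
          rcases le_total 1 (√v * ‖ξ‖) with h | h
          · rw [min_eq_left h]; exact (min_le_left _ _).trans (by linarith)
          · rw [min_eq_right h]; exact (min_le_right _ _).trans (le_of_eq (by rw [hμ]; ring))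
        have hle : ‖ξ‖ ≤ μ := by rw [hμ]; nlinarith
        gcongr
      _ = _ := by ring
  rw [e1, hrad f hf hfc μ, enorm_smul]
  have hce : ‖c‖ₑ = ENNReal.ofReal c := Real.enorm_of_nonneg hc
  calc ‖c‖ₑ * ‖∫ v in Ioi (0 : ℝ), f v * ∫ y in (-√v)..√v, ((v : ℂ) - (y : ℂ) ^ 2) ^ n *
        Complex.exp (μ * y * Complex.I)‖ₑ
      ≤ ENNReal.ofReal c * ∫⁻ v in Ioi (0 : ℝ), ENNReal.ofReal (C * (2 * Real.pi)) *
          (ENNReal.ofReal (√v ^ n) * ‖f v‖ₑ *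
            ENNReal.ofReal (‖ξ‖⁻¹ ^ (n + 1) * min 1 (√v * ‖ξ‖))) := by
        rw [hce]
        gcongr
        refine (enorm_integral_le_lintegral_enorm _).trans
          (setLIntegral_mono' measurableSet_Ioi fun v hv => ?_)
        have h1 : ‖∫ y in (-√v)..√v, ((v : ℂ) - (y : ℂ) ^ 2) ^ n *
            Complex.exp (μ * y * Complex.I)‖ₑ
            ≤ ENNReal.ofReal (C * (2 * Real.pi)) * (ENNReal.ofReal (√v ^ n) *
              ENNReal.ofReal (‖ξ‖⁻¹ ^ (n + 1) * min 1 (√v * ‖ξ‖))) := by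
          rw [← ENNReal.ofReal_mul (by positivity), ← ENNReal.ofReal_mul (by positivity),
            ← ofReal_norm]
          exact ENNReal.ofReal_le_ofReal (hinner v hv)
        rw [enorm_mul]
        calc _ ≤ ‖f v‖ₑ * _ := mul_le_mul_right h1 _
          _ = _ := by ring
    _ ≤ ENNReal.ofReal c * (ENNReal.ofReal (C * (2 * Real.pi)) * ∫⁻ v,
          ENNReal.ofReal (√v ^ n) * ‖f v‖ₑ *
            ENNReal.ofReal (‖ξ‖⁻¹ ^ (n + 1) * min 1 (√v * ‖ξ‖))) := by
        rw [lintegral_const_mul' _ _ ENNReal.ofReal_ne_top]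
        gcongr
        exact Measure.restrict_le_self
    _ ≤ _ := by
        rw [← mul_assoc, ← ENNReal.ofReal_mul hc]
        refine mul_le_mul_left (ENNReal.ofReal_le_ofReal ?_) _
        nlinarith [Real.pi_pos]

section

/-! ### The contribution of the initial data -/

variable {d : ℕ}

lemma isClosedEmbedding_slice (t : ℝ) :
    Topology.IsClosedEmbedding (fun x : Space d => (x, t)) :=
  Topology.IsClosedEmbedding.of_continuous_injective_isClosedMap (by fun_prop)
    (fun _ _ h => (Prod.ext_iff.1 h).1)
    (fun s hs => by
      have : (fun x : Space d => (x, t)) '' s = s ×ˢ {t} := by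
        ext ⟨a, b⟩; simp [eq_comm]
      rw [this]; exact hs.prod isClosed_singleton)

/-- The function `x ↦ f(x, t)` as a Schwartz function. -/
def slice {f : Space d × ℝ → ℂ} (hf : ContDiff ℝ ∞ f) (hc : HasCompactSupport f) (t : ℝ) :
    𝓢(Space d, ℂ) :=
  (hc.comp_isClosedEmbedding (isClosedEmbedding_slice t)).toSchwartzMap
    (hf.comp (contDiff_id.prodMk contDiff_const))

/-- The time derivative of the spatial Fourier transform. -/
lemma hasDerivAt_fourier_slice {f : Space d × ℝ → ℂ} (hf : ContDiff ℝ ∞ f)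
    (hc : HasCompactSupport f) (ξ : Space d) (t : ℝ) :
    HasDerivAt (fun t => 𝓕 (fun x => f (x, t)) ξ) (𝓕 (fun x => pd (0, 1) f (x, t)) ξ) t := by
  have hpd : Continuous (pd (0, 1) f) := (contDiff_pd hf _).continuous
  have hpc : HasCompactSupport (pd (0, 1) f) := hc.fderiv_apply ℝ (0, 1)
  obtain ⟨B, hB⟩ := hpc.exists_bound_of_continuous hpd
  set K : Set (Space d) := Prod.fst '' tsupport (pd (0, 1) f) with hK
  have hKc : IsCompact K := hpc.isCompact.image continuous_fst
  have hsl : ∀ s, Continuous fun x : Space d => f (x, s) := fun s =>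
    hf.continuous.comp (by fun_prop)
  have hexp : Continuous fun x : Space d =>
      Complex.exp (↑(-2 * Real.pi * inner ℝ x ξ) * Complex.I) := by fun_prop
  simp only [Real.fourier_eq']
  refine (hasDerivAt_integral_of_dominated_loc_of_deriv_le (s := univ)
    (F := fun s x => Complex.exp (↑(-2 * Real.pi * inner ℝ x ξ) * Complex.I) • f (x, s))
    (F' := fun s x => Complex.exp (↑(-2 * Real.pi * inner ℝ x ξ) * Complex.I) • pd (0, 1) f (x, s))
    (bound := K.indicator fun _ => B) Filter.univ_mem ?_ ?_ ?_ ?_ ?_ ?_).2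
  · exact Filter.Eventually.of_forall fun s => (hexp.smul (hsl s)).aestronglyMeasurable
  · refine (hexp.smul (hsl t)).integrable_of_hasCompactSupport ?_
    exact (hc.comp_isClosedEmbedding (isClosedEmbedding_slice t)).smul_left
  · exact (hexp.smul (hpd.comp (by fun_prop))).aestronglyMeasurable
  · refine Filter.Eventually.of_forall fun x s _ => ?_
    rw [norm_smul, Complex.norm_exp_ofReal_mul_I, one_mul]
    by_cases hx : x ∈ K
    · rw [indicator_of_mem hx]
      exact hB _
    · rw [indicator_of_notMem hx, image_eq_zero_of_notMem_tsupport (f := pd (0, 1) f) (x := (x, s))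
        fun h => hx ⟨_, h, rfl⟩, norm_zero]
  · exact (integrable_indicator_iff hKc.measurableSet).2
      (integrableOn_const hKc.measure_lt_top.ne)
  · refine Filter.Eventually.of_forall fun x s _ => ?_
    have h1 : HasDerivAt (fun s : ℝ => (x, s)) ((0 : Space d), (1 : ℝ)) s :=
      (hasDerivAt_const s x).prodMk (hasDerivAt_id s)
    have h2 : HasDerivAt (fun s => f (x, s)) (pd (0, 1) f (x, s)) s :=
      ((hf.differentiable (by simp)) (x, s)).hasFDerivAt.comp_hasDerivAt s h1
    exact h2.const_smul (Complex.exp (↑(-2 * Real.pi * inner ℝ x ξ) * Complex.I))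

lemma fourier_laplacian (f : 𝓢(Space d, ℂ)) (ξ : Space d) :
    𝓕 (Δ (f : Space d → ℂ)) ξ = -((2 * Real.pi * ‖ξ‖) ^ 2 : ℝ) * 𝓕 (f : Space d → ℂ) ξ := by
  have h1 : (Δ (f : Space d → ℂ)) = ((Δ f : 𝓢(Space d, ℂ)) : Space d → ℂ) := by
    ext x; exact (SchwartzMap.laplacian_apply f x).symm
  rw [h1, ← SchwartzMap.fourier_coe, SchwartzMap.laplacian_eq_fourierMultiplierCLM,
    SchwartzMap.fourierMultiplierCLM_apply]
  rw [FourierTransform.fourier_smul, FourierTransform.fourier_fourierInv_eq,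
    ← SchwartzMap.fourier_coe]
  rw [_root_.smul_apply, SchwartzMap.smulLeftCLM_apply_apply (by fun_prop)]
  simp
  ring

lemma box_eq (φ : TestFun d) (x : Space d) (t : ℝ) :
    TestFun.box φ (x, t) = pd (0, 1) (pd (0, 1) φ) (x, t) - (Δ (fun x => φ (x, t))) x := by
  rw [TestFun.box]
  congr 1
  have hφ : ContDiffOn ℝ ∞ φ univ := by exact_mod_cast φ.contDiff.contDiffOn
  have := iterate_pd_eq_iteratedDeriv isOpen_univ hφ (x, 0) (0, 1) 2 t (mem_univ _)
  simpa using this.symm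

/-- A forced oscillator that comes to rest is controlled by the total force. -/
lemma oscillator_bound {a a1 a2 P : ℝ → ℂ} {k T : ℝ} (hk : 0 < k)
    (h1 : ∀ t, HasDerivAt a (a1 t) t) (h2 : ∀ t, HasDerivAt a1 (a2 t) t) (hc : Continuous a2)
    (hT : 0 ≤ T) (haT : a T = 0) (ha1T : a1 T = 0)
    (hP : ∀ t, 0 < t → a2 t + (k ^ 2 : ℝ) * a t = P t) :
    ‖a 0‖ₑ ≤ ENNReal.ofReal k⁻¹ * ∫⁻ t in Ioi (0 : ℝ), ‖P t‖ₑ ∧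
      ‖a1 0‖ₑ ≤ ∫⁻ t in Ioi (0 : ℝ), ‖P t‖ₑ := by
  have hca : Continuous a := continuous_iff_continuousAt.2 fun t => (h1 t).continuousAt
  -- the Wronskian of `a` with a solution `s` of the free equation has derivative `P s`
  have key : ∀ s s1 : ℝ → ℝ, (∀ t, HasDerivAt s (s1 t) t) →
      (∀ t, HasDerivAt s1 (-(k ^ 2) * s t) t) → (∀ t, |s t| ≤ 1) →
      ‖a1 0 * (s 0 : ℂ) - a 0 * (s1 0 : ℂ)‖ₑ ≤ ∫⁻ t in Ioi (0 : ℝ), ‖P t‖ₑ := by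
    intro s s1 hs hs1 hb
    have hcs : Continuous s := continuous_iff_continuousAt.2 fun t => (hs t).continuousAt
    have hW : ∀ t, HasDerivAt (fun t => a1 t * (s t : ℂ) - a t * (s1 t : ℂ))
        ((a2 t + (k ^ 2 : ℝ) * a t) * (s t : ℂ)) t := by
      intro t
      have := ((h2 t).mul (hs t).ofReal_comp).sub ((h1 t).mul (hs1 t).ofReal_comp)
      refine this.congr_deriv ?_
      push_cast
      ring
    have hint := intervalIntegral.integral_eq_sub_of_hasDerivAt (a := 0) (b := T)
      (fun t _ => hW t) (Continuous.intervalIntegrable (by fun_prop) _ _)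
    rw [haT, ha1T] at hint
    have h3 : ‖a1 0 * (s 0 : ℂ) - a 0 * (s1 0 : ℂ)‖ₑ
        = ‖∫ t in (0 : ℝ)..T, (a2 t + (k ^ 2 : ℝ) * a t) * (s t : ℂ)‖ₑ := by
      rw [hint, zero_mul, zero_mul, sub_zero, zero_sub, enorm_neg]
    rw [h3, intervalIntegral.integral_of_le hT]
    refine (enorm_integral_le_lintegral_enorm _).trans ?_
    refine (setLIntegral_mono' (g := fun t => ‖P t‖ₑ) measurableSet_Ioc fun t ht => ?_).trans
      (lintegral_mono_set Ioc_subset_Ioi_self)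
    rw [hP t ht.1, enorm_mul]
    refine mul_le_of_le_one_right' ?_
    rw [← ofReal_norm, Complex.norm_real, Real.norm_eq_abs]
    exact ENNReal.ofReal_le_one.2 (hb t)
  have hlin : ∀ t, HasDerivAt (fun t => k * t) k t := fun t => by
    simpa using (hasDerivAt_id t).const_mul k
  constructor
  · have h := key (fun t => Real.sin (k * t)) (fun t => k * Real.cos (k * t))
      (fun t => ((hlin t).sin).congr_deriv (by ring))
      (fun t => ((hlin t).cos.const_mul k).congr_deriv (by ring)) (fun t => Real.abs_sin_le_one _)
    simp only [mul_zero, Real.sin_zero, Real.cos_zero, Complex.ofReal_zero, zero_sub, mul_one,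
      enorm_neg, enorm_mul] at h
    have hk' : ‖(k : ℂ)‖ₑ = ENNReal.ofReal k := by
      rw [← ofReal_norm, Complex.norm_real, Real.norm_of_nonneg hk.le]
    calc ‖a 0‖ₑ = ENNReal.ofReal k⁻¹ * (‖a 0‖ₑ * ENNReal.ofReal k) := by
          rw [mul_comm ‖a 0‖ₑ, ← mul_assoc, ← ENNReal.ofReal_mul (by positivity),
            inv_mul_cancel₀ hk.ne', ENNReal.ofReal_one, one_mul]
      _ ≤ _ := by rw [← hk']; gcongr
  · have h := key (fun t => Real.cos (k * t)) (fun t => -(k * Real.sin (k * t)))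
      (fun t => ((hlin t).cos).congr_deriv (by ring))
      (fun t => ((hlin t).sin.const_mul k).neg.congr_deriv (by ring))
      (fun t => Real.abs_cos_le_one _)
    simpa using h

/-- The spatial Fourier transform of a solution of the wave equation that vanishes for large
times. -/
lemma fourier_slice_bound (φ : TestFun d) {ψ : ℝ × ℝ → ℂ}
    (hbox : ∀ (x : Space d) (t : ℝ), 0 < t → TestFun.box φ (x, t) = ψ (‖x‖ ^ 2, t))
    {ξ : Space d} (hξ : ξ ≠ 0) :
    ‖𝓕 (fun x => φ (x, 0)) ξ‖ₑ ≤ ENNReal.ofReal (2 * Real.pi * ‖ξ‖)⁻¹ *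
        ∫⁻ t in Ioi (0 : ℝ), ‖𝓕 (fun x : Space d => ψ (‖x‖ ^ 2, t)) ξ‖ₑ ∧
      ‖𝓕 (fun x => TestFun.dt φ (x, 0)) ξ‖ₑ ≤
        ∫⁻ t in Ioi (0 : ℝ), ‖𝓕 (fun x : Space d => ψ (‖x‖ ^ 2, t)) ξ‖ₑ := by
  have hφ : ContDiff ℝ ∞ φ := by exact_mod_cast φ.contDiff
  have hc : HasCompactSupport φ := φ.hasCompactSupport
  have hφ1 := contDiff_pd hφ (0, 1)
  have hφ2 := contDiff_pd hφ1 (0, 1)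
  have hφ3 := contDiff_pd hφ2 (0, 1)
  have hc1 : HasCompactSupport (pd (0, 1) φ) := hc.fderiv_apply ℝ (0, 1)
  have hc2 : HasCompactSupport (pd (0, 1) (pd (0, 1) φ)) := hc1.fderiv_apply ℝ (0, 1)
  obtain ⟨T, hT⟩ : ∃ T : ℝ, ∀ (x : Space d) t, T < t → (x, t) ∉ tsupport φ := by
    obtain ⟨T, hT⟩ := (hc.isCompact.image continuous_snd).bddAbove
    exact ⟨T, fun x t ht h => absurd (hT ⟨_, h, rfl⟩) (not_le.2 ht)⟩
  have hz0 : ∀ x : Space d, φ (x, max T 0 + 1) = 0 := fun x =>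
    image_eq_zero_of_notMem_tsupport (hT x _ (by linarith [le_max_left T 0]))
  have hz1 : ∀ x : Space d, pd (0, 1) φ (x, max T 0 + 1) = 0 := fun x =>
    image_eq_zero_of_notMem_tsupport fun h =>
      hT x _ (by linarith [le_max_left T 0]) (tsupport_fderiv_apply_subset ℝ (0, 1) h)
  refine oscillator_bound (a := fun t => 𝓕 (fun x => φ (x, t)) ξ)
    (a1 := fun t => 𝓕 (fun x => pd (0, 1) φ (x, t)) ξ)
    (a2 := fun t => 𝓕 (fun x => pd (0, 1) (pd (0, 1) φ) (x, t)) ξ) (T := max T 0 + 1)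
    (by positivity)
    (fun t => hasDerivAt_fourier_slice hφ hc ξ t) (fun t => hasDerivAt_fourier_slice hφ1 hc1 ξ t)
    (continuous_iff_continuousAt.2 fun t => (hasDerivAt_fourier_slice hφ2 hc2 ξ t).continuousAt)
    (by positivity) ?_ ?_ ?_
  · simp [hz0, Real.fourier_eq']
  · simp [hz1, Real.fourier_eq']
  · intro t ht
    have e1 : (fun x : Space d => ψ (‖x‖ ^ 2, t))
        = ((slice hφ2 hc2 t - Δ (slice hφ hc t) : 𝓢(Space d, ℂ)) : Space d → ℂ) := by
      ext x
      rw [← hbox x t ht, box_eq, _root_.sub_apply, SchwartzMap.laplacian_apply]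
      rfl
    have e2 : 𝓕 ((Δ (slice hφ hc t) : 𝓢(Space d, ℂ)) : Space d → ℂ) ξ
        = -((2 * Real.pi * ‖ξ‖) ^ 2 : ℝ) * 𝓕 (fun x => φ (x, t)) ξ := by
      rw [show ((Δ (slice hφ hc t) : 𝓢(Space d, ℂ)) : Space d → ℂ)
        = Δ (slice hφ hc t : Space d → ℂ) from by
          ext x; exact SchwartzMap.laplacian_apply _ x, fourier_laplacian]
      rfl
    rw [e1, ← SchwartzMap.fourier_coe, sub_eq_add_neg, FourierTransform.fourier_add,
      FourierTransform.fourier_neg, _root_.add_apply, _root_.neg_apply,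
      SchwartzMap.fourier_coe, SchwartzMap.fourier_coe, e2]
    rw [neg_mul, neg_neg]
    rfl

lemma HasFourierDensity.apply_eq {f : 𝓢'(Space d, ℂ)} {g : Space d → ℂ}
    (h : HasFourierDensity f g) (φ : 𝓢(Space d, ℂ)) :
    f φ = ∫ ξ, 𝓕 (φ : Space d → ℂ) (-ξ) * g ξ := by
  have := (h.2 (𝓕⁻ φ)).2
  rw [TemperedDistribution.fourier_apply, FourierTransform.fourier_fourierInv_eq] at this
  rw [this]
  refine integral_congr_ae (Filter.Eventually.of_forall fun ξ => ?_)
  simp only [SchwartzMap.fourierInv_coe, Real.fourierInv_eq_fourier_neg]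

/-- The amplitude at radius `R` of the free wave with Fourier data `g₀`, `g₁`. The spherical mean of
a plane wave of frequency `ξ` is at most of size `min 1 ((R |ξ|)^(-(n+1)))` at radius `R`, where
`n + 1 = (d - 1) / 2`; after multiplication by `R^(n+1)` this is at most
`|ξ|^(-(n+1)) min 1 (R |ξ|)`, which is monotone in `R`. -/
def dataWeight (n : ℕ) (g₀ g₁ : Space d → ℂ) (R : ℝ) : ℝ≥0∞ :=
  ∫⁻ ξ, (ENNReal.ofReal ‖ξ‖⁻¹ * ‖g₁ ξ‖ₑ + ‖g₀ ξ‖ₑ) *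
    ENNReal.ofReal (‖ξ‖⁻¹ ^ (n + 1) * min 1 (R * ‖ξ‖))

lemma dataWeight_mono (n : ℕ) (g₀ g₁ : Space d → ℂ) : Monotone (dataWeight n g₀ g₁) := by
  intro R R' h
  refine lintegral_mono fun ξ => ?_
  gcongr

/-- The pairing of the initial data with a test function solving the wave equation with radial
source `ψ`. -/
theorem exists_data_bound (n : ℕ) : ∃ C : ℝ, 0 < C ∧ ∀ d, d = 2 * n + 3 →
    ∀ {ψ : ℝ × ℝ → ℂ}, Continuous ψ → HasCompactSupport ψ → ∀ φ : TestFun d,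
    (∀ (x : Space d) (t : ℝ), 0 < t → TestFun.box φ (x, t) = ψ (‖x‖ ^ 2, t)) →
    ∀ {u₀ u₁ : 𝓢'(Space d, ℂ)} {g₀ g₁ : Space d → ℂ}, HasFourierDensity u₀ g₀ →
    HasFourierDensity u₁ g₁ →
    ‖u₁ (TestFun.initial φ) - u₀ (TestFun.initialDt φ)‖ₑ ≤ ENNReal.ofReal C *
      ∫⁻ t in Ioi (0 : ℝ), ∫⁻ v, ENNReal.ofReal (√v ^ n) * ‖ψ (v, t)‖ₑ *
        dataWeight n g₀ g₁ √v := by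
  obtain ⟨C, hC, hrad⟩ := exists_radial_fourier_bound n
  refine ⟨C, hC, fun d hd ψ hψ hc φ hbox u₀ u₁ g₀ g₁ h₀ h₁ => ?_⟩
  have : Nontrivial (Space d) := by subst hd; infer_instance
  obtain ⟨A, hA⟩ : ∃ A : ℝ × ℝ → ℝ≥0∞,
      A = fun z => ENNReal.ofReal (√z.2 ^ n) * ‖ψ (z.2, z.1)‖ₑ := ⟨_, rfl⟩
  obtain ⟨B, hB⟩ : ∃ B : Space d → ℝ × ℝ → ℝ≥0∞, B = fun ξ z =>
    ENNReal.ofReal (‖ξ‖⁻¹ ^ (n + 1) * min 1 (√z.2 * ‖ξ‖)) := ⟨_, rfl⟩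
  obtain ⟨h, hh⟩ : ∃ h : Space d → ℝ≥0∞,
    h = fun ξ => ENNReal.ofReal ‖ξ‖⁻¹ * ‖g₁ ξ‖ₑ + ‖g₀ ξ‖ₑ := ⟨_, rfl⟩
  obtain ⟨ν, hν⟩ : ∃ ν : Measure (ℝ × ℝ), ν = (volume.restrict (Ioi 0)).prod volume := ⟨_, rfl⟩
  have hνs : SFinite ν := by rw [hν]; infer_instance
  have hAm : Measurable A := by
    have := hψ.measurable
    simp only [hA]
    fun_prop
  have hBm : Measurable (Function.uncurry B) := by
    simp only [hB, Function.uncurry_def]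
    fun_prop
  have hBξ : ∀ ξ, Measurable (B ξ) := fun ξ => hBm.comp measurable_prodMk_left
  have hABm : ∀ ξ, Measurable fun z => A z * B ξ z := fun ξ => hAm.mul (hBξ ξ)
  have hψc : ∀ t, Continuous fun v => ψ (v, t) := fun t => hψ.comp (by fun_prop)
  have hψs : ∀ t, HasCompactSupport fun v => ψ (v, t) := fun t => by
    refine hc.comp_isClosedEmbedding (g := fun v : ℝ => (v, t)) ?_
    exact (Homeomorph.prodComm ℝ ℝ).isClosedEmbedding.comp
      (Topology.IsClosedEmbedding.of_continuous_injective_isClosedMap (f := fun v : ℝ => (t, v))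
        (by fun_prop) (fun _ _ h => (Prod.ext_iff.1 h).2) (fun s hs => by
          have : (fun v : ℝ => (t, v)) '' s = {t} ×ˢ s := by
            ext ⟨a, b⟩; simp [eq_comm, and_comm]
          rw [this]; exact isClosed_singleton.prod hs))
  have hP : ∀ ξ : Space d, ξ ≠ 0 →
      ∫⁻ t in Ioi (0 : ℝ), ‖𝓕 (fun x : Space d => ψ (‖x‖ ^ 2, t)) ξ‖ₑ
        ≤ ENNReal.ofReal C * ∫⁻ z, A z * B ξ z ∂ν := by
    intro ξ hξ
    rw [hν, lintegral_prod _ (hABm ξ).aemeasurable,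
      ← lintegral_const_mul' _ _ ENNReal.ofReal_ne_top]
    simp only [hA, hB]
    exact lintegral_mono fun t => hrad d hd _ (hψc t) (hψs t) ξ hξ
  have hpt : ∀ ξ : Space d, ξ ≠ 0 →
      ‖𝓕 (fun x => φ (x, 0)) (-ξ) * g₁ ξ‖ₑ + ‖𝓕 (fun x => TestFun.dt φ (x, 0)) (-ξ) * g₀ ξ‖ₑ
        ≤ ENNReal.ofReal C * (h ξ * ∫⁻ z, A z * B ξ z ∂ν) := by
    intro ξ hξ
    obtain ⟨b1, b2⟩ := fourier_slice_bound φ hbox (neg_ne_zero.2 hξ)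
    have b3 := hP (-ξ) (neg_ne_zero.2 hξ)
    have hBn : B (-ξ) = B ξ := by simp only [hB, norm_neg]
    rw [hBn] at b3
    rw [norm_neg] at b1
    have hk : ENNReal.ofReal (2 * Real.pi * ‖ξ‖)⁻¹ ≤ ENNReal.ofReal ‖ξ‖⁻¹ := by
      have h0 : 0 < ‖ξ‖ := norm_pos_iff.2 hξ
      refine ENNReal.ofReal_le_ofReal (inv_anti₀ h0 ?_)
      nlinarith [Real.pi_gt_three]
    rw [enorm_mul, enorm_mul]
    calc _ ≤ (ENNReal.ofReal ‖ξ‖⁻¹ * (ENNReal.ofReal C * ∫⁻ z, A z * B ξ z ∂ν)) * ‖g₁ ξ‖ₑ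
          + (ENNReal.ofReal C * ∫⁻ z, A z * B ξ z ∂ν) * ‖g₀ ξ‖ₑ := by
          gcongr
          · exact b1.trans (by gcongr)
          · exact b2.trans b3
      _ = _ := by rw [hh]; ring
  have hae : ∀ᵐ ξ : Space d, ξ ≠ 0 := by
    simp [ae_iff]
  have hhm : AEMeasurable h := by
    have m1 := h₁.1.aestronglyMeasurable.enorm
    have m0 := h₀.1.aestronglyMeasurable.enorm
    rw [hh]
    exact ((by fun_prop : Measurable fun ξ : Space d => ENNReal.ofReal ‖ξ‖⁻¹).aemeasurable.mul
      m1).add m0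
  calc ‖u₁ (TestFun.initial φ) - u₀ (TestFun.initialDt φ)‖ₑ
      ≤ ‖u₁ (TestFun.initial φ)‖ₑ + ‖u₀ (TestFun.initialDt φ)‖ₑ := enorm_sub_le
    _ ≤ (∫⁻ ξ, ‖𝓕 (fun x => φ (x, 0)) (-ξ) * g₁ ξ‖ₑ)
        + ∫⁻ ξ, ‖𝓕 (fun x => TestFun.dt φ (x, 0)) (-ξ) * g₀ ξ‖ₑ := by
        rw [h₁.apply_eq, h₀.apply_eq]
        exact add_le_add (enorm_integral_le_lintegral_enorm _)
          (enorm_integral_le_lintegral_enorm _)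
    _ = ∫⁻ ξ, (‖𝓕 (fun x => φ (x, 0)) (-ξ) * g₁ ξ‖ₑ
        + ‖𝓕 (fun x => TestFun.dt φ (x, 0)) (-ξ) * g₀ ξ‖ₑ) := by
        refine (lintegral_add_left' ?_ _).symm
        have : Continuous (𝓕 (TestFun.initial φ : Space d → ℂ)) := by
          rw [← SchwartzMap.fourier_coe]; exact (𝓕 (TestFun.initial φ)).continuous
        exact ((this.comp continuous_neg).aestronglyMeasurable.mul
          h₁.1.aestronglyMeasurable).enorm
    _ ≤ ∫⁻ ξ, ENNReal.ofReal C * (h ξ * ∫⁻ z, A z * B ξ z ∂ν) :=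
        lintegral_mono_ae (hae.mono hpt)
    _ = ENNReal.ofReal C * ∫⁻ ξ, ∫⁻ z, h ξ * (A z * B ξ z) ∂ν := by
        rw [lintegral_const_mul' _ _ ENNReal.ofReal_ne_top]
        congr 1
        refine lintegral_congr fun ξ => ?_
        rw [lintegral_const_mul _ (hABm ξ)]
    _ = ENNReal.ofReal C * ∫⁻ z, (∫⁻ ξ, h ξ * (A z * B ξ z)) ∂ν := by
        rw [lintegral_lintegral_swap]
        exact (hhm.comp_quasiMeasurePreserving Measure.quasiMeasurePreserving_fst).mul
          ((hAm.comp measurable_snd).mul hBm).aemeasurable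
    _ = ENNReal.ofReal C * ∫⁻ z, A z * dataWeight n g₀ g₁ √z.2 ∂ν := by
        congr 1
        refine lintegral_congr fun z => ?_
        have hm : AEMeasurable fun ξ => h ξ * B ξ z :=
          hhm.mul (hBm.comp (measurable_prodMk_right (y := z))).aemeasurable
        have e : dataWeight n g₀ g₁ √z.2 = ∫⁻ ξ, h ξ * B ξ z := by rw [hh, hB]; rfl
        rw [e, ← lintegral_const_mul'' _ hm]
        exact lintegral_congr fun ξ => by ring
    _ = _ := by
        have hm : Measurable fun z => A z * dataWeight n g₀ g₁ √z.2 :=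
          (hAm.mul ((dataWeight_mono n g₀ g₁).measurable.comp
          (by fun_prop : Measurable fun z : ℝ × ℝ => √z.2)))
        rw [hν, lintegral_prod _ hm.aemeasurable, hA]

end

/-! ### Polar coordinates in space-time -/

/-- The measure `r^(d-1) dr dt` on the half-plane `r > 0`. -/
def polarMeasure (d : ℕ) : Measure (ℝ × ℝ) :=
  ((volume.restrict (Ioi 0)).withDensity fun r => ENNReal.ofReal (r ^ (d - 1))).prod volume

instance (d : ℕ) : SFinite (polarMeasure d) := by unfold polarMeasure; infer_instance

lemma measurePreserving_subtype_Ioi (k : ℕ) :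
    MeasurePreserving (Subtype.val : Ioi (0 : ℝ) → ℝ) (Measure.volumeIoiPow k)
      ((volume.restrict (Ioi 0)).withDensity fun r => ENNReal.ofReal (r ^ k)) := by
  refine ⟨measurable_subtype_coe, Measure.ext_of_lintegral _ fun φ hφ => ?_⟩
  have hm : Measurable fun r : ℝ => ENNReal.ofReal (r ^ k) := by fun_prop
  have h1 := lintegral_withDensity_eq_lintegral_mul
    (Measure.comap (Subtype.val : Ioi (0 : ℝ) → ℝ) volume)
    (hm.comp measurable_subtype_coe) (hφ.comp measurable_subtype_coe)
  rw [lintegral_map hφ measurable_subtype_coe, Measure.volumeIoiPow]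
  refine h1.trans ?_
  rw [lintegral_withDensity_eq_lintegral_mul _ hm hφ]
  exact (measurePreserving_subtype_coe measurableSet_Ioi).lintegral_comp (hm.mul hφ)

/-- Polar coordinates in the space variable. -/
def polarCoord (d : ℕ) (q : Metric.sphere (0 : Space d) 1 × (Ioi (0 : ℝ) × ℝ)) : Space d × ℝ :=
  ((q.2.1 : ℝ) • (q.1 : Space d), q.2.2)

lemma measurePreserving_polarCoord (d : ℕ) [Nontrivial (Space d)] :
    MeasurePreserving (polarCoord d)
      ((volume : Measure (Space d)).toSphere.prod ((Measure.volumeIoiPow (d - 1)).prod volume))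
      volume := by
  have h1 := (volume : Measure (Space d)).measurePreserving_homeomorphUnitSphereProd
  rw [finrank_euclideanSpace, Fintype.card_fin] at h1
  have h2 : MeasurePreserving (homeomorphUnitSphereProd (Space d)).toMeasurableEquiv.symm
      ((volume : Measure (Space d)).toSphere.prod (Measure.volumeIoiPow (d - 1))) _ :=
    MeasurePreserving.symm (homeomorphUnitSphereProd (Space d)).toMeasurableEquiv h1
  have h3 := measurePreserving_subtype_coe (μa := (volume : Measure (Space d)))
    (measurableSet_singleton (0 : Space d)).compl
  rw [restrict_compl_singleton] at h3
  have h4 := (h3.comp h2).prod (MeasurePreserving.id (volume : Measure ℝ))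
  have h5 : MeasurePreserving (MeasurableEquiv.prodAssoc
      (α := Metric.sphere (0 : Space d) 1) (β := Ioi (0 : ℝ)) (γ := ℝ)).symm _ _ :=
    (measurePreserving_prodAssoc (volume : Measure (Space d)).toSphere
    (Measure.volumeIoiPow (d - 1)) (volume : Measure ℝ)).symm _
  exact h4.comp h5

lemma norm_polarCoord (d : ℕ) (q : Metric.sphere (0 : Space d) 1 × (Ioi (0 : ℝ) × ℝ)) :
    ‖(polarCoord d q).1‖ = q.2.1 := by
  have h1 : ‖(q.1 : Space d)‖ = 1 := by simp
  have h2 : (0 : ℝ) < q.2.1 := q.2.1.2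
  rw [polarCoord, norm_smul, h1, mul_one, Real.norm_of_nonneg h2.le]

lemma measurePreserving_val_prod (d : ℕ) :
    MeasurePreserving (Prod.map (Subtype.val : Ioi (0 : ℝ) → ℝ) (id : ℝ → ℝ))
      ((Measure.volumeIoiPow (d - 1)).prod volume) (polarMeasure d) :=
  (measurePreserving_subtype_Ioi (d - 1)).prod (MeasurePreserving.id volume)

lemma lintegral_radial (d : ℕ) [Nontrivial (Space d)] {f : ℝ × ℝ → ℝ≥0∞} (hf : Measurable f) :
    ∫⁻ z : Space d × ℝ, f (‖z.1‖, z.2)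
      = (volume : Measure (Space d)).toSphere univ * ∫⁻ q, f q ∂polarMeasure d := by
  have hm : Measurable fun z : Space d × ℝ => f (‖z.1‖, z.2) := hf.comp (by fun_prop)
  have hm2 : Measurable fun p : Ioi (0 : ℝ) × ℝ => f (p.1, p.2) := hf.comp (by fun_prop)
  rw [← (measurePreserving_polarCoord d).lintegral_comp hm]
  simp only [norm_polarCoord]
  rw [lintegral_prod _ (by exact (hm2.comp measurable_snd).aemeasurable)]
  simp only [polarCoord]
  rw [lintegral_const, mul_comm, ← (measurePreserving_val_prod d).lintegral_comp hf]
  rfl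

lemma polarMeasure_eq (d : ℕ) : polarMeasure d
    = (volume.restrict (Ioi (0 : ℝ) ×ˢ (univ : Set ℝ))).withDensity
      fun q : ℝ × ℝ => ENNReal.ofReal (q.1 ^ (d - 1)) := by
  rw [polarMeasure, prod_withDensity_left (by fun_prop), Measure.volume_eq_prod,
    ← Measure.prod_restrict, Measure.restrict_univ]

/-- A radial integrable function has an integrable profile. -/
lemma integrable_profile (d : ℕ) [Nontrivial (Space d)] {w : ℝ × ℝ → ℂ}
    (hw : Integrable fun z : Space d × ℝ => w (‖z.1‖, z.2)) :
    IntegrableOn (fun q : ℝ × ℝ => q.1 ^ (d - 1) • w q) (Ioi (0 : ℝ) ×ˢ (univ : Set ℝ)) := by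
  have h1 := (measurePreserving_polarCoord d).integrable_comp_of_integrable hw
  have h2 := h1.prod_right_ae
  obtain ⟨σ, hσ⟩ : ∃ σ, Integrable (fun p => ((fun z : Space d × ℝ => w (‖z.1‖, z.2)) ∘
      polarCoord d) (σ, p)) ((Measure.volumeIoiPow (d - 1)).prod volume) := by
    have : NeZero (volume : Measure (Space d)).toSphere :=
      ⟨(volume : Measure (Space d)).toSphere_ne_zero⟩
    exact h2.exists
  have h3 : (fun p => ((fun z : Space d × ℝ => w (‖z.1‖, z.2)) ∘ polarCoord d) (σ, p))
      = w ∘ Prod.map (Subtype.val : Ioi (0 : ℝ) → ℝ) (id : ℝ → ℝ) := by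
    ext p
    simp only [Function.comp, norm_polarCoord]
    rfl
  have hemb : MeasurableEmbedding (Prod.map (Subtype.val : Ioi (0 : ℝ) → ℝ) (id : ℝ → ℝ)) :=
    (MeasurableEmbedding.subtype_coe measurableSet_Ioi).prodMap MeasurableEmbedding.id
  rw [h3, (measurePreserving_val_prod d).integrable_comp_emb hemb, polarMeasure_eq,
    integrable_withDensity_iff_integrable_smul' (by fun_prop) (by simp)] at hσ
  refine hσ.congr ?_
  filter_upwards [ae_restrict_mem (measurableSet_Ioi.prod MeasurableSet.univ)] with q hq
  have : (0 : ℝ) < q.1 := hq.1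
  rw [ENNReal.toReal_ofReal (by positivity)]

/-- Null sets in the `(r, t)` half-plane lift to null sets in space-time. -/
lemma ae_radial (d : ℕ) [Nontrivial (Space d)] {p : ℝ × ℝ → Prop} (hp : ∀ᵐ q, p q) :
    ∀ᵐ z : Space d × ℝ, p (‖z.1‖, z.2) := by
  obtain ⟨N, hN, hNm, hN0⟩ := exists_measurable_superset_of_null (ae_iff.1 hp)
  have h1 := lintegral_radial d (f := N.indicator 1) (measurable_one.indicator hNm)
  have h2 : ∫⁻ q, N.indicator 1 q ∂polarMeasure d = 0 := by
    rw [lintegral_indicator_one hNm, polarMeasure_eq]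
    refine withDensity_absolutelyContinuous _ _ ?_
    exact le_antisymm ((Measure.restrict_le_self _).trans hN0.le) bot_le
  have hm : Measurable fun z : Space d × ℝ => N.indicator (1 : ℝ × ℝ → ℝ≥0∞) (‖z.1‖, z.2) :=
    (measurable_one.indicator hNm).comp (by fun_prop)
  rw [h2, mul_zero, lintegral_eq_zero_iff hm] at h1
  filter_upwards [h1] with z hz
  by_contra hne
  have : (‖z.1‖, z.2) ∈ N := hN hne
  simp [indicator, this] at hz

section

/-! ### Duality and the pointwise bound -/

variable {d : ℕ}

/-- The part of the exterior of the light cone on which `|x| + |t| ≤ R`. For `R = 2 r` it contains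
the part outside the light cone of the domain of dependence of every exterior point at
radius `r`. -/
def sourceRegion (d : ℕ) (R : ℝ) : Set (Space d × ℝ) :=
  {z | |z.2| < ‖z.1‖ ∧ ‖z.1‖ + |z.2| ≤ R}

lemma measurableSet_sourceRegion (d : ℕ) (R : ℝ) : MeasurableSet (sourceRegion d R) := by
  have h1 : MeasurableSet {z : Space d × ℝ | |z.2| < ‖z.1‖} :=
    measurableSet_lt (by fun_prop) (by fun_prop)
  have h2 : MeasurableSet {z : Space d × ℝ | ‖z.1‖ + |z.2| ≤ R} :=
    measurableSet_le (by fun_prop) (by fun_prop)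
  exact h1.inter h2

/-- The amplitude at radius `R` of the wave with source `F`. -/
def sourceWeight (n : ℕ) (F : Space d × ℝ → ℂ) (R : ℝ) : ℝ≥0∞ :=
  ∫⁻ z in sourceRegion d R, ENNReal.ofReal (‖z.1‖⁻¹ ^ (n + 1)) * ‖F z‖ₑ

lemma sourceWeight_mono (n : ℕ) (F : Space d × ℝ → ℂ) : Monotone (sourceWeight n F) :=
  fun _ _ h => lintegral_mono_set fun _ hz => ⟨hz.1, hz.2.trans h⟩

/-- The amplitude of a wave at radius `R`. -/
def amplitude (n : ℕ) (g₀ g₁ : Space d → ℂ) (F : Space d × ℝ → ℂ) (R : ℝ) : ℝ≥0∞ :=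
  dataWeight n g₀ g₁ R + sourceWeight n F (2 * R)

lemma amplitude_mono (n : ℕ) (g₀ g₁ : Space d → ℂ) (F : Space d × ℝ → ℂ) :
    Monotone (amplitude n g₀ g₁ F) := fun _ _ h =>
  add_le_add (dataWeight_mono n g₀ g₁ h) (sourceWeight_mono n F (by linarith))

/-- By Tonelli's theorem, the pointwise bound of the test function `φ` turns the pairing with the
source into an average of source amplitudes. -/
lemma source_pairing_bound {n : ℕ} {F : Space d × ℝ → ℂ} (hF : LocallyIntegrable F) {C : ℝ}
    (hC : 0 < C) {ψ : ℝ × ℝ → ℂ} (hψ : Continuous ψ) (φ : TestFun d)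
    (hφ : ∀ (x : Space d) (t : ℝ), 0 < t →
      ‖φ (x, t)‖ₑ ≤ ENNReal.ofReal (C * ‖x‖⁻¹ ^ (n + 1)) *
        ∫⁻ t' : ℝ, ∫⁻ v : ℝ, {z : ℝ × ℝ | t < ‖x‖ ∧ ‖x‖ + t ≤ 2 * √z.1}.indicator
        (fun z => ENNReal.ofReal (√z.1 ^ n) * ‖ψ z‖ₑ) (v, t')) :
    ‖∫ z in {z : Space d × ℝ | 0 < z.2}, F z * φ z‖ₑ ≤ ENNReal.ofReal C *
      ∫⁻ t, ∫⁻ v, ENNReal.ofReal (√v ^ n) * ‖ψ (v, t)‖ₑ * sourceWeight n F (2 * √v) := by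
  obtain ⟨A, hA⟩ : ∃ A : ℝ × ℝ → ℝ≥0∞,
    A = fun q => ENNReal.ofReal (√q.2 ^ n) * ‖ψ (q.2, q.1)‖ₑ := ⟨_, rfl⟩
  obtain ⟨S, hS⟩ : ∃ S : Set ((Space d × ℝ) × (ℝ × ℝ)),
    S = {p | p.1 ∈ sourceRegion d (2 * √p.2.2)} := ⟨_, rfl⟩
  obtain ⟨h, hh⟩ : ∃ h : Space d × ℝ → ℝ≥0∞,
    h = fun z => ENNReal.ofReal (‖z.1‖⁻¹ ^ (n + 1)) * ‖F z‖ₑ := ⟨_, rfl⟩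
  have hAm : Measurable A := by
    have := hψ.measurable
    rw [hA]
    fun_prop
  have hSm : MeasurableSet S := by
    rw [hS]
    have h1 : MeasurableSet {p : (Space d × ℝ) × (ℝ × ℝ) | |p.1.2| < ‖p.1.1‖} :=
      measurableSet_lt (by fun_prop) (by fun_prop)
    have h2 : MeasurableSet {p : (Space d × ℝ) × (ℝ × ℝ) | ‖p.1.1‖ + |p.1.2| ≤ 2 * √p.2.2} :=
      measurableSet_le (by fun_prop) (by fun_prop)
    exact h1.inter h2
  have hhm : AEMeasurable h := by
    rw [hh]
    exact (by fun_prop : Measurable fun z : Space d × ℝ =>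
      ENNReal.ofReal (‖z.1‖⁻¹ ^ (n + 1))).aemeasurable.mul hF.aestronglyMeasurable.enorm
  have hSA : Measurable (S.indicator fun p => A p.2) :=
    (hAm.comp measurable_snd).indicator hSm
  have hSAz : ∀ z, Measurable fun q => S.indicator (fun p => A p.2) (z, q) := fun z =>
    hSA.comp measurable_prodMk_left
  have hpos : MeasurableSet {z : Space d × ℝ | 0 < z.2} := measurableSet_lt (by fun_prop)
    (by fun_prop)
  calc ‖∫ z in {z : Space d × ℝ | 0 < z.2}, F z * φ z‖ₑ
      ≤ ∫⁻ z in {z : Space d × ℝ | 0 < z.2}, ‖F z * φ z‖ₑ := enorm_integral_le_lintegral_enorm _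
    _ ≤ ∫⁻ z in {z : Space d × ℝ | 0 < z.2}, ENNReal.ofReal C *
          (h z * ∫⁻ q : ℝ × ℝ, S.indicator (fun p => A p.2) (z, q)) := by
        refine setLIntegral_mono' hpos fun z (hz : 0 < z.2) => ?_
        have h1 : ∫⁻ t' : ℝ, ∫⁻ v : ℝ, {q : ℝ × ℝ | z.2 < ‖z.1‖ ∧ ‖z.1‖ + z.2 ≤ 2 * √q.1}.indicator
            (fun q => ENNReal.ofReal (√q.1 ^ n) * ‖ψ q‖ₑ) (v, t')
            = ∫⁻ q : ℝ × ℝ, S.indicator (fun p => A p.2) (z, q) := by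
          rw [Measure.volume_eq_prod, lintegral_prod _ (hSAz z).aemeasurable]
          refine lintegral_congr fun t' => lintegral_congr fun v => ?_
          simp only [indicator, hS, hA, sourceRegion, mem_ofPred_eq, abs_of_pos hz]
        rw [enorm_mul, hh, ← h1]
        calc ‖F z‖ₑ * ‖φ z‖ₑ ≤ ‖F z‖ₑ * _ := mul_le_mul_right (hφ z.1 z.2 hz) _
          _ = _ := by rw [ENNReal.ofReal_mul hC.le]; ring
    _ ≤ ∫⁻ z, ENNReal.ofReal C *
          (h z * ∫⁻ q : ℝ × ℝ, S.indicator (fun p => A p.2) (z, q)) := setLIntegral_le_lintegral _ _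
    _ = ENNReal.ofReal C * ∫⁻ z, ∫⁻ q : ℝ × ℝ, h z * S.indicator (fun p => A p.2) (z, q) := by
        rw [lintegral_const_mul' _ _ ENNReal.ofReal_ne_top]
        congr 1
        exact lintegral_congr fun z => (lintegral_const_mul _ (hSAz z)).symm
    _ = ENNReal.ofReal C * ∫⁻ q : ℝ × ℝ, ∫⁻ z, h z * S.indicator (fun p => A p.2) (z, q) := by
        rw [lintegral_lintegral_swap]
        exact (hhm.comp_quasiMeasurePreserving Measure.quasiMeasurePreserving_fst).mul
          hSA.aemeasurable
    _ = ENNReal.ofReal C * ∫⁻ q : ℝ × ℝ, A q * sourceWeight n F (2 * √q.2) := by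
        congr 1
        refine lintegral_congr fun q => ?_
        rw [sourceWeight, ← lintegral_indicator (measurableSet_sourceRegion d _),
          ← lintegral_const_mul'' _ ?_]
        · refine lintegral_congr fun z => ?_
          by_cases hz : z ∈ sourceRegion d (2 * √q.2)
          · rw [indicator_of_mem hz, indicator_of_mem (show (z, q) ∈ S by rw [hS]; exact hz), hh,
              mul_comm]
          · rw [indicator_of_notMem hz, indicator_of_notMem (show (z, q) ∉ S by rw [hS]; exact hz),
              mul_zero, mul_zero]
        · have := hhm.indicator (measurableSet_sourceRegion d (2 * √q.2))
          rwa [hh] at this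
    _ = _ := by
        have hm : Measurable fun q : ℝ × ℝ => A q * sourceWeight n F (2 * √q.2) :=
          hAm.mul ((sourceWeight_mono n F).measurable.comp (by fun_prop))
        rw [Measure.volume_eq_prod, lintegral_prod _ hm.aemeasurable, hA]

/-- The distribution `u` is tested against radial functions supported outside the light cone. -/
theorem exists_pairing_bound (n : ℕ) : ∃ C : ℝ, 0 < C ∧ ∀ d, d = 2 * n + 3 →
    ∀ {u F : Space d × ℝ → ℂ} {u₀ u₁ : 𝓢'(Space d, ℂ)} {g₀ g₁ : Space d → ℂ},
    LocallyIntegrable F → HasFourierDensity u₀ g₀ → HasFourierDensity u₁ g₁ →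
    (∀ φ : TestFun d, ∫ z in {z : Space d × ℝ | 0 < z.2}, u z * TestFun.box φ z =
      (∫ z in {z : Space d × ℝ | 0 < z.2}, F z * φ z)
        + u₁ (TestFun.initial φ) - u₀ (TestFun.initialDt φ)) →
    ∀ {ψ : ℝ × ℝ → ℂ}, ContDiff ℝ ∞ ψ → HasCompactSupport ψ → ∀ {ε b T : ℝ}, 0 < ε →
    SupportedOutside ψ ε b T →
    ‖∫ z in {z : Space d × ℝ | 0 < z.2}, u z * ψ (‖z.1‖ ^ 2, z.2)‖ₑ ≤ ENNReal.ofReal C *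
      ∫⁻ t, ∫⁻ v, ENNReal.ofReal (√v ^ n) * ‖ψ (v, t)‖ₑ * amplitude n g₀ g₁ F √v := by
  obtain ⟨C₁, hC₁, htest⟩ := exists_testFun n
  obtain ⟨C₂, hC₂, hdata⟩ := exists_data_bound n
  refine ⟨C₁ + C₂, by positivity, ?_⟩
  intro d hd u F u₀ u₁ g₀ g₁ hF h₀ h₁ hu ψ hψ hc ε b T hε hS
  obtain ⟨φ, hbox, hφ⟩ := htest d hd hψ hc hε hS
  have e1 : ∫ z in {z : Space d × ℝ | 0 < z.2}, u z * ψ (‖z.1‖ ^ 2, z.2)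
      = ∫ z in {z : Space d × ℝ | 0 < z.2}, u z * TestFun.box φ z := by
    refine setIntegral_congr_fun (measurableSet_lt (by fun_prop) (by fun_prop)) fun z hz => ?_
    simp only [← hbox z.1 z.2 hz]
  have hm : ∀ t : ℝ, Measurable fun v =>
      ENNReal.ofReal (√v ^ n) * ‖ψ (v, t)‖ₑ * dataWeight n g₀ g₁ √v := by
    intro t
    have h1 := hψ.continuous.measurable
    have h2 := (dataWeight_mono n g₀ g₁).measurable.comp (by fun_prop : Measurable fun v => √v)
    have h3 : Measurable fun v => ENNReal.ofReal (√v ^ n) * ‖ψ (v, t)‖ₑ := by fun_prop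
    exact h3.mul h2
  have hm2 : Measurable fun t : ℝ => ∫⁻ v, ENNReal.ofReal (√v ^ n) * ‖ψ (v, t)‖ₑ *
      dataWeight n g₀ g₁ √v := by
    refine Measurable.lintegral_prod_right' (f := fun p : ℝ × ℝ =>
      ENNReal.ofReal (√p.2 ^ n) * ‖ψ (p.2, p.1)‖ₑ * dataWeight n g₀ g₁ √p.2) ?_
    have h1 := hψ.continuous.measurable
    have h2 := (dataWeight_mono n g₀ g₁).measurable.comp
      (by fun_prop : Measurable fun p : ℝ × ℝ => √p.2)
    have h3 : Measurable fun p : ℝ × ℝ => ENNReal.ofReal (√p.2 ^ n) * ‖ψ (p.2, p.1)‖ₑ := by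
      fun_prop
    exact h3.mul h2
  rw [e1, hu φ, add_sub_assoc]
  calc _ ≤ ‖∫ z in {z : Space d × ℝ | 0 < z.2}, F z * φ z‖ₑ
        + ‖u₁ (TestFun.initial φ) - u₀ (TestFun.initialDt φ)‖ₑ := enorm_add_le _ _
    _ ≤ ENNReal.ofReal C₁ * (∫⁻ t, ∫⁻ v, ENNReal.ofReal (√v ^ n) * ‖ψ (v, t)‖ₑ *
          sourceWeight n F (2 * √v))
        + ENNReal.ofReal C₂ * ∫⁻ t, ∫⁻ v, ENNReal.ofReal (√v ^ n) * ‖ψ (v, t)‖ₑ *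
          dataWeight n g₀ g₁ √v := by
        refine add_le_add (source_pairing_bound hF hC₁ hψ.continuous φ hφ) ?_
        refine (hdata d hd hψ.continuous hc φ hbox h₀ h₁).trans ?_
        gcongr
        exact Measure.restrict_le_self
    _ ≤ ENNReal.ofReal (C₁ + C₂) * (∫⁻ t, ∫⁻ v, ENNReal.ofReal (√v ^ n) * ‖ψ (v, t)‖ₑ *
          sourceWeight n F (2 * √v))
        + ENNReal.ofReal (C₁ + C₂) * ∫⁻ t, ∫⁻ v, ENNReal.ofReal (√v ^ n) * ‖ψ (v, t)‖ₑ *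
          dataWeight n g₀ g₁ √v := by
        gcongr <;> linarith
    _ = _ := by
        rw [← mul_add, add_comm (∫⁻ _, _), ← lintegral_add_left hm2]
        congr 1
        refine lintegral_congr fun t => ?_
        rw [← lintegral_add_left (hm t)]
        refine lintegral_congr fun v => ?_
        rw [← mul_add]
        rfl

end

section

variable {d : ℕ}

lemma integral_radial (d : ℕ) [Nontrivial (Space d)] {w : ℝ × ℝ → ℂ}
    (hw : AEStronglyMeasurable (fun z : Space d × ℝ => w (‖z.1‖, z.2))) :
    ∫ z : Space d × ℝ, w (‖z.1‖, z.2) = (volume : Measure (Space d)).toSphere.real univ •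
      ∫ q in Ioi (0 : ℝ) ×ˢ (univ : Set ℝ), q.1 ^ (d - 1) • w q := by
  have hP := measurePreserving_polarCoord d
  have hemb : MeasurableEmbedding (Prod.map (Subtype.val : Ioi (0 : ℝ) → ℝ) (id : ℝ → ℝ)) :=
    (MeasurableEmbedding.subtype_coe measurableSet_Ioi).prodMap MeasurableEmbedding.id
  have hw' := hw
  rw [← hP.map_eq] at hw ⊢
  rw [integral_map hP.measurable.aemeasurable hw]
  simp only [norm_polarCoord]
  have h1 := integral_fun_snd (μ := (volume : Measure (Space d)).toSphere)
    (ν := (Measure.volumeIoiPow (d - 1)).prod (volume : Measure ℝ))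
    (fun p : Ioi (0 : ℝ) × ℝ => w (p.1, p.2))
  have h2 := (measurePreserving_val_prod d).integral_comp hemb w
  refine h1.trans ?_
  congr 1
  refine h2.trans ?_
  rw [polarMeasure_eq, integral_withDensity_eq_integral_toReal_smul (by fun_prop) (by simp)]
  refine setIntegral_congr_fun (measurableSet_Ioi.prod MeasurableSet.univ) fun q hq => ?_
  have : (0 : ℝ) < q.1 := hq.1
  rw [ENNReal.toReal_ofReal (by positivity)]

/-- The profile of a radial function along a coordinate ray. -/
def profile (n : ℕ) (u : Space (2 * n + 3) × ℝ → ℂ) (q : ℝ × ℝ) : ℂ :=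
  u (EuclideanSpace.single 0 q.1, q.2)

lemma IsRadial.eq_profile {n : ℕ} {u : Space (2 * n + 3) × ℝ → ℂ} (hu : IsRadial u)
    (z : Space (2 * n + 3) × ℝ) : profile n u (‖z.1‖, z.2) = u z :=
  hu _ _ _ (by simp)

/-- The profile, weighted by the density of polar coordinates and restricted to positive times. -/
def weightedProfile (n : ℕ) (u : Space (2 * n + 3) × ℝ → ℂ) : ℝ × ℝ → ℂ :=
  (Ioi (0 : ℝ) ×ˢ Ioi (0 : ℝ)).indicator fun q => q.1 ^ (2 * n + 2) • profile n u q

lemma locallyIntegrable_weightedProfile {n : ℕ} {u : Space (2 * n + 3) × ℝ → ℂ}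
    (hu : IsRadial u) (hl : LocallyIntegrable u) : LocallyIntegrable (weightedProfile n u) := by
  rw [locallyIntegrable_iff]
  intro K hK
  obtain ⟨R, hR⟩ := hK.isBounded.subset_closedBall 0
  set B : Set (ℝ × ℝ) := Metric.closedBall 0 R with hB
  set D : Set (Space (2 * n + 3) × ℝ) := {z | (‖z.1‖, z.2) ∈ B} with hD
  have hDc : D ⊆ Metric.closedBall 0 R := by
    intro z hz
    have hz' : ‖((‖z.1‖, z.2) : ℝ × ℝ)‖ ≤ R := by simpa [hD, hB] using hz
    rw [Prod.norm_def] at hz'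
    rw [mem_closedBall_zero_iff, Prod.norm_def]
    simpa using hz'
  have hDm : MeasurableSet D := by
    have : Continuous fun z : Space (2 * n + 3) × ℝ => (‖z.1‖, z.2) := by fun_prop
    exact this.measurable Metric.isClosed_closedBall.measurableSet
  have h1 : IntegrableOn u D := (hl.integrableOn_isCompact (isCompact_closedBall _ _)).mono_set hDc
  rw [← integrable_indicator_iff hDm] at h1
  have h2 : D.indicator u = fun z => (B.indicator (profile n u)) (‖z.1‖, z.2) := by
    ext z
    by_cases hz : z ∈ D
    · rw [indicator_of_mem hz, indicator_of_mem (show (‖z.1‖, z.2) ∈ B from hz), hu.eq_profile]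
    · rw [indicator_of_notMem hz, indicator_of_notMem (show (‖z.1‖, z.2) ∉ B from hz)]
  rw [h2] at h1
  have h3 := integrable_profile (2 * n + 3) h1
  have hBm : MeasurableSet B := Metric.isClosed_closedBall.measurableSet
  have h4 : IntegrableOn (weightedProfile n u) B := by
    rw [← integrable_indicator_iff hBm]
    rw [← integrable_indicator_iff (measurableSet_Ioi.prod MeasurableSet.univ)] at h3
    refine (h3.indicator (measurableSet_Ioi.prod measurableSet_Ioi :
      MeasurableSet (Ioi (0 : ℝ) ×ˢ Ioi (0 : ℝ)))).congr (Filter.Eventually.of_forall fun q => ?_)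
    by_cases h5 : q ∈ Ioi (0 : ℝ) ×ˢ Ioi (0 : ℝ)
    · by_cases h6 : q ∈ B
      · have h7 : q ∈ Ioi (0 : ℝ) ×ˢ (univ : Set ℝ) := ⟨h5.1, mem_univ _⟩
        simp only [weightedProfile, indicator_of_mem h5, indicator_of_mem h6, indicator_of_mem h7]
        rfl
      · have h7 : q ∈ Ioi (0 : ℝ) ×ˢ (univ : Set ℝ) := ⟨h5.1, mem_univ _⟩
        simp only [indicator_of_mem h5, indicator_of_notMem h6, indicator_of_mem h7, smul_zero]
    · by_cases h6 : q ∈ B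
      · simp only [weightedProfile, indicator_of_notMem h5, indicator_of_mem h6]
      · simp only [indicator_of_notMem h5, indicator_of_notMem h6]
  exact h4.mono_set hR

lemma setIntegral_mul_radial {n : ℕ} {u : Space (2 * n + 3) × ℝ → ℂ} (hu : IsRadial u)
    (hl : LocallyIntegrable u) {ρ : ℝ × ℝ → ℝ} (hρ : Continuous ρ) :
    ∫ z in {z : Space (2 * n + 3) × ℝ | 0 < z.2}, u z * (ρ (‖z.1‖, z.2) : ℂ)
      = (volume : Measure (Space (2 * n + 3))).toSphere.real univ •
        ∫ q, ρ q • weightedProfile n u q := by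
  have hpos : MeasurableSet {z : Space (2 * n + 3) × ℝ | 0 < z.2} :=
    measurableSet_lt (by fun_prop) (by fun_prop)
  have h1 : ({z : Space (2 * n + 3) × ℝ | 0 < z.2}.indicator
      fun z => u z * (ρ (‖z.1‖, z.2) : ℂ))
      = fun z => (({q : ℝ × ℝ | 0 < q.2}.indicator fun q => profile n u q * (ρ q : ℂ))
        (‖z.1‖, z.2)) := by
    ext z
    by_cases hz : 0 < z.2
    · rw [indicator_of_mem (show z ∈ {z : Space (2 * n + 3) × ℝ | 0 < z.2} from hz),
        indicator_of_mem (show (‖z.1‖, z.2) ∈ {q : ℝ × ℝ | 0 < q.2} from hz), hu.eq_profile]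
    · rw [indicator_of_notMem (show z ∉ {z : Space (2 * n + 3) × ℝ | 0 < z.2} from hz),
        indicator_of_notMem (show (‖z.1‖, z.2) ∉ {q : ℝ × ℝ | 0 < q.2} from hz)]
  have h2 : AEStronglyMeasurable ({z : Space (2 * n + 3) × ℝ | 0 < z.2}.indicator
      fun z => u z * (ρ (‖z.1‖, z.2) : ℂ)) :=
    (hl.aestronglyMeasurable.mul (by fun_prop : Continuous fun z : Space (2 * n + 3) × ℝ =>
      (ρ (‖z.1‖, z.2) : ℂ)).aestronglyMeasurable).indicator hpos
  rw [h1] at h2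
  rw [← integral_indicator hpos, h1, integral_radial _ h2,
    ← integral_indicator (measurableSet_Ioi.prod MeasurableSet.univ)]
  congr 2 with q
  by_cases h3 : 0 < q.1
  · rw [indicator_of_mem (show q ∈ Ioi (0 : ℝ) ×ˢ (univ : Set ℝ) from ⟨h3, mem_univ _⟩)]
    by_cases h4 : 0 < q.2
    · rw [indicator_of_mem (show q ∈ {q : ℝ × ℝ | 0 < q.2} from h4), weightedProfile,
        indicator_of_mem (show q ∈ Ioi (0 : ℝ) ×ˢ Ioi (0 : ℝ) from ⟨h3, h4⟩)]
      simp only [Complex.real_smul]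
      rw [show 2 * n + 3 - 1 = 2 * n + 2 by omega]
      ring
    · rw [indicator_of_notMem (show q ∉ {q : ℝ × ℝ | 0 < q.2} from h4), weightedProfile,
        indicator_of_notMem (show q ∉ Ioi (0 : ℝ) ×ˢ Ioi (0 : ℝ) from fun h => h4 h.2),
        smul_zero, smul_zero]
  · rw [indicator_of_notMem (show q ∉ Ioi (0 : ℝ) ×ˢ (univ : Set ℝ) from fun h => h3 h.1),
      weightedProfile,
      indicator_of_notMem (show q ∉ Ioi (0 : ℝ) ×ˢ Ioi (0 : ℝ) from fun h => h3 h.1), smul_zero]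

lemma lintegral_comp_sqrt {f : ℝ → ℝ≥0∞} (hf : f 0 = 0) :
    ∫⁻ v, f √v = ∫⁻ r in Ioi (0 : ℝ), ENNReal.ofReal (2 * r) * f r := by
  have h1 : ∫⁻ v, f √v = ∫⁻ v in Ioi (0 : ℝ), f √v := by
    rw [← lintegral_indicator measurableSet_Ioi]
    refine lintegral_congr fun v => ?_
    by_cases hv : 0 < v
    · rw [indicator_of_mem (show v ∈ Ioi 0 from hv)]
    · rw [indicator_of_notMem (show v ∉ Ioi 0 from hv), Real.sqrt_eq_zero'.2 (not_lt.1 hv), hf]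
  have h2 : (fun r : ℝ => r ^ 2) '' Ioi 0 = Ioi 0 := by
    ext v
    constructor
    · rintro ⟨r, hr : 0 < r, rfl⟩
      exact pow_pos hr 2
    · intro (hv : 0 < v)
      exact ⟨√v, Real.sqrt_pos.2 hv, Real.sq_sqrt hv.le⟩
  have h3 := lintegral_image_eq_lintegral_abs_deriv_mul (s := Ioi (0 : ℝ))
    (f := fun r => r ^ 2) (f' := fun r => 2 * r) measurableSet_Ioi
    (fun r _ => by simpa using (hasDerivAt_pow 2 r).hasDerivWithinAt)
    (fun a (ha : 0 < a) b (hb : 0 < b) h => (pow_left_inj₀ ha.le hb.le two_ne_zero).1 h)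
    (fun v => f √v)
  rw [h1, ← h2, h3, h2]
  refine setLIntegral_congr_fun measurableSet_Ioi fun r (hr : 0 < r) => ?_
  simp only [Real.sqrt_sq hr.le, abs_of_pos (by positivity : 0 < 2 * r)]

/-- A bump function in `(r, t)`, away from the axis, is a smooth function of `(r², t)`. -/
lemma contDiff_comp_sqrt {ρ : ℝ × ℝ → ℝ} (hρ : ContDiff ℝ ∞ ρ) {a : ℝ} (ha : 0 < a)
    (hs : ∀ q, ρ q ≠ 0 → a ≤ q.1) :
    ContDiff ℝ ∞ fun z : ℝ × ℝ => (ρ (√z.1, z.2) : ℂ) := by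
  rw [contDiff_iff_contDiffAt]
  intro z
  by_cases hz : 0 < z.1
  · have h1 : ContDiffAt ℝ ∞ (fun z : ℝ × ℝ => √z.1) z :=
      (Real.contDiffAt_sqrt hz.ne').comp z contDiffAt_fst
    have h2 : ContDiffAt ℝ ∞ (fun z : ℝ × ℝ => ρ (√z.1, z.2)) z :=
      hρ.contDiffAt.comp z (h1.prodMk contDiffAt_snd)
    exact Complex.ofRealCLM.contDiff.contDiffAt.comp z h2
  · have hU : {z : ℝ × ℝ | z.1 < a ^ 2} ∈ nhds z :=
      (isOpen_lt continuous_fst continuous_const).mem_nhds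
        ((not_lt.1 hz).trans_lt (by positivity))
    refine (contDiffAt_const (c := (0 : ℂ))).congr_of_eventuallyEq ?_
    filter_upwards [hU] with y hy
    by_contra hne
    have h1 : ρ (√y.1, y.2) ≠ 0 := fun h => hne (by rw [h, Complex.ofReal_zero])
    have h2 : a ≤ √y.1 := hs _ h1
    have h3 : a ^ 2 ≤ y.1 := by
      have h4 : 0 < √y.1 := ha.trans_le h2
      calc a ^ 2 ≤ √y.1 ^ 2 := by gcongr
        _ = y.1 := Real.sq_sqrt (Real.sqrt_pos.1 h4).le
    exact absurd hy (not_lt.2 h3)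

/-- A radial solution is bounded, outside the light cone and for positive times, by the amplitude
of the wave: the pairing bound is tested with bump functions and differentiated. -/
theorem exists_pointwise_bound_forward (n : ℕ) : ∃ C : ℝ, 0 < C ∧
    ∀ {u F : Space (2 * n + 3) × ℝ → ℂ} {u₀ u₁ : 𝓢'(Space (2 * n + 3), ℂ)}
    {g₀ g₁ : Space (2 * n + 3) → ℂ}, IsRadial u → LocallyIntegrable u →
    LocallyIntegrable F → HasFourierDensity u₀ g₀ → HasFourierDensity u₁ g₁ →
    (∀ φ : TestFun (2 * n + 3),
      ∫ z in {z : Space (2 * n + 3) × ℝ | 0 < z.2}, u z * TestFun.box φ z =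
      (∫ z in {z : Space (2 * n + 3) × ℝ | 0 < z.2}, F z * φ z)
        + u₁ (TestFun.initial φ) - u₀ (TestFun.initialDt φ)) →
    ∀ᵐ z : Space (2 * n + 3) × ℝ, 0 < z.2 → z.2 < ‖z.1‖ →
      ‖u z‖ₑ ≤ ENNReal.ofReal (C * ‖z.1‖⁻¹ ^ (n + 1)) * amplitude n g₀ g₁ F (2 * ‖z.1‖) := by
  obtain ⟨C, hC, hpair⟩ := exists_pairing_bound n
  set κ : ℝ := (volume : Measure (Space (2 * n + 3))).toSphere.real univ with hκdef
  have hκ : 0 < κ := by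
    have h1 : (volume : Measure (Space (2 * n + 3))).toSphere univ ≠ 0 := by
      rw [Ne, Measure.measure_univ_eq_zero]
      exact (volume : Measure (Space (2 * n + 3))).toSphere_ne_zero
    exact ENNReal.toReal_pos h1 (measure_ne_top _ _)
  refine ⟨κ⁻¹ * (C * 2 ^ n * 4), by positivity, ?_⟩
  intro u F u₀ u₁ g₀ g₁ hrad hu hF h₀ h₁ hwave
  -- bump functions with radii tending to zero, for Lebesgue's differentiation theorem
  let B : ℕ → ContDiffBump (0 : ℝ × ℝ) := fun i =>
    ⟨1 / ((i : ℝ) + 1) / 2, 1 / ((i : ℝ) + 1), by positivity, half_lt_self (by positivity)⟩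
  have hB0 : Filter.Tendsto (fun i => (B i).rOut) Filter.atTop (nhds 0) :=
    tendsto_one_div_add_atTop_nhds_zero_nat
  have hlim := ContDiffBump.ae_convolution_tendsto_right_of_locallyIntegrable (K := 2) hB0
    (Filter.Eventually.of_forall fun i => by
      show 1 / ((i : ℝ) + 1) ≤ 2 * (1 / ((i : ℝ) + 1) / 2)
      linarith) (locallyIntegrable_weightedProfile hrad hu)
  have hprof : ∀ᵐ q : ℝ × ℝ, 0 < q.2 → q.2 < q.1 → ‖profile n u q‖ₑ ≤
      ENNReal.ofReal (κ⁻¹ * (C * 2 ^ n * 4) * q.1⁻¹ ^ (n + 1)) *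
        amplitude n g₀ g₁ F (2 * q.1) := by
    filter_upwards [hlim] with q hq ht hr
    have hr0 : 0 < q.1 := ht.trans hr
    set δ₀ : ℝ := min (q.2 / 2) ((q.1 - q.2) / 4) with hδ₀
    have hδ₀pos : 0 < δ₀ := lt_min (by linarith) (by linarith)
    have hδ1 : δ₀ ≤ q.2 / 2 := min_le_left _ _
    have hδ2 : δ₀ ≤ (q.1 - q.2) / 4 := min_le_right _ _
    -- the bound for every sufficiently concentrated bump
    have hbound : ∀ᶠ i in Filter.atTop,
        ‖convolution ((B i).normed volume) (weightedProfile n u)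
          (ContinuousLinearMap.lsmul ℝ ℝ) volume q‖ₑ ≤
        ENNReal.ofReal (κ⁻¹ * (C * ((2 * q.1) ^ n * (4 * q.1)))) *
          amplitude n g₀ g₁ F (2 * q.1) := by
      filter_upwards [hB0.eventually (gt_mem_nhds hδ₀pos)] with i hi
      set ρ : ℝ × ℝ → ℝ := fun y => (B i).normed volume (q - y) with hρ
      have hρs : ContDiff ℝ ∞ ρ := (B i).contDiff_normed.comp (contDiff_const.sub contDiff_id)
      have hρ0 : ∀ y, 0 ≤ ρ y := fun y => (B i).nonneg_normed _
      have hsupp : ∀ y, ρ y ≠ 0 → |q.1 - y.1| < δ₀ ∧ |q.2 - y.2| < δ₀ := by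
        intro y hy
        have h1 : q - y ∈ Function.support ((B i).normed volume) := hy
        rw [ContDiffBump.support_normed_eq, mem_ball_zero_iff, Prod.norm_def, max_lt_iff] at h1
        exact ⟨h1.1.trans hi, h1.2.trans hi⟩
      have hint1 : ∫⁻ y, ‖ρ y‖ₑ = 1 := by
        have h1 : ∫⁻ y, ‖ρ y‖ₑ = ∫⁻ y, ‖(B i).normed volume y‖ₑ :=
          lintegral_sub_left_eq_self (fun y => ‖(B i).normed volume y‖ₑ) q
        have h2 : ∀ y, ‖(B i).normed volume y‖ₑ = ENNReal.ofReal ((B i).normed volume y) :=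
          fun y => Real.enorm_of_nonneg ((B i).nonneg_normed _)
        rw [h1]
        simp only [h2]
        rw [← ofReal_integral_eq_lintegral_ofReal (B i).integrable_normed
          (Filter.Eventually.of_forall (B i).nonneg_normed), (B i).integral_normed,
          ENNReal.ofReal_one]
      have hconv : convolution ((B i).normed volume) (weightedProfile n u)
          (ContinuousLinearMap.lsmul ℝ ℝ) volume q = ∫ y, ρ y • weightedProfile n u y := by
        rw [convolution, ← integral_sub_left_eq_self _ volume q]
        simp [hρ]
      -- the test function in the variables `(r², t)`
      set ψ : ℝ × ℝ → ℂ := fun z => (ρ (√z.1, z.2) : ℂ) with hψ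
      have hne : ∀ z, ψ z ≠ 0 → ρ (√z.1, z.2) ≠ 0 := fun z hz h => hz (by simp [hψ, h])
      have hψs : ContDiff ℝ ∞ ψ := contDiff_comp_sqrt hρs (a := q.1 / 2) (by linarith) fun y hy => by
        have := (abs_lt.1 (hsupp y hy).1).2
        linarith
      have hψc : HasCompactSupport ψ := by
        refine HasCompactSupport.intro ((isCompact_Icc (a := (0 : ℝ)) (b := (2 * q.1) ^ 2)).prod
          (isCompact_Icc (a := (0 : ℝ)) (b := 2 * q.2))) fun z hz => ?_
        by_contra hz0
        obtain ⟨h1, h2⟩ := hsupp _ (hne z hz0)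
        have h1' := abs_lt.1 h1
        have h2' := abs_lt.1 h2
        simp only at h1' h2'
        have h3 : 0 < √z.1 := by linarith [h1'.2]
        have h4 : 0 < z.1 := Real.sqrt_pos.1 h3
        have h5 : √z.1 ≤ 2 * q.1 := by linarith [h1'.1]
        refine hz ⟨⟨h4.le, ?_⟩, ⟨by linarith [h2'.2], by linarith [h2'.1]⟩⟩
        exact (Real.sqrt_le_left (by linarith)).1 h5
      have hS : SupportedOutside ψ ((q.1 - q.2) / 2) (2 * q.1) (2 * q.2) := by
        refine ⟨fun v t hz => ?_, fun v t hz => ?_, fun v t hz => ?_, fun v t hz => ?_⟩ <;>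
        · obtain ⟨h1, h2⟩ := hsupp _ (hne _ hz)
          have h1' := abs_lt.1 h1
          have h2' := abs_lt.1 h2
          simp only at h1' h2'
          linarith [h1'.1, h1'.2, h2'.1, h2'.2]
      have hmain := hpair (2 * n + 3) rfl hF h₀ h₁ hwave hψs hψc (by linarith) hS
      have hL : ∫ z in {z : Space (2 * n + 3) × ℝ | 0 < z.2}, u z * ψ (‖z.1‖ ^ 2, z.2)
          = κ • ∫ y, ρ y • weightedProfile n u y := by
        rw [← setIntegral_mul_radial hrad hu hρs.continuous]
        simp only [hψ, Real.sqrt_sq (norm_nonneg _)]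
      have hR : ∫⁻ t, ∫⁻ v, ENNReal.ofReal (√v ^ n) * ‖ψ (v, t)‖ₑ * amplitude n g₀ g₁ F √v
          ≤ ENNReal.ofReal ((2 * q.1) ^ n * (4 * q.1)) * amplitude n g₀ g₁ F (2 * q.1) := by
        have h1 : ∀ t, ∫⁻ v, ENNReal.ofReal (√v ^ n) * ‖ψ (v, t)‖ₑ * amplitude n g₀ g₁ F √v
            ≤ ENNReal.ofReal ((2 * q.1) ^ n * (4 * q.1)) * amplitude n g₀ g₁ F (2 * q.1) *
              ∫⁻ r, ‖ρ (r, t)‖ₑ := by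
          intro t
          have hz : ∀ r, ¬ (r ≤ 2 * q.1 ∧ 0 < r) → ρ (r, t) = 0 := by
            intro r hr'
            by_contra hne
            have h1' := abs_lt.1 (hsupp _ hne).1
            simp only at h1'
            exact hr' ⟨by linarith [h1'.1], by linarith [h1'.2]⟩
          have e1 : ∀ v, ENNReal.ofReal (√v ^ n) * ‖ψ (v, t)‖ₑ * amplitude n g₀ g₁ F √v
              = (fun r => ENNReal.ofReal (r ^ n) * ‖ρ (r, t)‖ₑ * amplitude n g₀ g₁ F r) √v := by
            intro v
            simp only [hψ]
            rw [← ofReal_norm, Complex.norm_real, ofReal_norm]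
          simp only [e1]
          rw [lintegral_comp_sqrt (f := fun r => ENNReal.ofReal (r ^ n) * ‖ρ (r, t)‖ₑ *
            amplitude n g₀ g₁ F r) (by rw [hz 0 (by simp)]; simp)]
          have hmr : Measurable fun r => ‖ρ (r, t)‖ₑ := by
            have := hρs.continuous.measurable
            fun_prop
          rw [← lintegral_const_mul _ hmr]
          refine (setLIntegral_le_lintegral _ _).trans (lintegral_mono fun r => ?_)
          by_cases hr' : r ≤ 2 * q.1 ∧ 0 < r
          · calc ENNReal.ofReal (2 * r) * (ENNReal.ofReal (r ^ n) * ‖ρ (r, t)‖ₑ *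
                  amplitude n g₀ g₁ F r)
                ≤ ENNReal.ofReal (4 * q.1) * (ENNReal.ofReal ((2 * q.1) ^ n) * ‖ρ (r, t)‖ₑ *
                  amplitude n g₀ g₁ F (2 * q.1)) := by
                  refine mul_le_mul' (ENNReal.ofReal_le_ofReal (by linarith [hr'.1]))
                    (mul_le_mul' (mul_le_mul' (ENNReal.ofReal_le_ofReal
                      (pow_le_pow_left₀ hr'.2.le hr'.1 n)) le_rfl)
                      (amplitude_mono n g₀ g₁ F hr'.1))
              _ = _ := by
                rw [ENNReal.ofReal_mul (p := (2 * q.1) ^ n) (by positivity)]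
                ring
          · rw [hz r hr']
            simp
        refine (lintegral_mono h1).trans (le_of_eq ?_)
        have hm : Measurable fun t => ∫⁻ r, ‖ρ (r, t)‖ₑ := by
          have := hρs.continuous.measurable
          exact Measurable.lintegral_prod_right' (f := fun p : ℝ × ℝ => ‖ρ (p.2, p.1)‖ₑ)
            (by fun_prop)
        have h2 : ∫⁻ t, ∫⁻ r, ‖ρ (r, t)‖ₑ = 1 := by
          rw [← hint1, Measure.volume_eq_prod, lintegral_prod_symm]
          have := hρs.continuous.measurable
          fun_prop
        rw [lintegral_const_mul _ hm, h2, mul_one]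
      rw [hL, enorm_smul, Real.enorm_of_nonneg hκ.le] at hmain
      rw [hconv]
      calc ‖∫ y, ρ y • weightedProfile n u y‖ₑ
          = ENNReal.ofReal κ⁻¹ * (ENNReal.ofReal κ * ‖∫ y, ρ y • weightedProfile n u y‖ₑ) := by
            rw [← mul_assoc, ← ENNReal.ofReal_mul (by positivity), inv_mul_cancel₀ hκ.ne',
              ENNReal.ofReal_one, one_mul]
        _ ≤ ENNReal.ofReal κ⁻¹ * (ENNReal.ofReal C * (ENNReal.ofReal ((2 * q.1) ^ n * (4 * q.1)) *
              amplitude n g₀ g₁ F (2 * q.1))) :=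
            mul_le_mul_right (hmain.trans (mul_le_mul_right hR _)) _
        _ = _ := by
            rw [ENNReal.ofReal_mul (p := κ⁻¹) (by positivity), ENNReal.ofReal_mul hC.le]
            ring
    have hlim2 := le_of_tendsto (hq.enorm) hbound
    rw [weightedProfile, indicator_of_mem (show q ∈ Ioi (0 : ℝ) ×ˢ Ioi (0 : ℝ) from ⟨hr0, ht⟩),
      enorm_smul, Real.enorm_of_nonneg (by positivity)] at hlim2
    calc ‖profile n u q‖ₑ = ENNReal.ofReal (q.1⁻¹ ^ (2 * n + 2)) *
          (ENNReal.ofReal (q.1 ^ (2 * n + 2)) * ‖profile n u q‖ₑ) := by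
          rw [← mul_assoc, ← ENNReal.ofReal_mul (by positivity), ← mul_pow,
            inv_mul_cancel₀ hr0.ne', one_pow, ENNReal.ofReal_one, one_mul]
      _ ≤ _ := mul_le_mul_right hlim2 _
      _ = _ := by
          rw [← mul_assoc, ← ENNReal.ofReal_mul (by positivity)]
          congr 2
          rw [mul_pow, inv_pow, inv_pow]
          field_simp
          ring
  filter_upwards [ae_radial (2 * n + 3) hprof] with z hz h1 h2
  have := hz h1 h2
  rwa [hrad.eq_profile] at this

/-- The reflection `t ↦ -t` of a test function. -/
def reflectTest (φ : TestFun d) : TestFun d where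
  toFun z := φ (z.1, -z.2)
  contDiff' := φ.contDiff.comp (contDiff_fst.prodMk contDiff_snd.neg)
  hasCompactSupport' := φ.hasCompactSupport.comp_homeomorph
    ((Homeomorph.refl (Space d)).prodCongr (Homeomorph.neg ℝ))
  tsupport_subset' _ _ := trivial

lemma reflectTest_apply (φ : TestFun d) (x : Space d) (t : ℝ) :
    reflectTest φ (x, t) = φ (x, -t) := rfl

lemma box_reflectTest (φ : TestFun d) (x : Space d) (t : ℝ) :
    TestFun.box (reflectTest φ) (x, t) = TestFun.box φ (x, -t) := by
  simp only [TestFun.box, reflectTest_apply]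
  rw [iteratedDeriv_comp_neg 2 (fun s => φ (x, s))]
  simp

lemma initial_reflectTest (φ : TestFun d) :
    TestFun.initial (reflectTest φ) = TestFun.initial φ := by
  ext x
  show reflectTest φ (x, 0) = φ (x, 0)
  rw [reflectTest_apply, neg_zero]

lemma initialDt_reflectTest (φ : TestFun d) :
    TestFun.initialDt (reflectTest φ) = -TestFun.initialDt φ := by
  ext x
  show TestFun.dt (reflectTest φ) (x, 0) = -TestFun.dt φ (x, 0)
  simp only [TestFun.dt_eq_deriv, reflectTest_apply]
  rw [deriv_comp_neg (fun s => φ (x, s)), neg_zero]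

lemma measurePreserving_reflect (d : ℕ) :
    MeasurePreserving (fun z : Space d × ℝ => (z.1, -z.2)) :=
  (MeasurePreserving.id (volume : Measure (Space d))).prod
    (Measure.measurePreserving_neg (volume : Measure ℝ))

lemma measurableEmbedding_reflect (d : ℕ) :
    MeasurableEmbedding (fun z : Space d × ℝ => (z.1, -z.2)) :=
  ((Homeomorph.refl (Space d)).prodCongr (Homeomorph.neg ℝ)).measurableEmbedding

lemma locallyIntegrable_reflect {f : Space d × ℝ → ℂ} (hf : LocallyIntegrable f) :
    LocallyIntegrable fun z : Space d × ℝ => f (z.1, -z.2) := by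
  rw [locallyIntegrable_iff] at hf ⊢
  intro K hK
  have h1 := hf ((fun z : Space d × ℝ => (z.1, -z.2)) '' K) (hK.image (by fun_prop))
  have h2 := ((measurePreserving_reflect d).integrableOn_image (measurableEmbedding_reflect d)).1 h1
  exact h2

lemma setIntegral_reflect (f : Space d × ℝ → ℂ) :
    ∫ z in {z : Space d × ℝ | 0 < z.2}, f (z.1, -z.2) = ∫ z in {z : Space d × ℝ | z.2 < 0}, f z := by
  have := (measurePreserving_reflect d).setIntegral_preimage_emb (measurableEmbedding_reflect d) f
    {z : Space d × ℝ | z.2 < 0}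
  rw [← this]
  simp

lemma sourceWeight_reflect (n : ℕ) (F : Space d × ℝ → ℂ) (R : ℝ) :
    sourceWeight n (fun z => F (z.1, -z.2)) R = sourceWeight n F R := by
  have := (measurePreserving_reflect d).setLIntegral_comp_preimage_emb
    (measurableEmbedding_reflect d) (fun z => ENNReal.ofReal (‖z.1‖⁻¹ ^ (n + 1)) * ‖F z‖ₑ)
    (sourceRegion d R)
  rw [sourceWeight, sourceWeight, ← this]
  simp [sourceRegion]

lemma HasFourierDensity.neg {f : 𝓢'(Space d, ℂ)} {g : Space d → ℂ} (h : HasFourierDensity f g) :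
    HasFourierDensity (-f) (-g) := by
  refine ⟨h.1.neg, fun φ => ?_⟩
  obtain ⟨h1, h2⟩ := h.2 φ
  refine ⟨by simpa using h1.neg, ?_⟩
  rw [FourierTransform.fourier_neg]
  simp only [Pi.neg_apply, mul_neg, integral_neg, ← h2]
  rfl

/-- A radial solution is bounded outside the light cone by the amplitude of the wave. Time
reversal reduces negative times to positive ones. -/
theorem exists_pointwise_bound (n : ℕ) : ∃ C : ℝ, 0 < C ∧
    ∀ {u F : Space (2 * n + 3) × ℝ → ℂ} {u₀ u₁ : 𝓢'(Space (2 * n + 3), ℂ)}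
    {g₀ g₁ : Space (2 * n + 3) → ℂ}, IsRadial u → IsWaveSolution u F u₀ u₁ →
    HasFourierDensity u₀ g₀ → HasFourierDensity u₁ g₁ →
    ∀ᵐ z : Space (2 * n + 3) × ℝ, |z.2| < ‖z.1‖ →
      ‖u z‖ₑ ≤ ENNReal.ofReal (C * ‖z.1‖⁻¹ ^ (n + 1)) * amplitude n g₀ g₁ F (2 * ‖z.1‖) := by
  obtain ⟨C, hC, h⟩ := exists_pointwise_bound_forward n
  refine ⟨C, hC, ?_⟩
  intro u F u₀ u₁ g₀ g₁ hrad hu h₀ h₁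
  have hf := h hrad hu.locallyIntegrable hu.locallyIntegrable_source h₀ h₁ hu.forward
  have hb := h (u := fun z => u (z.1, -z.2)) (F := fun z => F (z.1, -z.2)) (u₀ := u₀) (u₁ := -u₁)
    (g₀ := g₀) (g₁ := -g₁) (fun x y t hxy => hrad x y (-t) hxy)
    (locallyIntegrable_reflect hu.locallyIntegrable)
    (locallyIntegrable_reflect hu.locallyIntegrable_source) h₀ h₁.neg (fun φ => by
      have h1 := hu.backward (reflectTest φ)
      have e1 : ∫ z in {z : Space (2 * n + 3) × ℝ | 0 < z.2}, u (z.1, -z.2) * TestFun.box φ z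
          = ∫ z in {z : Space (2 * n + 3) × ℝ | z.2 < 0},
            u z * TestFun.box (reflectTest φ) z := by
        rw [← setIntegral_reflect]
        simp only [box_reflectTest, neg_neg]
      have e2 : ∫ z in {z : Space (2 * n + 3) × ℝ | 0 < z.2}, F (z.1, -z.2) * φ z
          = ∫ z in {z : Space (2 * n + 3) × ℝ | z.2 < 0}, F z * reflectTest φ z := by
        rw [← setIntegral_reflect]
        simp only [reflectTest_apply, neg_neg]
      rw [e1, e2, h1, initial_reflectTest, initialDt_reflectTest, map_neg,
        _root_.neg_apply]
      ring)
  have hz : ∀ᵐ z : Space (2 * n + 3) × ℝ, z.2 ≠ 0 := by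
    have h1 : ∀ᵐ t : ℝ, t ≠ 0 := by simp [ae_iff]
    exact Measure.quasiMeasurePreserving_snd.ae h1
  have hb' := (measurePreserving_reflect (2 * n + 3)).quasiMeasurePreserving.ae hb
  have hamp : amplitude n g₀ (-g₁) (fun z => F (z.1, -z.2)) = amplitude n g₀ g₁ F := by
    ext R
    simp only [amplitude, sourceWeight_reflect, dataWeight, Pi.neg_apply, enorm_neg]
  filter_upwards [hf, hb', hz] with z h1 h2 h3 h4
  rcases lt_or_gt_of_ne h3 with h5 | h5
  · rw [abs_of_neg h5] at h4
    have := h2 (by simpa using h5) h4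
    simpa [hamp] using this
  · rw [abs_of_pos h5] at h4
    exact h1 h5 h4

end

/-! ### Square-summable sequences and geometric kernels -/

/-- The `ℓ²` norm of a sequence of extended nonnegative numbers. -/
def ell2 (h : ℤ → ℝ≥0∞) : ℝ≥0∞ := (∑' k, h k ^ (2 : ℝ)) ^ (1 / 2 : ℝ)

lemma ell2_mono {h h' : ℤ → ℝ≥0∞} (hle : ∀ k, h k ≤ h' k) : ell2 h ≤ ell2 h' := by
  unfold ell2
  gcongr with k
  exact hle k

lemma ell2_const_mul (c : ℝ≥0∞) (h : ℤ → ℝ≥0∞) : ell2 (fun k => c * h k) = c * ell2 h := by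
  unfold ell2
  simp only [ENNReal.mul_rpow_of_nonneg _ _ (by norm_num : (0 : ℝ) ≤ 2)]
  rw [ENNReal.tsum_mul_left, ENNReal.mul_rpow_of_nonneg _ _ (by norm_num), ← ENNReal.rpow_mul]
  norm_num

lemma ell2_add_le (h h' : ℤ → ℝ≥0∞) : ell2 (fun k => h k + h' k) ≤ ell2 h + ell2 h' := by
  have := ENNReal.lintegral_Lp_add_le (μ := Measure.count) (f := h) (g := h')
    (measurable_of_countable h).aemeasurable (measurable_of_countable h').aemeasurable
    (p := 2) (by norm_num)
  simpa only [lintegral_count, ell2, Pi.add_apply] using this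

/-- Schur's test. -/
lemma ell2_schur {K : ℤ → ℤ → ℝ≥0∞} {A : ℝ≥0∞} (h1 : ∀ l, ∑' k, K l k ≤ A)
    (h2 : ∀ k, ∑' l, K l k ≤ A) (h : ℤ → ℝ≥0∞) :
    ell2 (fun l => ∑' k, K l k * h k) ≤ A * ell2 h := by
  have key : ∀ l, (∑' k, K l k * h k) ^ (2 : ℝ) ≤ A * ∑' k, K l k * h k ^ (2 : ℝ) := by
    intro l
    have hold := ENNReal.lintegral_mul_le_Lp_mul_Lq (μ := Measure.count)
      (Real.HolderConjugate.two_two) (f := fun k => K l k ^ (1 / 2 : ℝ))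
      (g := fun k => K l k ^ (1 / 2 : ℝ) * h k)
      (measurable_of_countable _).aemeasurable (measurable_of_countable _).aemeasurable
    simp only [lintegral_count, Pi.mul_apply] at hold
    have e0 : ∀ x : ℝ≥0∞, x ^ (1 / 2 : ℝ) * x ^ (1 / 2 : ℝ) = x := fun x => by
      rw [← ENNReal.rpow_add_of_nonneg _ _ (by norm_num) (by norm_num)]
      norm_num
    have e1 : ∀ x : ℝ≥0∞, (x ^ (1 / 2 : ℝ)) ^ (2 : ℝ) = x := fun x => by
      rw [← ENNReal.rpow_mul]; norm_num
    simp only [← mul_assoc, e0, ENNReal.mul_rpow_of_nonneg _ _ (by norm_num : (0 : ℝ) ≤ 2),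
      e1] at hold
    calc (∑' k, K l k * h k) ^ (2 : ℝ)
        ≤ ((∑' k, K l k) ^ (1 / 2 : ℝ) * (∑' k, K l k * h k ^ (2 : ℝ)) ^ (1 / 2 : ℝ)) ^ (2 : ℝ) := by
          gcongr
      _ = (∑' k, K l k) * ∑' k, K l k * h k ^ (2 : ℝ) := by
          rw [ENNReal.mul_rpow_of_nonneg _ _ (by norm_num), e1, e1]
      _ ≤ _ := by gcongr; exact h1 l
  have hA : A * ell2 h = (A ^ (2 : ℝ) * ∑' k, h k ^ (2 : ℝ)) ^ (1 / 2 : ℝ) := by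
    rw [ENNReal.mul_rpow_of_nonneg _ _ (by norm_num), ← ENNReal.rpow_mul, ell2]
    norm_num
  rw [hA, ell2]
  gcongr
  calc ∑' l, (∑' k, K l k * h k) ^ (2 : ℝ)
      ≤ ∑' l, A * ∑' k, K l k * h k ^ (2 : ℝ) := ENNReal.tsum_le_tsum key
    _ = A * ∑' k, (∑' l, K l k) * h k ^ (2 : ℝ) := by
        rw [ENNReal.tsum_mul_left, ENNReal.tsum_comm]
        simp only [ENNReal.tsum_mul_right]
    _ ≤ A * ∑' k, A * h k ^ (2 : ℝ) := by
        gcongr with k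
        exact h2 k
    _ = _ := by
        rw [ENNReal.tsum_mul_left, ← mul_assoc]
        congr 1
        rw [show (2 : ℝ) = 1 + 1 by norm_num, ENNReal.rpow_add_of_nonneg _ _ (by norm_num)
          (by norm_num), ENNReal.rpow_one]

/-- The one-sided geometric kernel `2^(-a(l-k))` on `k ≤ l + c`. -/
def geomKernel (a : ℝ) (c : ℤ) (l k : ℤ) : ℝ≥0∞ :=
  if k ≤ l + c then (2 : ℝ≥0∞) ^ (-a * ((l : ℝ) - k)) else 0

/-- The total mass of the geometric kernel. -/
def geomMass (a : ℝ) (c : ℤ) : ℝ≥0∞ := ∑' i : ℕ, (2 : ℝ≥0∞) ^ (-a * ((i : ℝ) - c))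

lemma geomMass_ne_top {a : ℝ} (ha : 0 < a) (c : ℤ) : geomMass a c ≠ ⊤ := by
  have h1 : ∀ i : ℕ, (2 : ℝ≥0∞) ^ (-a * ((i : ℝ) - c))
      = (2 : ℝ≥0∞) ^ (a * c) * ((2 : ℝ≥0∞) ^ (-a)) ^ i := by
    intro i
    rw [← ENNReal.rpow_natCast, ← ENNReal.rpow_mul, ← ENNReal.rpow_add _ _ (by simp) (by simp)]
    congr 1
    ring
  have h2 : (2 : ℝ≥0∞) ^ (-a) < 1 := by
    rw [← ENNReal.rpow_zero (x := 2)]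
    exact ENNReal.rpow_lt_rpow_of_exponent_lt (by norm_num) (by simp) (by linarith)
  unfold geomMass
  simp only [h1]
  rw [ENNReal.tsum_mul_left, ENNReal.tsum_geometric]
  refine ENNReal.mul_ne_top (ENNReal.rpow_ne_top_of_ne_zero (by simp) (by simp)) ?_
  rw [ENNReal.inv_ne_top]
  exact (tsub_pos_of_lt h2).ne'

lemma tsum_geomKernel_right (a : ℝ) (c : ℤ) (l : ℤ) :
    ∑' k, geomKernel a c l k = geomMass a c := by
  have hinj : Function.Injective fun i : ℕ => l + c - (i : ℤ) := fun i j h => by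
    simp only at h; omega
  rw [geomMass, ← hinj.tsum_eq]
  · refine tsum_congr fun i => ?_
    rw [geomKernel, if_pos (by omega)]
    congr 1
    push_cast
    ring
  · intro k hk
    have : k ≤ l + c := by
      by_contra h
      exact hk (if_neg h)
    exact ⟨(l + c - k).toNat, by simp only; omega⟩

lemma tsum_geomKernel_left (a : ℝ) (c : ℤ) (k : ℤ) :
    ∑' l, geomKernel a c l k = geomMass a c := by
  have hinj : Function.Injective fun i : ℕ => k - c + (i : ℤ) := fun i j h => by
    simp only at h; omega
  rw [geomMass, ← hinj.tsum_eq]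
  · refine tsum_congr fun i => ?_
    rw [geomKernel, if_pos (by omega)]
    congr 1
    push_cast
    ring
  · intro l hl
    have : k ≤ l + c := by
      by_contra h
      exact hl (if_neg h)
    exact ⟨(l - k + c).toNat, by simp only; omega⟩

lemma ell2_geomKernel_le (a : ℝ) (c : ℤ) (h : ℤ → ℝ≥0∞) :
    ell2 (fun l => ∑' k, geomKernel a c l k * h k) ≤ geomMass a c * ell2 h :=
  ell2_schur (fun l => (tsum_geomKernel_right a c l).le)
    (fun k => (tsum_geomKernel_left a c k).le) h

lemma ell2_geomKernel_swap_le (a : ℝ) (c : ℤ) (h : ℤ → ℝ≥0∞) :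
    ell2 (fun k => ∑' l, geomKernel a c l k * h l) ≤ geomMass a c * ell2 h :=
  ell2_schur (K := fun k l => geomKernel a c l k) (fun k => (tsum_geomKernel_left a c k).le)
    (fun l => (tsum_geomKernel_right a c l).le) h

lemma tsum_rpow_le_rpow_tsum {ι : Type*} (h : ι → ℝ≥0∞) {p : ℝ} (hp : 1 ≤ p) :
    ∑' k, h k ^ p ≤ (∑' k, h k) ^ p := by
  have e : ∀ x : ℝ≥0∞, x ^ p = x * x ^ (p - 1) := fun x => by
    conv_lhs => rw [show p = 1 + (p - 1) by ring]
    rw [ENNReal.rpow_add_of_nonneg _ _ (by norm_num) (by linarith), ENNReal.rpow_one]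
  calc ∑' k, h k ^ p ≤ ∑' k, h k * (∑' k, h k) ^ (p - 1) := by
        refine ENNReal.tsum_le_tsum fun k => ?_
        rw [e]
        exact mul_le_mul_right (ENNReal.rpow_le_rpow (ENNReal.le_tsum k) (by linarith)) _
    _ = _ := by rw [ENNReal.tsum_mul_right, ← e]

/-! ### Dyadic decompositions and shells -/

lemma two_rpow_mul (x y : ℝ) :
    (2 : ℝ≥0∞) ^ x * (2 : ℝ≥0∞) ^ y = (2 : ℝ≥0∞) ^ (x + y) :=
  (ENNReal.rpow_add _ _ (by simp) (by simp)).symm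

lemma two_rpow_ne_top (x : ℝ) : (2 : ℝ≥0∞) ^ x ≠ ⊤ :=
  ENNReal.rpow_ne_top_of_ne_zero (by simp) (by simp)

lemma two_zpow_eq_rpow (l : ℤ) : ENNReal.ofReal ((2 : ℝ) ^ l) = (2 : ℝ≥0∞) ^ (l : ℝ) := by
  rw [← Real.rpow_intCast, ← ENNReal.ofReal_rpow_of_pos two_pos]
  simp

/-- The set where `2^l ≤ r < 2^(l+1)`. -/
def dyadicSet {α : Type*} (r : α → ℝ) (l : ℤ) : Set α :=
  {x | (2 : ℝ) ^ l ≤ r x ∧ r x < (2 : ℝ) ^ (l + 1)}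

lemma measurableSet_dyadicSet {α : Type*} [MeasurableSpace α] {r : α → ℝ} (hr : Measurable r)
    (l : ℤ) : MeasurableSet (dyadicSet r l) := by
  have h1 : MeasurableSet {x | (2 : ℝ) ^ l ≤ r x} := measurableSet_le measurable_const hr
  have h2 : MeasurableSet {x | r x < (2 : ℝ) ^ (l + 1)} := measurableSet_lt hr measurable_const
  exact h1.inter h2

lemma lintegral_eq_tsum_dyadic {α : Type*} [MeasurableSpace α] {μ : Measure α} {r : α → ℝ}
    (hr : Measurable r) (hpos : ∀ᵐ x ∂μ, 0 < r x) (f : α → ℝ≥0∞) :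
    ∫⁻ x, f x ∂μ = ∑' l : ℤ, ∫⁻ x in dyadicSet r l, f x ∂μ := by
  have hu : ⋃ l : ℤ, dyadicSet r l = {x | 0 < r x} := by
    ext x
    simp only [mem_iUnion]
    constructor
    · rintro ⟨l, h1, _⟩
      exact lt_of_lt_of_le (by positivity) h1
    · intro hx
      obtain ⟨l, h1, h2⟩ := exists_mem_Ico_zpow (y := (2 : ℝ)) hx one_lt_two
      exact ⟨l, h1, h2⟩
  have hd : Pairwise (Function.onFun Disjoint (dyadicSet r)) := by
    intro k l hkl
    rw [Function.onFun, Set.disjoint_left]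
    intro x hx hx'
    apply hkl
    have h1 : (2 : ℝ) ^ k < 2 ^ (l + 1) := hx.1.trans_lt hx'.2
    have h2 : (2 : ℝ) ^ l < 2 ^ (k + 1) := hx'.1.trans_lt hx.2
    rw [zpow_lt_zpow_iff_right₀ one_lt_two] at h1 h2
    omega
  rw [← lintegral_iUnion (measurableSet_dyadicSet hr) hd, hu]
  have : {x | 0 < r x} =ᵐ[μ] univ := by
    filter_upwards [hpos] with x hx
    exact propext ⟨fun _ => trivial, fun _ => hx⟩
  rw [Measure.restrict_congr_set this, Measure.restrict_univ]

/-- Hölder's inequality on a set of finite measure. -/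
lemma setLIntegral_le_rpow_mul {α : Type*} [MeasurableSpace α] {μ : Measure α} {f : α → ℝ≥0∞}
    (hf : AEMeasurable f μ) (s : Set α) {p : ℝ} (hp : 1 ≤ p) :
    ∫⁻ x in s, f x ∂μ ≤ μ s ^ (1 - 1 / p) * (∫⁻ x in s, f x ^ p ∂μ) ^ (1 / p) := by
  rcases hp.eq_or_lt with rfl | hp
  · simp
  have hold := ENNReal.lintegral_mul_le_Lp_mul_Lq (μ := μ.restrict s)
    (Real.HolderConjugate.conjExponent hp).symm (f := fun _ => 1) (g := f)
    aemeasurable_const hf.restrict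
  simp only [Pi.mul_apply, one_mul, ENNReal.one_rpow, lintegral_one, Measure.restrict_apply_univ]
    at hold
  have e : 1 / Real.conjExponent p = 1 - 1 / p := by
    rw [Real.conjExponent]
    field_simp
  rwa [e] at hold

/-- Volume of a spherical shell. -/
lemma exists_volume_shell_le (k : ℕ) : ∃ C : ℝ, 0 < C ∧ ∀ R h : ℝ, 0 < h → h ≤ R →
    volume {x : Space (k + 1) | R ≤ ‖x‖ ∧ ‖x‖ < R + h} ≤ ENNReal.ofReal (C * (R ^ k * h)) := by
  set c : ℝ := volume.real (Metric.ball (0 : Space (k + 1)) 1) with hc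
  refine ⟨c * ((k + 1) * 2 ^ k) + 1, by positivity, fun R h hh hR => ?_⟩
  have hR0 : 0 < R := hh.trans_le hR
  have hball : ∀ r : ℝ, 0 < r → volume (Metric.ball (0 : Space (k + 1)) r)
      = ENNReal.ofReal (r ^ (k + 1) * c) := by
    intro r hr
    rw [Measure.addHaar_ball_of_pos _ _ hr, ENNReal.ofReal_mul (by positivity), hc,
      finrank_euclideanSpace, Fintype.card_fin, ofReal_measureReal measure_ball_lt_top.ne]
  have hsub : {x : Space (k + 1) | R ≤ ‖x‖ ∧ ‖x‖ < R + h}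
      ⊆ Metric.ball 0 (R + h) \ Metric.ball 0 R := by
    intro x hx
    exact ⟨by simpa using hx.2, by simpa using hx.1⟩
  refine (measure_mono hsub).trans ?_
  rw [measure_sdiff (Metric.ball_subset_ball (by linarith)) measurableSet_ball.nullMeasurableSet
    measure_ball_lt_top.ne, hball _ (by linarith), hball _ hR0,
    ← ENNReal.ofReal_sub _ (by positivity)]
  refine ENNReal.ofReal_le_ofReal ?_
  -- Bernoulli-type bound for the difference of powers
  have hpow : (R + h) ^ (k + 1) - R ^ (k + 1) ≤ (k + 1) * (2 ^ k * R ^ k) * h := by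
    have h1 := Commute.geom_sum₂_mul (Commute.all (R + h) R) (k + 1)
    rw [← h1, add_sub_cancel_left]
    refine mul_le_mul_of_nonneg_right ?_ hh.le
    refine (Finset.sum_le_card_nsmul _ _ (2 ^ k * R ^ k) fun i hi => ?_).trans
      (le_of_eq (by simp))
    rw [Finset.mem_range] at hi
    calc (R + h) ^ i * R ^ (k + 1 - 1 - i) ≤ (2 * R) ^ i * (2 * R) ^ (k + 1 - 1 - i) := by
          gcongr <;> linarith
      _ = 2 ^ k * R ^ k := by
          rw [← pow_add, ← mul_pow]
          congr 1
          omega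
  have hc0 : 0 ≤ c := measureReal_nonneg
  have h2 : 0 ≤ R ^ k * h := by positivity
  calc (R + h) ^ (k + 1) * c - R ^ (k + 1) * c = c * ((R + h) ^ (k + 1) - R ^ (k + 1)) := by ring
    _ ≤ c * ((k + 1) * (2 ^ k * R ^ k) * h) := by gcongr
    _ ≤ _ := by nlinarith

/-! ### The space-time norms of a function bounded by a radial amplitude -/

lemma ofReal_inv_pow_le {r : ℝ} {l : ℤ} (h : (2 : ℝ) ^ l ≤ r) (m : ℕ) :
    ENNReal.ofReal (r⁻¹ ^ m) ≤ (2 : ℝ≥0∞) ^ (-(m : ℝ) * l) := by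
  have h0 : (0 : ℝ) < 2 ^ l := by positivity
  calc ENNReal.ofReal (r⁻¹ ^ m) ≤ ENNReal.ofReal (((2 : ℝ) ^ l)⁻¹ ^ m) := by
        have := h0.trans_le h
        gcongr
    _ = (2 : ℝ≥0∞) ^ (-(m : ℝ) * l) := by
        rw [ENNReal.ofReal_pow (by positivity), ← zpow_neg, two_zpow_eq_rpow,
          ← ENNReal.rpow_natCast, ← ENNReal.rpow_mul]
        congr 1
        push_cast
        ring

lemma ofReal_pow_le {r : ℝ} {l : ℤ} (h0 : 0 ≤ r) (h : r ≤ (2 : ℝ) ^ l) (k : ℕ) :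
    ENNReal.ofReal (r ^ k) ≤ (2 : ℝ≥0∞) ^ ((k : ℝ) * l) := by
  calc ENNReal.ofReal (r ^ k) ≤ ENNReal.ofReal (((2 : ℝ) ^ l) ^ k) := by gcongr
    _ = (2 : ℝ≥0∞) ^ ((k : ℝ) * l) := by
        rw [ENNReal.ofReal_pow (by positivity), two_zpow_eq_rpow,
          ← ENNReal.rpow_natCast, ← ENNReal.rpow_mul]
        congr 1
        ring

lemma volume_dyadic_time_le (j l : ℤ) :
    volume (dyadicSet (fun t : ℝ => |t| + (2 : ℝ) ^ j) l) ≤ (2 : ℝ≥0∞) ^ ((l : ℝ) + 2) := by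
  have hsub : dyadicSet (fun t : ℝ => |t| + (2 : ℝ) ^ j) l
      ⊆ Icc (-(2 : ℝ) ^ (l + 1)) (2 ^ (l + 1)) := by
    intro t ht
    have h1 : |t| + (2 : ℝ) ^ j < 2 ^ (l + 1) := ht.2
    have h2 : (0 : ℝ) < 2 ^ j := by positivity
    exact abs_le.1 (by linarith)
  refine (measure_mono hsub).trans (le_of_eq ?_)
  rw [Real.volume_Icc, show (2 : ℝ) ^ (l + 1) - -2 ^ (l + 1) = 2 ^ (l + 2) by
    rw [zpow_add₀ two_ne_zero, zpow_add₀ two_ne_zero]; norm_num; ring, two_zpow_eq_rpow]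
  push_cast
  rfl

lemma dyadic_time_eq_empty {j l : ℤ} (h : l < j) :
    dyadicSet (fun t : ℝ => |t| + (2 : ℝ) ^ j) l = ∅ := by
  refine eq_empty_of_forall_notMem fun t ht => ?_
  have h1 : |t| + (2 : ℝ) ^ j < 2 ^ (l + 1) := ht.2
  have h2 : (2 : ℝ) ^ (l + 1) ≤ 2 ^ j := zpow_le_zpow_right₀ one_le_two (by omega)
  linarith [abs_nonneg t]

lemma exists_volume_channel_le (n : ℕ) : ∃ D : ℝ≥0∞, D ≠ ⊤ ∧ ∀ (j l : ℤ) (t : ℝ),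
    t ∈ dyadicSet (fun t : ℝ => |t| + (2 : ℝ) ^ j) l →
    volume {x : Space (2 * n + 3) | (x, t) ∈ channel (2 * n + 3) j}
      ≤ D * (2 : ℝ≥0∞) ^ ((2 * n + 2) * (l : ℝ) + j) := by
  obtain ⟨C, hC, h⟩ := exists_volume_shell_le (2 * n + 2)
  refine ⟨ENNReal.ofReal C * (2 : ℝ≥0∞) ^ ((2 * n + 2 : ℝ)), ENNReal.mul_ne_top
    ENNReal.ofReal_ne_top (ENNReal.rpow_ne_top_of_ne_zero (by simp) (by simp)), ?_⟩
  intro j l t ht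
  have hj : (0 : ℝ) < 2 ^ j := by positivity
  have hsub : {x : Space (2 * n + 3) | (x, t) ∈ channel (2 * n + 3) j}
      ⊆ {x : Space (2 * n + 2 + 1) | |t| + 2 ^ j ≤ ‖x‖ ∧ ‖x‖ < |t| + 2 ^ j + 2 ^ j} := by
    intro x hx
    refine ⟨hx.1, hx.2.trans_eq ?_⟩
    rw [zpow_add₀ two_ne_zero]
    ring
  refine (measure_mono hsub).trans ((h _ _ hj (by linarith [abs_nonneg t])).trans ?_)
  rw [ENNReal.ofReal_mul hC.le, ENNReal.ofReal_mul (by positivity), two_zpow_eq_rpow, mul_assoc]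
  refine mul_le_mul_right ?_ _
  calc ENNReal.ofReal ((|t| + 2 ^ j) ^ (2 * n + 2)) * (2 : ℝ≥0∞) ^ (j : ℝ)
      ≤ (2 : ℝ≥0∞) ^ (((2 * n + 2 : ℕ) : ℝ) * ((l + 1 : ℤ) : ℝ)) * (2 : ℝ≥0∞) ^ (j : ℝ) := by
        gcongr
        exact ofReal_pow_le (by positivity) ht.2.le _
    _ = _ := by
        rw [← ENNReal.rpow_add _ _ (by simp) (by simp), ← ENNReal.rpow_add _ _ (by simp) (by simp)]
        congr 1
        push_cast
        ring

lemma measurableSet_channel (d : ℕ) (j : ℤ) : MeasurableSet (channel d j) := by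
  have h1 : MeasurableSet {z : Space d × ℝ | |z.2| + (2 : ℝ) ^ j ≤ ‖z.1‖} :=
    measurableSet_le (by fun_prop) (by fun_prop)
  have h2 : MeasurableSet {z : Space d × ℝ | ‖z.1‖ < |z.2| + (2 : ℝ) ^ (j + 1)} :=
    measurableSet_lt (by fun_prop) (by fun_prop)
  exact h1.inter h2

lemma ae_ae_of_ae_space_time {d : ℕ} {P : Space d × ℝ → Prop} (h : ∀ᵐ z, P z) :
    ∀ᵐ t : ℝ, ∀ᵐ x : Space d, P (x, t) :=
  Measure.ae_ae_of_ae_prod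
    ((Measure.measurePreserving_swap (μ := (volume : Measure ℝ))
      (ν := (volume : Measure (Space d)))).quasiMeasurePreserving.ae h)

/-- A function bounded by `|x|^(-(n+1)) B(2 |x|)` outside the light cone. On the channel `Ω_j` the
times with `|t| + 2^j ~ 2^l` occur only for `l ≥ j`; there `|x| ~ 2^l` and the slices have volume
about `2^((d-1) l + j)`, so that the block is of size `2^(-(l-j)/q) 2^(-(β-1/2) l) B(2^(l+3))` by
the scaling relation, and Schur's test sums over `j`. -/
theorem exists_channelNorm_le (n : ℕ) {p q β : ℝ} (hp : 1 ≤ p) (hq : 1 ≤ q)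
    (hpq : 1 / p + (2 * n + 3) / q = (2 * n + 3) / 2 - β) : ∃ A : ℝ≥0∞, A ≠ ⊤ ∧
    ∀ (u : Space (2 * n + 3) × ℝ → ℂ) (B : ℝ → ℝ≥0∞), Monotone B →
    (∀ᵐ z : Space (2 * n + 3) × ℝ, |z.2| < ‖z.1‖ →
      ‖u z‖ₑ ≤ ENNReal.ofReal (‖z.1‖⁻¹ ^ (n + 1)) * B (2 * ‖z.1‖)) →
    channelNorm p q u ≤
      A * ell2 fun l => (2 : ℝ≥0∞) ^ (-(β - 1 / 2) * l) * B ((2 : ℝ) ^ (l + 3)) := by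
  obtain ⟨D, hD, hvol⟩ := exists_volume_channel_le n
  have hp0 : 0 < p := by linarith
  have hq0 : 0 < q := by linarith
  set A₀ : ℝ≥0∞ := D ^ (1 / q) * (2 : ℝ≥0∞) ^ (2 / p) with hA₀
  have hA₀top : A₀ ≠ ⊤ := ENNReal.mul_ne_top (ENNReal.rpow_ne_top_of_nonneg (by positivity) hD)
    (two_rpow_ne_top _)
  refine ⟨A₀ * geomMass (1 / q) 0, ENNReal.mul_ne_top hA₀top
    (geomMass_ne_top (by positivity) 0), ?_⟩
  intro u B hB hu
  have hu' := ae_ae_of_ae_space_time hu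
  set b : ℤ → ℝ≥0∞ := fun l => (2 : ℝ≥0∞) ^ (-(β - 1 / 2) * l) * B ((2 : ℝ) ^ (l + 3)) with hb
  -- one dyadic block of times, where `|x| ~ 2 ^ l` on the channel
  have hblock : ∀ j l : ℤ, ∫⁻ t in dyadicSet (fun t : ℝ => |t| + (2 : ℝ) ^ j) l,
      (∫⁻ x, ‖(channel (2 * n + 3) j).indicator u (x, t)‖ₑ ^ q) ^ (p / q)
      ≤ (A₀ * (geomKernel (1 / q) 0 l j * b l)) ^ p := by
    intro j l
    by_cases hjl : l < j
    · rw [dyadic_time_eq_empty hjl]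
      simp
    set W : ℝ≥0∞ := (2 : ℝ≥0∞) ^ (-((n + 1 : ℕ) : ℝ) * l) * B ((2 : ℝ) ^ (l + 3)) with hW
    set V : ℝ≥0∞ := D * (2 : ℝ≥0∞) ^ ((2 * n + 2) * (l : ℝ) + j) with hV
    have h1 : ∀ᵐ t : ℝ, t ∈ dyadicSet (fun t : ℝ => |t| + (2 : ℝ) ^ j) l →
        (∫⁻ x, ‖(channel (2 * n + 3) j).indicator u (x, t)‖ₑ ^ q) ^ (p / q)
          ≤ W ^ p * V ^ (p / q) := by
      filter_upwards [hu'] with t ht htl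
      have hj : (0 : ℝ) < 2 ^ j := by positivity
      have hS : MeasurableSet {x : Space (2 * n + 3) | (x, t) ∈ channel (2 * n + 3) j} :=
        (measurableSet_channel _ j).preimage measurable_prodMk_right
      have h2 : ∫⁻ x, ‖(channel (2 * n + 3) j).indicator u (x, t)‖ₑ ^ q ≤ W ^ q * V := by
        calc _ ≤ ∫⁻ x, {x : Space (2 * n + 3) | (x, t) ∈ channel (2 * n + 3) j}.indicator
              (fun _ => W ^ q) x := by
              refine lintegral_mono_ae ?_
              filter_upwards [ht] with x hx
              by_cases hxc : (x, t) ∈ channel (2 * n + 3) j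
              · rw [indicator_of_mem hxc, indicator_of_mem
                  (show x ∈ {x : Space (2 * n + 3) | (x, t) ∈ channel (2 * n + 3) j} from hxc)]
                have h3 : |t| + 2 ^ j ≤ ‖x‖ := hxc.1
                have h4 : ‖x‖ < |t| + (2 : ℝ) ^ (j + 1) := hxc.2
                have h5 : (2 : ℝ) ^ l ≤ |t| + 2 ^ j := htl.1
                have h6 : |t| + (2 : ℝ) ^ j < 2 ^ (l + 1) := htl.2
                have h7 : (2 : ℝ) ^ (j + 1) = 2 ^ j + 2 ^ j := by
                  rw [zpow_add₀ two_ne_zero]; ring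
                have h8 : (2 : ℝ) ^ (l + 3) = 2 * (2 * 2 ^ (l + 1)) := by
                  rw [zpow_add₀ two_ne_zero, zpow_add₀ two_ne_zero]; norm_num; ring
                refine ENNReal.rpow_le_rpow ((hx (show |t| < ‖x‖ by linarith)).trans ?_) hq0.le
                refine mul_le_mul' (ofReal_inv_pow_le (h5.trans h3) _) (hB ?_)
                show 2 * ‖x‖ ≤ _
                rw [h8]
                linarith [abs_nonneg t]
              · rw [indicator_of_notMem hxc, enorm_zero, ENNReal.zero_rpow_of_pos hq0]
                exact bot_le
          _ ≤ W ^ q * V := by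
              rw [lintegral_indicator_const hS]
              gcongr
              exact hvol j l t htl
      calc _ ≤ (W ^ q * V) ^ (p / q) := by gcongr
        _ = W ^ p * V ^ (p / q) := by
            rw [ENNReal.mul_rpow_of_nonneg _ _ (by positivity), ← ENNReal.rpow_mul,
              mul_div_cancel₀ _ hq0.ne']
    have hm : MeasurableSet (dyadicSet (fun t : ℝ => |t| + (2 : ℝ) ^ j) l) :=
      measurableSet_dyadicSet (by fun_prop) l
    calc _ ≤ ∫⁻ t in dyadicSet (fun t : ℝ => |t| + (2 : ℝ) ^ j) l, W ^ p * V ^ (p / q) := by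
          refine lintegral_mono_ae ?_
          exact (ae_restrict_iff' hm).2 h1
      _ ≤ W ^ p * V ^ (p / q) * (2 : ℝ≥0∞) ^ ((l : ℝ) + 2) := by
          rw [setLIntegral_const]
          gcongr
          exact volume_dyadic_time_le j l
      _ = (W * V ^ (1 / q) * (2 : ℝ≥0∞) ^ (((l : ℝ) + 2) / p)) ^ p := by
          have e : ∀ W V : ℝ≥0∞, (W * V ^ (1 / q) * (2 : ℝ≥0∞) ^ (((l : ℝ) + 2) / p)) ^ p
              = W ^ p * V ^ (p / q) * (2 : ℝ≥0∞) ^ ((l : ℝ) + 2) := fun W V => by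
            rw [ENNReal.mul_rpow_of_nonneg _ _ hp0.le, ENNReal.mul_rpow_of_nonneg _ _ hp0.le,
              ← ENNReal.rpow_mul, ← ENNReal.rpow_mul, div_mul_cancel₀ _ hp0.ne',
              one_div_mul_eq_div]
          rw [e]
      _ = _ := by
          congr 1
          -- the scaling relation between `p`, `q` and `β`
          have hexp : -((n : ℝ) + 1) * l + ((2 * n + 2) * (l : ℝ) + j) * (1 / q) + ((l : ℝ) + 2) / p
              = 2 / p + -(1 / q) * ((l : ℝ) - j) + -(β - 1 / 2) * l := by
            have : (l : ℝ) * (1 / p) = l * ((2 * n + 3) / 2 - β - (2 * n + 3) / q) := by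
              rw [← hpq]; ring
            calc _ = -((n : ℝ) + 1) * l + ((2 * n + 2) * (l : ℝ) + j) * (1 / q)
                  + (l : ℝ) * (1 / p) + 2 / p := by ring
              _ = _ := by rw [this]; ring
          rw [hW, hV, geomKernel, if_pos (by omega), hb, hA₀,
            ENNReal.mul_rpow_of_nonneg _ _ (by positivity : 0 ≤ 1 / q), ← ENNReal.rpow_mul]
          calc _ = D ^ (1 / q) * ((2 : ℝ≥0∞) ^ (-((n + 1 : ℕ) : ℝ) * l) *
                (2 : ℝ≥0∞) ^ (((2 * n + 2) * (l : ℝ) + j) * (1 / q)) *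
                (2 : ℝ≥0∞) ^ (((l : ℝ) + 2) / p)) * B ((2 : ℝ) ^ (l + 3)) := by ring
            _ = D ^ (1 / q) * ((2 : ℝ≥0∞) ^ (2 / p) * (2 : ℝ≥0∞) ^ (-(1 / q) * ((l : ℝ) - j)) *
                (2 : ℝ≥0∞) ^ (-(β - 1 / 2) * l)) * B ((2 : ℝ) ^ (l + 3)) := by
                rw [two_rpow_mul, two_rpow_mul, two_rpow_mul, two_rpow_mul, ← hexp]
                push_cast
                rfl
            _ = _ := by ring
  have hj : ∀ j, mixedNorm p q ((channel (2 * n + 3) j).indicator u)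
      ≤ ∑' l, geomKernel (1 / q) 0 l j * (A₀ * b l) := by
    intro j
    rw [mixedNorm, lintegral_eq_tsum_dyadic (r := fun t : ℝ => |t| + (2 : ℝ) ^ j) (by fun_prop)
      (Filter.Eventually.of_forall fun t => by positivity)]
    calc _ ≤ (∑' l, (A₀ * (geomKernel (1 / q) 0 l j * b l)) ^ p) ^ (1 / p) := by
          gcongr with l
          exact hblock j l
      _ ≤ ((∑' l, A₀ * (geomKernel (1 / q) 0 l j * b l)) ^ p) ^ (1 / p) := by
          gcongr
          exact tsum_rpow_le_rpow_tsum _ hp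
      _ = ∑' l, A₀ * (geomKernel (1 / q) 0 l j * b l) := by
          rw [← ENNReal.rpow_mul, mul_one_div_cancel hp0.ne', ENNReal.rpow_one]
      _ = _ := tsum_congr fun l => by ring
  calc channelNorm p q u = ell2 fun j => mixedNorm p q ((channel (2 * n + 3) j).indicator u) := rfl
    _ ≤ ell2 fun j => ∑' l, geomKernel (1 / q) 0 l j * (A₀ * b l) := ell2_mono hj
    _ ≤ geomMass (1 / q) 0 * ell2 fun l => A₀ * b l := ell2_geomKernel_swap_le _ _ _
    _ = _ := by rw [ell2_const_mul]; ring

/-! ### The amplitude of the source -/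

lemma channelNorm_congr_ae {d : ℕ} {p q : ℝ} {F F' : Space d × ℝ → ℂ} (h : F =ᵐ[volume] F') :
    channelNorm p q F = channelNorm p q F' := by
  have h' := ae_ae_of_ae_space_time h
  have : ∀ j, mixedNorm p q ((channel d j).indicator F)
      = mixedNorm p q ((channel d j).indicator F') := by
    intro j
    unfold mixedNorm
    congr 1
    refine lintegral_congr_ae ?_
    filter_upwards [h'] with t ht
    congr 1
    refine lintegral_congr_ae ?_
    filter_upwards [ht] with x hx
    have hx' : F (x, t) = F' (x, t) := hx
    by_cases hc : (x, t) ∈ channel d j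
    · rw [indicator_of_mem hc, indicator_of_mem hc, hx']
    · rw [indicator_of_notMem hc, indicator_of_notMem hc]
  simp only [channelNorm, this]

lemma sourceWeight_congr_ae {d n : ℕ} {F F' : Space d × ℝ → ℂ} (h : F =ᵐ[volume] F') (R : ℝ) :
    sourceWeight n F R = sourceWeight n F' R := by
  unfold sourceWeight
  refine lintegral_congr_ae (ae_restrict_of_ae ?_)
  filter_upwards [h] with z hz
  rw [hz]

/-- The contribution to the source amplitude of one channel and one dyadic block of times. -/
lemma source_block_le {n : ℕ} {qt : ℝ} (hqt : 1 ≤ qt) {D : ℝ≥0∞}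
    (hvol : ∀ (j l : ℤ) (t : ℝ), t ∈ dyadicSet (fun t : ℝ => |t| + (2 : ℝ) ^ j) l →
      volume {x : Space (2 * n + 3) | (x, t) ∈ channel (2 * n + 3) j}
        ≤ D * (2 : ℝ≥0∞) ^ ((2 * n + 2) * (l : ℝ) + j))
    {F : Space (2 * n + 3) × ℝ → ℂ} (hF : Measurable F) (L k i : ℤ) {t : ℝ}
    (ht : t ∈ dyadicSet (fun t : ℝ => |t| + (2 : ℝ) ^ k) i) :
    ∫⁻ x, (sourceRegion (2 * n + 3) ((2 : ℝ) ^ L) ∩ channel (2 * n + 3) k).indicator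
      (fun z => ENNReal.ofReal (‖z.1‖⁻¹ ^ (n + 1)) * ‖F z‖ₑ) (x, t)
    ≤ if i ≤ L then (2 : ℝ≥0∞) ^ (-((n + 1 : ℕ) : ℝ) * i) *
        ((D * (2 : ℝ≥0∞) ^ ((2 * n + 2) * (i : ℝ) + k)) ^ (1 - 1 / qt) *
        (∫⁻ x, ‖(channel (2 * n + 3) k).indicator F (x, t)‖ₑ ^ qt) ^ (1 / qt)) else 0 := by
  have h1 : (2 : ℝ) ^ i ≤ |t| + 2 ^ k := ht.1
  set S : Set (Space (2 * n + 3)) := {x | (x, t) ∈ channel (2 * n + 3) k} with hS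
  have hSm : MeasurableSet S := (measurableSet_channel _ k).preimage measurable_prodMk_right
  split_ifs with hiL
  · have hm : Measurable fun x => (channel (2 * n + 3) k).indicator F (x, t) :=
      (hF.indicator (measurableSet_channel _ k)).comp measurable_prodMk_right
    have hq0 : 0 ≤ 1 - 1 / qt := by
      have : 1 / qt ≤ 1 := by rw [div_le_one (by linarith)]; exact hqt
      linarith
    calc _ ≤ ∫⁻ x, S.indicator (fun x => (2 : ℝ≥0∞) ^ (-((n + 1 : ℕ) : ℝ) * i) *
          ‖(channel (2 * n + 3) k).indicator F (x, t)‖ₑ) x := by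
          refine lintegral_mono fun x => ?_
          by_cases hx : (x, t) ∈ sourceRegion (2 * n + 3) ((2 : ℝ) ^ L) ∩ channel (2 * n + 3) k
          · rw [indicator_of_mem hx, indicator_of_mem (show x ∈ S from hx.2),
              indicator_of_mem hx.2]
            gcongr
            exact ofReal_inv_pow_le (h1.trans hx.2.1) _
          · rw [indicator_of_notMem hx]
            exact bot_le
      _ = (2 : ℝ≥0∞) ^ (-((n + 1 : ℕ) : ℝ) * i) *
          ∫⁻ x in S, ‖(channel (2 * n + 3) k).indicator F (x, t)‖ₑ := by
          rw [lintegral_indicator hSm, lintegral_const_mul _ hm.enorm]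
      _ ≤ _ := by
          gcongr
          refine (setLIntegral_le_rpow_mul hm.enorm.aemeasurable S hqt).trans ?_
          gcongr
          · exact hvol k i t ht
          · exact Measure.restrict_le_self
  · refine le_of_eq ?_
    rw [lintegral_eq_zero_iff']
    · refine Filter.Eventually.of_forall fun x => ?_
      refine indicator_of_notMem (fun hx => hiL ?_) _
      have h2 : ‖x‖ + |t| ≤ 2 ^ L := hx.1.2
      have h3 : |t| + (2 : ℝ) ^ k ≤ ‖x‖ := hx.2.1
      have h4 : (2 : ℝ) ^ i ≤ 2 ^ L := by linarith [abs_nonneg t]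
      exact (zpow_le_zpow_iff_right₀ one_lt_two).1 h4
    · have hm : Measurable fun z : Space (2 * n + 3) × ℝ =>
          ENNReal.ofReal (‖z.1‖⁻¹ ^ (n + 1)) * ‖F z‖ₑ := by fun_prop
      exact ((hm.indicator ((measurableSet_sourceRegion _ _).inter
        (measurableSet_channel _ k))).comp measurable_prodMk_right).aemeasurable

/-- The source amplitude in terms of the channel norm of the source. Hölder's inequality on the
block `|t| + 2^k ~ 2^i` of the channel `Ω_k` gains `2^(-κ (i-k))` with `κ = 1 - 1/qt`, and the
weights of the blocks `i ≤ l + 4` decay geometrically because `β > 1/2`. -/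
theorem exists_sourceWeight_le (n : ℕ) {pt qt β : ℝ} (hpt : 1 ≤ pt) (hqt : 1 ≤ qt)
    (hβ : 1 / 2 < β) (hpqt : 1 / pt + (2 * n + 3) / qt = (2 * n + 3) / 2 - β + 2) :
    ∃ A : ℝ≥0∞, A ≠ ⊤ ∧ ∀ F : Space (2 * n + 3) × ℝ → ℂ, AEStronglyMeasurable F →
      ell2 (fun l => (2 : ℝ≥0∞) ^ (-(β - 1 / 2) * l) * sourceWeight n F ((2 : ℝ) ^ (l + 4)))
        ≤ A * channelNorm pt qt F := by
  obtain ⟨D, hD, hvol⟩ := exists_volume_channel_le n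
  have hpt0 : 0 < pt := by linarith
  have hqt0 : 0 < qt := by linarith
  set κ : ℝ := 1 - 1 / qt with hκ
  -- the scaling relation excludes `qt = 1`, since `β > 1/2`
  have hκ0 : 0 < κ := by
    have h1 : 0 < 1 / pt := by positivity
    have h2 : (2 * n + 3 : ℝ) * (1 / qt) < (2 * n + 3) * 1 := by
      have h3 : (2 * n + 3 : ℝ) * (1 / qt) = (2 * n + 3) / 2 - β + 2 - 1 / pt := by
        rw [← hpqt]; ring
      have h4 : (0 : ℝ) ≤ n := by positivity
      linarith
    have h3 : 1 / qt < 1 := lt_of_mul_lt_mul_left h2 (by positivity)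
    linarith
  have hpt1 : 0 ≤ 1 - 1 / pt := by
    have : 1 / pt ≤ 1 := by rw [div_le_one hpt0]; exact hpt
    linarith
  set A₀ : ℝ≥0∞ := D ^ κ * (2 : ℝ≥0∞) ^ (2 * (1 - 1 / pt)) with hA₀
  have hA₀top : A₀ ≠ ⊤ := ENNReal.mul_ne_top (ENNReal.rpow_ne_top_of_nonneg hκ0.le hD)
    (two_rpow_ne_top _)
  refine ⟨A₀ * (geomMass (β - 1 / 2) 4 * geomMass κ 0), ENNReal.mul_ne_top hA₀top
    (ENNReal.mul_ne_top (geomMass_ne_top (by linarith) _) (geomMass_ne_top hκ0 _)), ?_⟩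
  -- it suffices to treat measurable sources
  suffices key : ∀ F : Space (2 * n + 3) × ℝ → ℂ, Measurable F →
      ell2 (fun l => (2 : ℝ≥0∞) ^ (-(β - 1 / 2) * l) * sourceWeight n F ((2 : ℝ) ^ (l + 4)))
        ≤ A₀ * (geomMass (β - 1 / 2) 4 * geomMass κ 0) * channelNorm pt qt F by
    intro F hF
    have := key _ hF.stronglyMeasurable_mk.measurable
    rw [← channelNorm_congr_ae hF.ae_eq_mk] at this
    simpa only [← sourceWeight_congr_ae hF.ae_eq_mk] using this
  intro F hF
  set f : ℤ → ℝ≥0∞ := fun k => mixedNorm pt qt ((channel (2 * n + 3) k).indicator F) with hf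
  set H : Space (2 * n + 3) × ℝ → ℝ≥0∞ :=
    fun z => ENNReal.ofReal (‖z.1‖⁻¹ ^ (n + 1)) * ‖F z‖ₑ with hH
  have hHm : Measurable H := by rw [hH]; fun_prop
  have hNm : ∀ k, Measurable fun t : ℝ =>
      (∫⁻ x, ‖(channel (2 * n + 3) k).indicator F (x, t)‖ₑ ^ qt) ^ (1 / qt) := by
    intro k
    have : Measurable fun z => ‖(channel (2 * n + 3) k).indicator F z‖ₑ ^ qt :=
      ((hF.indicator (measurableSet_channel _ k)).enorm).pow_const _
    exact this.lintegral_prod_left'.pow_const _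
  -- the contribution of one channel, summed over the dyadic blocks of times
  have hchan : ∀ L k : ℤ, ∫⁻ z in sourceRegion (2 * n + 3) ((2 : ℝ) ^ L) ∩
      channel (2 * n + 3) k, H z ≤ ∑' i, if i ≤ L then
        A₀ * ((2 : ℝ≥0∞) ^ ((β - 1 / 2) * (i : ℝ)) * (geomKernel κ 0 i k * f k)) else 0 := by
    intro L k
    set E := sourceRegion (2 * n + 3) ((2 : ℝ) ^ L) ∩ channel (2 * n + 3) k with hE
    have hEm : MeasurableSet E := (measurableSet_sourceRegion _ _).inter (measurableSet_channel _ k)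
    rw [← lintegral_indicator hEm, Measure.volume_eq_prod,
      lintegral_prod_symm _ (hHm.indicator hEm).aemeasurable,
      lintegral_eq_tsum_dyadic (r := fun t : ℝ => |t| + (2 : ℝ) ^ k) (by fun_prop)
      (Filter.Eventually.of_forall fun t => by positivity)]
    refine ENNReal.tsum_le_tsum fun i => ?_
    by_cases hik : i < k
    · rw [dyadic_time_eq_empty hik]
      simp
    have hdm : MeasurableSet (dyadicSet (fun t : ℝ => |t| + (2 : ℝ) ^ k) i) :=
      measurableSet_dyadicSet (by fun_prop) i
    refine (setLIntegral_mono' hdm fun t ht => source_block_le hqt hvol hF L k i ht).trans ?_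
    split_ifs with hiL
    · rw [lintegral_const_mul _ ((hNm k).const_mul _), lintegral_const_mul _ (hNm k)]
      have h1 := setLIntegral_le_rpow_mul (μ := volume) (hNm k).aemeasurable
        (dyadicSet (fun t : ℝ => |t| + (2 : ℝ) ^ k) i) hpt
      have h2 : (∫⁻ t in dyadicSet (fun t : ℝ => |t| + (2 : ℝ) ^ k) i,
          ((∫⁻ x, ‖(channel (2 * n + 3) k).indicator F (x, t)‖ₑ ^ qt) ^ (1 / qt)) ^ pt) ^ (1 / pt)
          ≤ f k := by
        simp only [hf, mixedNorm, ← ENNReal.rpow_mul, one_div_mul_eq_div]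
        gcongr
        exact Measure.restrict_le_self
      calc _ ≤ (2 : ℝ≥0∞) ^ (-((n + 1 : ℕ) : ℝ) * i) *
            ((D * (2 : ℝ≥0∞) ^ ((2 * n + 2) * (i : ℝ) + k)) ^ κ *
            (((2 : ℝ≥0∞) ^ ((i : ℝ) + 2)) ^ (1 - 1 / pt) * f k)) := by
            refine mul_le_mul_right (mul_le_mul_right (h1.trans (mul_le_mul' ?_ h2)) _) _
            exact ENNReal.rpow_le_rpow (volume_dyadic_time_le k i) hpt1
        _ = _ := by
            rw [geomKernel, if_pos (by omega), ENNReal.mul_rpow_of_nonneg _ _ hκ0.le,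
              ← ENNReal.rpow_mul, ← ENNReal.rpow_mul, hA₀]
            -- the scaling relation between `pt`, `qt` and `β`
            have hexp : -((n + 1 : ℕ) : ℝ) * i + ((2 * n + 2) * (i : ℝ) + k) * κ
                + ((i : ℝ) + 2) * (1 - 1 / pt)
                = 2 * (1 - 1 / pt) + (β - 1 / 2) * (i : ℝ) + -κ * ((i : ℝ) - k) := by
              have h3 : 1 / pt = (2 * n + 3) / 2 - β + 2 - (2 * n + 3) * (1 - κ) := by
                rw [hκ, ← hpqt]; ring
              have h4 : (i : ℝ) * (1 / pt)
                  = i * ((2 * n + 3) / 2 - β + 2 - (2 * n + 3) * (1 - κ)) := by rw [← h3]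
              push_cast
              linarith
            calc _ = D ^ κ * ((2 : ℝ≥0∞) ^ (-((n + 1 : ℕ) : ℝ) * i) *
                  (2 : ℝ≥0∞) ^ (((2 * n + 2) * (i : ℝ) + k) * κ) *
                  (2 : ℝ≥0∞) ^ (((i : ℝ) + 2) * (1 - 1 / pt))) * f k := by ring
              _ = D ^ κ * ((2 : ℝ≥0∞) ^ (2 * (1 - 1 / pt)) *
                  (2 : ℝ≥0∞) ^ ((β - 1 / 2) * (i : ℝ)) *
                  (2 : ℝ≥0∞) ^ (-κ * ((i : ℝ) - k))) * f k := by
                  rw [two_rpow_mul, two_rpow_mul, two_rpow_mul, two_rpow_mul, hexp]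
              _ = _ := by ring
    · simp
  have hweight : ∀ l : ℤ, (2 : ℝ≥0∞) ^ (-(β - 1 / 2) * l) * sourceWeight n F ((2 : ℝ) ^ (l + 4))
      ≤ ∑' i, geomKernel (β - 1 / 2) 4 l i * (A₀ * ∑' k, geomKernel κ 0 i k * f k) := by
    intro l
    have hr : Measurable fun z : Space (2 * n + 3) × ℝ => ‖z.1‖ - |z.2| := by fun_prop
    have hpos : ∀ᵐ z ∂(volume : Measure (Space (2 * n + 3) × ℝ)).restrict
        (sourceRegion (2 * n + 3) ((2 : ℝ) ^ (l + 4))), 0 < ‖z.1‖ - |z.2| := by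
      filter_upwards [ae_restrict_mem (measurableSet_sourceRegion _ _)] with z hz
      exact sub_pos.2 hz.1
    have hdc : ∀ k, dyadicSet (fun z : Space (2 * n + 3) × ℝ => ‖z.1‖ - |z.2|) k
        = channel (2 * n + 3) k := by
      intro k
      ext z
      exact ⟨fun h => ⟨by linarith [h.1], by linarith [h.2]⟩,
        fun h => ⟨by linarith [h.1], by linarith [h.2]⟩⟩
    rw [sourceWeight, lintegral_eq_tsum_dyadic hr hpos]
    simp only [hdc, Measure.restrict_restrict (measurableSet_channel _ _)]
    calc _ ≤ (2 : ℝ≥0∞) ^ (-(β - 1 / 2) * l) * ∑' k, ∑' i, (if i ≤ l + 4 then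
        A₀ * ((2 : ℝ≥0∞) ^ ((β - 1 / 2) * (i : ℝ)) * (geomKernel κ 0 i k * f k)) else 0) := by
          gcongr with k
          rw [inter_comm]
          exact hchan (l + 4) k
      _ = ∑' i, ∑' k, (2 : ℝ≥0∞) ^ (-(β - 1 / 2) * l) * (if i ≤ l + 4 then
        A₀ * ((2 : ℝ≥0∞) ^ ((β - 1 / 2) * (i : ℝ)) * (geomKernel κ 0 i k * f k)) else 0) := by
          rw [ENNReal.tsum_comm, ← ENNReal.tsum_mul_left]
          simp only [ENNReal.tsum_mul_left]
      _ = _ := by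
          refine tsum_congr fun i => ?_
          rw [← ENNReal.tsum_mul_left, ← ENNReal.tsum_mul_left]
          refine tsum_congr fun k => ?_
          rw [show geomKernel (β - 1 / 2) 4 l i = if i ≤ l + 4 then
            (2 : ℝ≥0∞) ^ (-(β - 1 / 2) * ((l : ℝ) - i)) else 0 from rfl]
          split_ifs with h
          · rw [show -(β - 1 / 2) * ((l : ℝ) - i) = -(β - 1 / 2) * l + (β - 1 / 2) * i by ring,
              ← two_rpow_mul]
            ring
          · simp
  calc _ ≤ ell2 fun l => ∑' i, geomKernel (β - 1 / 2) 4 l i *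
        (A₀ * ∑' k, geomKernel κ 0 i k * f k) := ell2_mono hweight
    _ ≤ geomMass (β - 1 / 2) 4 * (A₀ * (geomMass κ 0 * ell2 f)) := by
        refine (ell2_geomKernel_le _ _ _).trans ?_
        rw [ell2_const_mul]
        gcongr
        exact ell2_geomKernel_le _ _ _
    _ = A₀ * (geomMass (β - 1 / 2) 4 * geomMass κ 0) * ell2 f := by ring

/-! ### The amplitude of the free wave -/

/-- The `Ḣ^s` norm of the tempered distribution with Fourier density `g`. -/
def densityNorm {d : ℕ} (s : ℝ) (g : Space d → ℂ) : ℝ≥0∞ :=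
  (∫⁻ ξ, ENNReal.ofReal (2 * Real.pi * ‖ξ‖) ^ (2 * s) * ‖g ξ‖ₑ ^ (2 : ℝ)) ^ (1 / 2 : ℝ)

/-- The factor `2 π` in the Sobolev weight costs only a constant, since the exponent is at
least `-2`. -/
lemma rpow_norm_le {d : ℕ} {s : ℝ} (hs : -1 ≤ s) (ξ : Space d) :
    ENNReal.ofReal ‖ξ‖ ^ (2 * s)
      ≤ ENNReal.ofReal (2 * Real.pi) ^ (2 : ℝ) * ENNReal.ofReal (2 * Real.pi * ‖ξ‖) ^ (2 * s) := by
  have hpi : (1 : ℝ) ≤ 2 * Real.pi := by linarith [Real.pi_gt_three]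
  have h0 : ENNReal.ofReal (2 * Real.pi) ≠ 0 := by
    rw [Ne, ENNReal.ofReal_eq_zero]; linarith
  rw [ENNReal.ofReal_mul (p := 2 * Real.pi) (by linarith),
    ENNReal.mul_rpow_of_ne_top ENNReal.ofReal_ne_top
    ENNReal.ofReal_ne_top, ← mul_assoc, ← ENNReal.rpow_add _ _ h0 ENNReal.ofReal_ne_top]
  refine le_mul_of_one_le_left' ?_
  rw [← ENNReal.rpow_zero (x := ENNReal.ofReal (2 * Real.pi))]
  refine ENNReal.rpow_le_rpow_of_exponent_le ?_ (by linarith)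
  rw [← ENNReal.ofReal_one]
  exact ENNReal.ofReal_le_ofReal hpi

/-- Volume of the frequency shell `|ξ| ~ 2^(-l)`. -/
lemma exists_volume_frequency_le (k : ℕ) : ∃ D : ℝ≥0∞, D ≠ ⊤ ∧ ∀ l : ℤ,
    volume (dyadicSet (fun ξ : Space k => ‖ξ‖⁻¹) l) ≤ D * (2 : ℝ≥0∞) ^ (-(k : ℝ) * l) := by
  refine ⟨volume (Metric.ball (0 : Space k) 1), measure_ball_lt_top.ne, fun l => ?_⟩
  have hsub : dyadicSet (fun ξ : Space k => ‖ξ‖⁻¹) l ⊆ Metric.closedBall 0 ((2 : ℝ) ^ (-l)) := by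
    intro ξ hξ
    have h1 : (2 : ℝ) ^ l ≤ ‖ξ‖⁻¹ := hξ.1
    rw [mem_closedBall_zero_iff, zpow_neg]
    have h2 : (0 : ℝ) < 2 ^ l := by positivity
    have h3 := inv_anti₀ h2 h1
    rwa [inv_inv] at h3
  refine (measure_mono hsub).trans (le_of_eq ?_)
  rw [Measure.addHaar_closedBall _ _ (by positivity), finrank_euclideanSpace, Fintype.card_fin,
    mul_comm, ENNReal.ofReal_pow (by positivity), two_zpow_eq_rpow, ← ENNReal.rpow_natCast,
    ← ENNReal.rpow_mul]
  congr 2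
  push_cast
  ring

/-- The weight of both data in the amplitude has the scaling of `Ḣ^β`, the factor `|ξ|⁻¹` of the
initial velocity accounting for its lower regularity. -/
lemma lintegral_weighted_le {d : ℕ} {β : ℝ} (hβ : 0 ≤ β) {g₀ g₁ : Space d → ℂ}
    [Nontrivial (Space d)] (h₀ : AEStronglyMeasurable g₀) (h₁ : AEStronglyMeasurable g₁) :
    (∫⁻ ξ, ((ENNReal.ofReal ‖ξ‖⁻¹ * ‖g₁ ξ‖ₑ + ‖g₀ ξ‖ₑ) * ENNReal.ofReal ‖ξ‖ ^ β) ^ (2 : ℝ)) ^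
      (1 / 2 : ℝ) ≤ ENNReal.ofReal (2 * Real.pi) * (densityNorm β g₀ + densityNorm (β - 1) g₁) := by
  have hone : ∀ {s : ℝ}, -1 ≤ s → ∀ g : Space d → ℂ,
      (∫⁻ ξ, ENNReal.ofReal ‖ξ‖ ^ (2 * s) * ‖g ξ‖ₑ ^ (2 : ℝ)) ^ (1 / 2 : ℝ)
        ≤ ENNReal.ofReal (2 * Real.pi) * densityNorm s g := by
    intro s hs g
    have e : ENNReal.ofReal (2 * Real.pi) * densityNorm s g
        = (∫⁻ ξ, ENNReal.ofReal (2 * Real.pi) ^ (2 : ℝ) *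
          (ENNReal.ofReal (2 * Real.pi * ‖ξ‖) ^ (2 * s) * ‖g ξ‖ₑ ^ (2 : ℝ))) ^ (1 / 2 : ℝ) := by
      rw [lintegral_const_mul' _ _ (ENNReal.rpow_ne_top_of_nonneg (by norm_num)
        ENNReal.ofReal_ne_top), ENNReal.mul_rpow_of_nonneg _ _ (by norm_num),
        ← ENNReal.rpow_mul, densityNorm, mul_one_div_cancel (two_ne_zero' ℝ), ENNReal.rpow_one]
    rw [e]
    refine ENNReal.rpow_le_rpow (lintegral_mono fun ξ => ?_) (by norm_num)
    rw [← mul_assoc]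
    exact mul_le_mul_left (rpow_norm_le hs ξ) _
  have hmρ : Measurable fun ξ : Space d => ENNReal.ofReal ‖ξ‖ ^ β := by fun_prop
  have hmi : Measurable fun ξ : Space d => ENNReal.ofReal ‖ξ‖⁻¹ := by fun_prop
  have hadd := ENNReal.lintegral_Lp_add_le (μ := (volume : Measure (Space d))) (p := 2)
    (f := fun ξ => ENNReal.ofReal ‖ξ‖⁻¹ * ‖g₁ ξ‖ₑ * ENNReal.ofReal ‖ξ‖ ^ β)
    (g := fun ξ => ‖g₀ ξ‖ₑ * ENNReal.ofReal ‖ξ‖ ^ β)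
    ((hmi.aemeasurable.mul h₁.enorm).mul hmρ.aemeasurable)
    (h₀.enorm.mul hmρ.aemeasurable) (by norm_num)
  simp only [Pi.add_apply, ← add_mul] at hadd
  have e0 : ∫⁻ ξ, (‖g₀ ξ‖ₑ * ENNReal.ofReal ‖ξ‖ ^ β) ^ (2 : ℝ)
      = ∫⁻ ξ, ENNReal.ofReal ‖ξ‖ ^ (2 * β) * ‖g₀ ξ‖ₑ ^ (2 : ℝ) := by
    refine lintegral_congr fun ξ => ?_
    rw [ENNReal.mul_rpow_of_nonneg _ _ (by norm_num), ← ENNReal.rpow_mul, mul_comm, mul_comm β]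
  have e1 : ∫⁻ ξ, (ENNReal.ofReal ‖ξ‖⁻¹ * ‖g₁ ξ‖ₑ * ENNReal.ofReal ‖ξ‖ ^ β) ^ (2 : ℝ)
      = ∫⁻ ξ, ENNReal.ofReal ‖ξ‖ ^ (2 * (β - 1)) * ‖g₁ ξ‖ₑ ^ (2 : ℝ) := by
    have hae : ∀ᵐ ξ : Space d, ξ ≠ 0 := by simp [ae_iff]
    refine lintegral_congr_ae ?_
    filter_upwards [hae] with ξ hξ
    have hpos : 0 < ‖ξ‖ := norm_pos_iff.2 hξ
    have h2 : ENNReal.ofReal ‖ξ‖ ≠ 0 := by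
      rw [Ne, ENNReal.ofReal_eq_zero]; linarith
    rw [ENNReal.mul_rpow_of_nonneg _ _ (by norm_num), ENNReal.mul_rpow_of_nonneg _ _ (by norm_num),
      ← ENNReal.rpow_mul, ENNReal.ofReal_inv_of_pos hpos, ← ENNReal.rpow_neg_one,
      ← ENNReal.rpow_mul, mul_right_comm, ← ENNReal.rpow_add _ _ h2 ENNReal.ofReal_ne_top]
    congr 2
    ring
  rw [e0, e1] at hadd
  refine hadd.trans ?_
  rw [mul_add, add_comm]
  exact add_le_add (hone (by linarith) g₀) (hone (by linarith) g₁)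

/-- The amplitude of the free wave in terms of the Sobolev norms. The frequencies `|ξ| ~ 2^(-k)`
contribute to the amplitude at radius `2^l` with the factor `2^(-(β-1/2)(l-k)) min(1, 2^(l-k))`,
which decays geometrically for `l ≥ k` because `β > 1/2` and for `l ≤ k` because `β < 3/2`. -/
theorem exists_dataWeight_le (n : ℕ) {β : ℝ} (hβ₁ : 1 / 2 < β) (hβ₂ : β < 3 / 2) :
    ∃ A : ℝ≥0∞, A ≠ ⊤ ∧ ∀ g₀ g₁ : Space (2 * n + 3) → ℂ,
      AEStronglyMeasurable g₀ → AEStronglyMeasurable g₁ →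
      ell2 (fun l => (2 : ℝ≥0∞) ^ (-(β - 1 / 2) * l) * dataWeight n g₀ g₁ ((2 : ℝ) ^ (l + 3)))
        ≤ A * (densityNorm β g₀ + densityNorm (β - 1) g₁) := by
  obtain ⟨D, hD, hvol⟩ := exists_volume_frequency_le (2 * n + 3)
  set A₀ : ℝ≥0∞ := D ^ (1 / 2 : ℝ) * (2 : ℝ≥0∞) ^ ((n : ℝ) + 1 + β) with hA₀
  have hA₀top : A₀ ≠ ⊤ := ENNReal.mul_ne_top (ENNReal.rpow_ne_top_of_nonneg (by norm_num) hD)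
    (two_rpow_ne_top _)
  set M : ℝ≥0∞ := geomMass (β - 1 / 2) 0 + (2 : ℝ≥0∞) ^ (3 : ℝ) * geomMass (3 / 2 - β) 0 with hM
  have hMtop : M ≠ ⊤ := ENNReal.add_ne_top.2 ⟨geomMass_ne_top (by linarith) _,
    ENNReal.mul_ne_top (two_rpow_ne_top _) (geomMass_ne_top (by linarith) _)⟩
  refine ⟨A₀ * M * ENNReal.ofReal (2 * Real.pi), ENNReal.mul_ne_top
    (ENNReal.mul_ne_top hA₀top hMtop) ENNReal.ofReal_ne_top, ?_⟩
  intro g₀ g₁ h₀ h₁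
  set r : Space (2 * n + 3) → ℝ := fun ξ => ‖ξ‖⁻¹ with hr
  have hrm : Measurable r := by rw [hr]; fun_prop
  have hae : ∀ᵐ ξ : Space (2 * n + 3), ξ ≠ 0 := by simp [ae_iff]
  have hrpos : ∀ᵐ ξ : Space (2 * n + 3), 0 < r ξ :=
    hae.mono fun ξ hξ => inv_pos.2 (norm_pos_iff.2 hξ)
  set Φ : Space (2 * n + 3) → ℝ≥0∞ := fun ξ =>
    (ENNReal.ofReal ‖ξ‖⁻¹ * ‖g₁ ξ‖ₑ + ‖g₀ ξ‖ₑ) * ENNReal.ofReal ‖ξ‖ ^ β with hΦ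
  have hΦm : AEMeasurable Φ := by
    have h1 : Measurable fun ξ : Space (2 * n + 3) => ENNReal.ofReal ‖ξ‖⁻¹ := by fun_prop
    have h2 : Measurable fun ξ : Space (2 * n + 3) => ENNReal.ofReal ‖ξ‖ ^ β := by fun_prop
    exact ((h1.aemeasurable.mul h₁.enorm).add h₀.enorm).mul h2.aemeasurable
  set h : ℤ → ℝ≥0∞ := fun k => (∫⁻ ξ in dyadicSet r k, Φ ξ ^ (2 : ℝ)) ^ (1 / 2 : ℝ) with hh
  have hell : ell2 h ≤ ENNReal.ofReal (2 * Real.pi) *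
      (densityNorm β g₀ + densityNorm (β - 1) g₁) := by
    refine le_trans (le_of_eq ?_) (lintegral_weighted_le (by linarith : 0 ≤ β) h₀ h₁)
    rw [ell2, lintegral_eq_tsum_dyadic hrm hrpos]
    congr 1
    refine tsum_congr fun k => ?_
    rw [hh, ← ENNReal.rpow_mul, one_div_mul_cancel (two_ne_zero' ℝ), ENNReal.rpow_one]
  -- the kernel of one frequency shell
  have hker : ∀ l k : ℤ, (2 : ℝ≥0∞) ^ (-(β - 1 / 2) * ((l : ℝ) - k)) *
      ENNReal.ofReal (min 1 ((2 : ℝ) ^ (l + 3 - k)))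
      ≤ geomKernel (β - 1 / 2) 0 l k + (2 : ℝ≥0∞) ^ (3 : ℝ) * geomKernel (3 / 2 - β) 0 k l := by
    intro l k
    rcases le_total k l with hkl | hkl
    · refine le_add_right ?_
      rw [geomKernel, if_pos (by omega)]
      refine mul_le_of_le_one_right' ?_
      exact ENNReal.ofReal_le_one.2 (min_le_left _ _)
    · refine le_add_left ?_
      rw [geomKernel, if_pos (by omega), two_rpow_mul]
      calc _ ≤ (2 : ℝ≥0∞) ^ (-(β - 1 / 2) * ((l : ℝ) - k)) *
            ENNReal.ofReal ((2 : ℝ) ^ (l + 3 - k)) := by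
            gcongr
            exact min_le_right _ _
        _ = _ := by
            rw [two_zpow_eq_rpow, two_rpow_mul]
            congr 1
            push_cast
            ring
  have hshell : ∀ l k : ℤ, (2 : ℝ≥0∞) ^ (-(β - 1 / 2) * l) * ∫⁻ ξ in dyadicSet r k,
      (ENNReal.ofReal ‖ξ‖⁻¹ * ‖g₁ ξ‖ₑ + ‖g₀ ξ‖ₑ) *
        ENNReal.ofReal (‖ξ‖⁻¹ ^ (n + 1) * min 1 ((2 : ℝ) ^ (l + 3) * ‖ξ‖))
      ≤ (geomKernel (β - 1 / 2) 0 l k + (2 : ℝ≥0∞) ^ (3 : ℝ) * geomKernel (3 / 2 - β) 0 k l) *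
        (A₀ * h k) := by
    intro l k
    set m : ℝ≥0∞ := ENNReal.ofReal (min 1 ((2 : ℝ) ^ (l + 3 - k))) with hm
    have hpt : ∀ ξ ∈ dyadicSet r k, (ENNReal.ofReal ‖ξ‖⁻¹ * ‖g₁ ξ‖ₑ + ‖g₀ ξ‖ₑ) *
        ENNReal.ofReal (‖ξ‖⁻¹ ^ (n + 1) * min 1 ((2 : ℝ) ^ (l + 3) * ‖ξ‖))
        ≤ (2 : ℝ≥0∞) ^ (((n : ℝ) + 1 + β) * (k + 1)) * m * Φ ξ := by
      intro ξ hξ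
      have h1 : (2 : ℝ) ^ k ≤ ‖ξ‖⁻¹ := hξ.1
      have h2 : ‖ξ‖⁻¹ ≤ (2 : ℝ) ^ (k + 1) := hξ.2.le
      have h3 : (0 : ℝ) < 2 ^ k := by positivity
      have hpos : 0 < ‖ξ‖ := inv_pos.1 (h3.trans_le h1)
      have h4 : ‖ξ‖ ≤ 2 ^ (-k) := by
        have := inv_anti₀ h3 h1
        rwa [inv_inv, ← zpow_neg] at this
      have h5 : ENNReal.ofReal ‖ξ‖ ^ β * ENNReal.ofReal ‖ξ‖⁻¹ ^ β = 1 := by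
        rw [← ENNReal.mul_rpow_of_nonneg _ _ (by linarith), ← ENNReal.ofReal_mul hpos.le,
          mul_inv_cancel₀ hpos.ne', ENNReal.ofReal_one, ENNReal.one_rpow]
      have h6 : ENNReal.ofReal ‖ξ‖⁻¹ ^ β ≤ (2 : ℝ≥0∞) ^ (β * (k + 1)) := by
        calc _ ≤ ENNReal.ofReal ((2 : ℝ) ^ (k + 1)) ^ β := by gcongr
          _ = _ := by
            rw [two_zpow_eq_rpow, ← ENNReal.rpow_mul]
            push_cast
            congr 1
            ring
      have h7 : ENNReal.ofReal (‖ξ‖⁻¹ ^ (n + 1))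
          ≤ (2 : ℝ≥0∞) ^ (((n + 1 : ℕ) : ℝ) * ((k + 1 : ℤ) : ℝ)) :=
        ofReal_pow_le (by positivity) h2 _
      have h8 : ENNReal.ofReal (min 1 ((2 : ℝ) ^ (l + 3) * ‖ξ‖)) ≤ m := by
        refine ENNReal.ofReal_le_ofReal (min_le_min le_rfl ?_)
        rw [sub_eq_add_neg, zpow_add₀ two_ne_zero (l + 3)]
        gcongr
      rw [ENNReal.ofReal_mul (by positivity)]
      calc _ = Φ ξ * (ENNReal.ofReal ‖ξ‖⁻¹ ^ β * (ENNReal.ofReal (‖ξ‖⁻¹ ^ (n + 1)) *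
            ENNReal.ofReal (min 1 ((2 : ℝ) ^ (l + 3) * ‖ξ‖)))) := by
            simp only [hΦ]
            rw [mul_assoc _ (ENNReal.ofReal ‖ξ‖ ^ β), ← mul_assoc (ENNReal.ofReal ‖ξ‖ ^ β), h5,
              one_mul]
        _ ≤ Φ ξ * ((2 : ℝ≥0∞) ^ (β * (k + 1)) *
            ((2 : ℝ≥0∞) ^ (((n + 1 : ℕ) : ℝ) * ((k + 1 : ℤ) : ℝ)) * m)) := by
            gcongr
        _ = _ := by
            rw [← mul_assoc ((2 : ℝ≥0∞) ^ (β * (k + 1))), two_rpow_mul, mul_comm]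
            congr 3
            push_cast
            ring
    have hS : MeasurableSet (dyadicSet r k) := measurableSet_dyadicSet hrm k
    calc _ ≤ (2 : ℝ≥0∞) ^ (-(β - 1 / 2) * l) *
          ((2 : ℝ≥0∞) ^ (((n : ℝ) + 1 + β) * (k + 1)) * m *
            ((D * (2 : ℝ≥0∞) ^ (-((2 * n + 3 : ℕ) : ℝ) * k)) ^ (1 / 2 : ℝ) * h k)) := by
          refine mul_le_mul_right ((setLIntegral_mono' hS hpt).trans ?_) _
          rw [lintegral_const_mul'' _ hΦm.restrict]
          refine mul_le_mul_right ((setLIntegral_le_rpow_mul hΦm _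
            (by norm_num : (1 : ℝ) ≤ 2)).trans ?_) _
          rw [show (1 : ℝ) - 1 / 2 = 1 / 2 by norm_num]
          gcongr
          exact hvol k
      _ = ((2 : ℝ≥0∞) ^ (-(β - 1 / 2) * ((l : ℝ) - k)) * m) * (A₀ * h k) := by
          have hexp : -(β - 1 / 2) * (l : ℝ) + ((n : ℝ) + 1 + β) * (k + 1)
              + -((2 * n + 3 : ℕ) : ℝ) * k * (1 / 2)
              = -(β - 1 / 2) * ((l : ℝ) - k) + ((n : ℝ) + 1 + β) := by
            push_cast
            ring
          rw [ENNReal.mul_rpow_of_nonneg _ _ (by norm_num : (0 : ℝ) ≤ 1 / 2), ← ENNReal.rpow_mul,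
            hA₀]
          calc _ = ((2 : ℝ≥0∞) ^ (-(β - 1 / 2) * (l : ℝ)) *
                (2 : ℝ≥0∞) ^ (((n : ℝ) + 1 + β) * (k + 1)) *
                (2 : ℝ≥0∞) ^ (-((2 * n + 3 : ℕ) : ℝ) * k * (1 / 2))) *
                (m * D ^ (1 / 2 : ℝ) * h k) := by ring
            _ = ((2 : ℝ≥0∞) ^ (-(β - 1 / 2) * ((l : ℝ) - k)) *
                (2 : ℝ≥0∞) ^ ((n : ℝ) + 1 + β)) * (m * D ^ (1 / 2 : ℝ) * h k) := by
                rw [two_rpow_mul, two_rpow_mul, two_rpow_mul, hexp]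
            _ = _ := by ring
      _ ≤ _ := by
          gcongr
          exact hker l k
  have hweight : ∀ l : ℤ, (2 : ℝ≥0∞) ^ (-(β - 1 / 2) * l) *
      dataWeight n g₀ g₁ ((2 : ℝ) ^ (l + 3))
      ≤ (∑' k, geomKernel (β - 1 / 2) 0 l k * (A₀ * h k))
        + ∑' k, geomKernel (3 / 2 - β) 0 k l * ((2 : ℝ≥0∞) ^ (3 : ℝ) * (A₀ * h k)) := by
    intro l
    rw [dataWeight, lintegral_eq_tsum_dyadic hrm hrpos, ← ENNReal.tsum_mul_left,
      ← ENNReal.tsum_add]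
    refine ENNReal.tsum_le_tsum fun k => (hshell l k).trans (le_of_eq ?_)
    ring
  calc _ ≤ ell2 fun l => (∑' k, geomKernel (β - 1 / 2) 0 l k * (A₀ * h k))
        + ∑' k, geomKernel (3 / 2 - β) 0 k l * ((2 : ℝ≥0∞) ^ (3 : ℝ) * (A₀ * h k)) :=
        ell2_mono hweight
    _ ≤ geomMass (β - 1 / 2) 0 * (A₀ * ell2 h)
        + geomMass (3 / 2 - β) 0 * ((2 : ℝ≥0∞) ^ (3 : ℝ) * (A₀ * ell2 h)) := by
        refine (ell2_add_le _ _).trans (add_le_add ?_ ?_)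
        · refine (ell2_geomKernel_le _ _ _).trans (le_of_eq ?_)
          rw [ell2_const_mul]
        · refine (ell2_geomKernel_swap_le _ _ _).trans (le_of_eq ?_)
          rw [ell2_const_mul, ell2_const_mul]
    _ = A₀ * M * ell2 h := by rw [hM]; ring
    _ ≤ _ := by
        rw [mul_assoc (A₀ * M)]
        gcongr

/-! ### The channel estimate -/

/-- The estimate in terms of a choice of Fourier densities of the initial data. -/
theorem exists_channelNorm_le_density (n : ℕ) {p q pt qt β : ℝ} (hp : 1 ≤ p) (hq : 1 ≤ q)
    (hpt : 1 ≤ pt) (hqt : 1 ≤ qt) (hβ₁ : 1 / 2 < β) (hβ₂ : β < 3 / 2)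
    (hpq : 1 / p + (2 * n + 3) / q = (2 * n + 3) / 2 - β)
    (hpqt : 1 / pt + (2 * n + 3) / qt = (2 * n + 3) / 2 - β + 2) :
    ∃ A : ℝ≥0∞, A ≠ ⊤ ∧ ∀ {u F : Space (2 * n + 3) × ℝ → ℂ} {u₀ u₁ : 𝓢'(Space (2 * n + 3), ℂ)}
      {g₀ g₁ : Space (2 * n + 3) → ℂ}, IsRadial u → IsWaveSolution u F u₀ u₁ →
      HasFourierDensity u₀ g₀ → HasFourierDensity u₁ g₁ →
      channelNorm p q u
        ≤ A * (densityNorm β g₀ + densityNorm (β - 1) g₁ + channelNorm pt qt F) := by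
  obtain ⟨C, -, hC⟩ := exists_pointwise_bound n
  obtain ⟨A₁, hA₁, h₁⟩ := exists_channelNorm_le n hp hq hpq
  obtain ⟨A₂, hA₂, h₂⟩ := exists_sourceWeight_le n hpt hqt hβ₁ hpqt
  obtain ⟨A₃, hA₃, h₃⟩ := exists_dataWeight_le n hβ₁ hβ₂
  refine ⟨A₁ * (ENNReal.ofReal C * (A₃ + A₂)), ENNReal.mul_ne_top hA₁
    (ENNReal.mul_ne_top ENNReal.ofReal_ne_top (ENNReal.add_ne_top.2 ⟨hA₃, hA₂⟩)), ?_⟩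
  intro u F u₀ u₁ g₀ g₁ hu hsol hg₀ hg₁
  have hdata := h₃ g₀ g₁ hg₀.1.aestronglyMeasurable hg₁.1.aestronglyMeasurable
  have hsource := h₂ F hsol.locallyIntegrable_source.aestronglyMeasurable
  have hbound := h₁ u (fun R => ENNReal.ofReal C * amplitude n g₀ g₁ F R)
    (fun R R' hR => mul_le_mul_right (amplitude_mono n g₀ g₁ F hR) _) (by
      filter_upwards [hC hu hsol hg₀ hg₁] with z hz hzr
      refine (hz hzr).trans (le_of_eq ?_)
      rw [mul_comm C, ENNReal.ofReal_mul (by positivity), mul_assoc])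
  refine hbound.trans ?_
  rw [mul_assoc A₁]
  refine mul_le_mul_right ?_ _
  calc _ = ell2 fun l : ℤ => ENNReal.ofReal C *
        ((2 : ℝ≥0∞) ^ (-(β - 1 / 2) * l) * dataWeight n g₀ g₁ ((2 : ℝ) ^ (l + 3))
          + (2 : ℝ≥0∞) ^ (-(β - 1 / 2) * l) * sourceWeight n F ((2 : ℝ) ^ (l + 4))) := by
        congr 1
        funext l
        rw [amplitude, ← zpow_one_add₀ two_ne_zero, show 1 + (l + 3) = l + 4 by ring]
        ring
    _ ≤ ENNReal.ofReal C * (A₃ * (densityNorm β g₀ + densityNorm (β - 1) g₁)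
          + A₂ * channelNorm pt qt F) := by
        rw [ell2_const_mul]
        exact mul_le_mul_right ((ell2_add_le _ _).trans (add_le_add hdata hsource)) _
    _ ≤ _ := by
        rw [mul_assoc]
        refine mul_le_mul_right ?_ _
        rw [mul_add (A₃ + A₂)]
        gcongr
        · exact le_self_add
        · exact le_add_self

lemma homSobolevNorm_add_le_dataNorm {d : ℕ} (β : ℝ) (u₀ u₁ : 𝓢'(Space d, ℂ)) :
    homSobolevNorm β u₀ + homSobolevNorm (β - 1) u₁ ≤ 2 * dataNorm β u₀ u₁ := by
  have key : ∀ a b : ℝ≥0∞, a ≤ (a ^ (2 : ℝ) + b ^ (2 : ℝ)) ^ (1 / 2 : ℝ) := fun a b => by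
    calc a = (a ^ (2 : ℝ)) ^ (1 / 2 : ℝ) := by
          rw [← ENNReal.rpow_mul, mul_one_div_cancel (two_ne_zero' ℝ), ENNReal.rpow_one]
      _ ≤ _ := ENNReal.rpow_le_rpow le_self_add (by norm_num)
  rw [two_mul]
  refine add_le_add (key _ _) ?_
  rw [dataNorm, add_comm]
  exact key _ _

/-- A bound by every choice of Fourier densities is a bound by the Sobolev norms, also if there
is no density at all and the norm is infinite. -/
lemma le_homSobolevNorm_of_forall_density {d : ℕ} {s s' : ℝ} {f f' : 𝓢'(Space d, ℂ)}
    {a A K : ℝ≥0∞} (hA₀ : A ≠ 0) (hA : A ≠ ⊤) (h : ∀ g g', HasFourierDensity f g →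
      HasFourierDensity f' g' → a ≤ A * (densityNorm s g + densityNorm s' g' + K)) :
    a ≤ A * (homSobolevNorm s f + homSobolevNorm s' f' + K) := by
  simp only [homSobolevNorm, ENNReal.iInf_add, ENNReal.add_iInf, ENNReal.mul_iInf_of_ne hA₀ hA]
  exact le_iInf fun g => le_iInf fun hg => le_iInf fun g' => le_iInf fun hg' => h g' g hg' hg

end ChannelStrichartz

end

open ChannelStrichartz in
theorem mainTheorem1 (d : ℕ) (hd : 3 ≤ d) (hodd : Odd d)
    (β : ℝ) (hβ₁ : 1 / 2 < β) (hβ₂ : β < 3 / 2)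
    (p q pt qt : ℝ) (hp : 1 ≤ p) (hq : 1 ≤ q) (hpt : 1 ≤ pt) (hqt : 1 ≤ qt)
    (hpq : 1 / p + d / q = d / 2 - β)
    (hpqt : 1 / pt + d / qt = d / 2 - β + 2) :
    ∃ C : ℝ, 0 < C ∧
      ∀ (u F : ChannelStrichartz.Space d × ℝ → ℂ)
        (u₀ u₁ : TemperedDistribution (ChannelStrichartz.Space d) ℂ),
        ChannelStrichartz.IsRadial u →
        ChannelStrichartz.IsWaveSolution u F u₀ u₁ →
        ChannelStrichartz.channelNorm p q u ≤
          ENNReal.ofReal C *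
            (ChannelStrichartz.dataNorm β u₀ u₁ + ChannelStrichartz.channelNorm pt qt F) := by
  obtain ⟨n, rfl⟩ : ∃ n, d = 2 * n + 3 := by
    obtain ⟨k, rfl⟩ := hodd
    exact ⟨k - 1, by omega⟩
  push_cast at hpq hpqt
  obtain ⟨A, hA, h⟩ := exists_channelNorm_le_density n hp hq hpt hqt hβ₁ hβ₂ hpq hpqt
  refine ⟨(A.toReal + 1) * 2, by positivity, fun u F u₀ u₁ hu hsol => ?_⟩
  have hA' : A + 1 = ENNReal.ofReal (A.toReal + 1) := by
    rw [ENNReal.ofReal_add ENNReal.toReal_nonneg zero_le_one, ENNReal.ofReal_toReal hA,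
      ENNReal.ofReal_one]
  calc channelNorm p q u
      ≤ (A + 1) * (homSobolevNorm β u₀ + homSobolevNorm (β - 1) u₁ + channelNorm pt qt F) :=
        le_homSobolevNorm_of_forall_density (by simp) (ENNReal.add_ne_top.2 ⟨hA, by simp⟩)
          fun g₀ g₁ hg₀ hg₁ => (h hu hsol hg₀ hg₁).trans (mul_le_mul_left le_self_add _)
    _ ≤ (A + 1) * (2 * dataNorm β u₀ u₁ + 2 * channelNorm pt qt F) := by
        gcongr
        · exact homSobolevNorm_add_le_dataNorm β u₀ u₁
        · exact le_mul_of_one_le_left' one_le_two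
    _ = _ := by
        rw [hA', ENNReal.ofReal_mul (by positivity), ENNReal.ofReal_ofNat]
        ring
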